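/- Let $S^1=\mathbb R/2\pi\mathbb Z$ and let $g\in C^\infty(S^1;\mathbb C)$ be such that $\operatorname{Im} g$ has exactly two critical points, a minimum $a$ and a maximum $b$, with $a<b<a+2\pi$, $\operatorname{Im} g(a)<\operatorname{Im} g(b)$, both nondegenerate. For $h>0$ let $P_h=hD_x+g(x)$, $D_x=\frac1i\frac{d}{dx}$, be the unbounded operator on $L^2(S^1)$ with domain $H^1(S^1)$, and let $p(x,\xi)=\xi+g(x)$ on $T^*S^1$, $\{q,r\}=q'_\xi r'_x-q'_x r'_\xi$, $\Sigma=\overline{p(T^*S^1)}$, $d(z)=\operatorname{dist}(z,\partial\Sigma)$, $\langle g\rangle=\frac1{2\pi}\int_{S^1}g(y)\,dy$. For $z$ in the interior of $\Sigma$ there are points $x_\pm=x_\pm(z)\in\mathbb R$ with $\operatorname{Im} g(x_\pm)=\operatorname{Im} z$, $\pm\operatorname{Im} g'(x_\pm)<0$ and $x_--2\pi<x_+<x_-$; for any such choice put $\rho_\pm=(x_\pm,\operatorname{Re} z-\operatorname{Re} g(x_\pm))$ and $$S(z)=\min\Big(\operatorname{Im}\int_{x_+}^{x_-}(z-g(y))\,dy,\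 \operatorname{Im}\int_{x_+}^{x_--2\pi}(z-g(y))\,dy\Big).$$ For $z\in\mathbb C$, $h>0$ let $\Phi(z,h)=-\frac{2\pi i}{h}(z-\langle g\rangle)$ if $\operatorname{Im} z\le\langle\operatorname{Im} g\rangle$ and $\Phi(z,h)=\frac{2\pi i}{h}(z-\langle g\rangle)$ if $\operatorname{Im} z>\langle\operatorname{Im} g\rangle$ (so $\operatorname{Re}\Phi\le0$). Use the convention $\|(P_h-z)^{-1}\|=\infty$ for $z\in\sigma(P_h)$, and $0^{-1}=\infty$ for the factor $|1-e^{\Phi}|^{-1}$ below. Then: (i) There are constants $C_0,h_0>0$ depending only on $g$ such that, uniformly for $0<h\le h_0$ and $z\in\Sigma$ with $d(z)\ge C_0h^{2/3}$, $$\|(P_h-z)^{-1}\|=\frac{\sqrt\pi\,|1-e^{\Phi(z,h)}|^{-1}e^{S(z)/h}}{\sqrt h\,\big(\frac i2\{p,\overline p\}(\rho_+)\,\frac i2\{\overline p,p\}(\rho_-)\big)^{1/4}}\Big(1+O\big(d(z)^{-3/2}h\big)\Big),$$ and, for every $c>0$, uniformly for those $h,z$ that moreover satisfy $|\operatorname{Im}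 z-\langle\operatorname{Im} g\rangle|>c$, with constants depending only on $g$ and $c$, $$\|(P_h-z)^{-1}\|\asymp\frac{e^{S(z)/h}}{\sqrt h\,d(z)^{1/4}}.$$ (ii) In particular, for every $c>0$, the error factor in the first formula is $1+O(h)$, uniformly for $z\in\Sigma$ with $d(z)\ge c$ and all sufficiently small $h>0$. (iii) For all $z\in\mathbb C$ and $h>0$: $|1-e^{\Phi(z,h)}|=0$ if and only if $z\in\sigma(P_h)$, and $$|1-e^{\Phi(z,h)}|=1+O\big(e^{-\frac{2\pi}{h}|\operatorname{Im} z-\langle\operatorname{Im} g\rangle|}\big)\quad\text{uniformly in } z,h.$$ -/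

import Mathlib

open MeasureTheory
open scoped Real ENNReal ContDiff

noncomputable section

namespace Hager

instance factTwoPiPos : Fact (0 < 2 * π) := ⟨Real.two_pi_pos⟩

/-- The circle `S¹ = ℝ / 2πℤ`. -/
abbrev S1 : Type := AddCircle (2 * π)

/-- `L²(S¹)` with respect to Lebesgue measure (total mass `2π`). -/
abbrev L2S1 : Type := Lp ℂ 2 (volume : Measure S1)

/-- Smooth complex functions on the circle: the `2π`-periodic lift to `ℝ` is smooth. -/
def IsSmooth (φ : S1 → ℂ) : Prop := ContDiff ℝ ∞ (fun x : ℝ => φ (x : S1))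

/-- The function `Im g`, lifted to the real line. -/
def imLift (g : S1 → ℂ) (x : ℝ) : ℝ := (g (x : S1)).im

/-- `g` is smooth on the circle, `Im g` has exactly two critical points `a < b < a + 2π`, with
`Im g(a) < Im g(b)` (so that `a` is the minimum and `b` the maximum), both nondegenerate. -/
structure IsHagerPotential (g : S1 → ℂ) (a b : ℝ) : Prop where
  smooth : IsSmooth g
  lt : a < b
  lt_add : b < a + 2 * π
  critical : ∀ x ∈ Set.Ico a (a + 2 * π), deriv (imLift g) x = 0 ↔ x = a ∨ x = b
  im_lt : imLift g a < imLift g b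
  nondeg_min : deriv (deriv (imLift g)) a ≠ 0
  nondeg_max : deriv (deriv (imLift g)) b ≠ 0

/-! ### The operator `P_h = h D_x + g` -/

/-- `v` is the weak derivative of `u` on the circle; `φ'` is the derivative of the test
function `φ`. -/
def IsWeakDeriv (u v : L2S1) : Prop :=
  ∀ φ φ' : S1 → ℂ, IsSmooth φ → (∀ x : ℝ, HasDerivAt (fun y : ℝ => φ (y : S1)) (φ' (x : S1)) x) →
    ∫ x, u x * φ' x = -∫ x, v x * φ x

theorem continuous_of_lift {φ : S1 → ℂ} (h : Continuous (fun x : ℝ => φ (x : S1))) :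
    Continuous φ :=
  (QuotientAddGroup.isQuotientMap_mk (N := AddSubgroup.zmultiples (2 * π))).continuous_iff.2 h

theorem integrable_mul (u : L2S1) {φ : S1 → ℂ} (h : Continuous φ) :
    Integrable (fun x => u x * φ x) := by
  have hφ : MemLp φ 2 (volume : Measure S1) :=
    h.memLp_of_hasCompactSupport (HasCompactSupport.of_compactSpace φ)
  exact (Lp.memLp u).integrable_mul hφ

theorem continuous_deriv_of_isSmooth {φ φ' : S1 → ℂ} (h : IsSmooth φ)
    (h' : ∀ x : ℝ, HasDerivAt (fun y : ℝ => φ (y : S1)) (φ' (x : S1)) x) : Continuous φ' := by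
  apply continuous_of_lift
  have e : (fun x : ℝ => φ' (x : S1)) = deriv (fun y : ℝ => φ (y : S1)) :=
    funext fun x => (h' x).deriv.symm
  rw [e]
  exact ContDiff.continuous_deriv h (by simp)

theorem IsWeakDeriv.add {u v u₁ v₁ : L2S1} (h : IsWeakDeriv u v) (h₁ : IsWeakDeriv u₁ v₁) :
    IsWeakDeriv (u + u₁) (v + v₁) := by
  intro φ φ' hs hd
  have c := continuous_of_lift (ContDiff.continuous hs)
  have c' := continuous_deriv_of_isSmooth hs hd
  have e : ∀ (a b : L2S1) {ψ : S1 → ℂ}, Continuous ψ →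
      ∫ x, (a + b : L2S1) x * ψ x = (∫ x, a x * ψ x) + ∫ x, b x * ψ x := by
    intro a b ψ hψ
    rw [← integral_add (integrable_mul a hψ) (integrable_mul b hψ)]
    apply integral_congr_ae
    filter_upwards [Lp.coeFn_add a b] with x hx
    rw [hx, Pi.add_apply, add_mul]
  rw [e u u₁ c', e v v₁ c, h φ φ' hs hd, h₁ φ φ' hs hd]
  ring

theorem IsWeakDeriv.smul {u v : L2S1} (c : ℂ) (h : IsWeakDeriv u v) :
    IsWeakDeriv (c • u) (c • v) := by
  intro φ φ' hs hd
  have e : ∀ (a : L2S1) (ψ : S1 → ℂ), ∫ x, (c • a : L2S1) x * ψ x = c * ∫ x, a x * ψ x := by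
    intro a ψ
    rw [← integral_const_mul]
    apply integral_congr_ae
    filter_upwards [Lp.coeFn_smul c a] with x hx
    rw [hx, Pi.smul_apply, smul_eq_mul, mul_assoc]
  rw [e, e, h φ φ' hs hd]
  ring

/-- The graph of `P_h = h D_x + g`, `D_x = (1/i) d/dx`, with domain `H¹(S¹)`: the pairs `(u, f)`
of `L²` functions such that `u` has a weak derivative `v ∈ L²` and `f = (h/i) v + g u`. -/
def hagerGraph (g : S1 → ℂ) (h : ℝ) : Submodule ℂ (L2S1 × L2S1) where
  carrier := {q | ∃ v : L2S1, IsWeakDeriv q.1 v ∧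
    ∀ᵐ x, q.2 x = (h / Complex.I) * v x + g x * q.1 x}
  zero_mem' := by
    refine ⟨0, ?_, ?_⟩
    · intro φ φ' _ _
      simp
    · filter_upwards with x
      simp
  add_mem' := by
    rintro ⟨u, f⟩ ⟨u₁, f₁⟩ ⟨v, hv, hf⟩ ⟨v₁, hv₁, hf₁⟩
    refine ⟨v + v₁, hv.add hv₁, ?_⟩
    filter_upwards [hf, hf₁, Lp.coeFn_add u u₁, Lp.coeFn_add f f₁, Lp.coeFn_add v v₁]
      with x h1 h2 h3 h4 h5
    simp only [Prod.mk_add_mk, h3, h4, h5, Pi.add_apply] at *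
    rw [h1, h2]; ring
  smul_mem' := by
    rintro c ⟨u, f⟩ ⟨v, hv, hf⟩
    refine ⟨c • v, hv.smul c, ?_⟩
    filter_upwards [hf, Lp.coeFn_smul c u, Lp.coeFn_smul c f, Lp.coeFn_smul c v]
      with x h1 h3 h4 h5
    simp only [Prod.smul_mk, h3, h4, h5, Pi.smul_apply, smul_eq_mul] at *
    rw [h1]; ring

/-- The unbounded operator `P_h = h D_x + g` on `L²(S¹)` with domain `H¹(S¹)`. -/
def hagerOperator (g : S1 → ℂ) (h : ℝ) : L2S1 →ₗ.[ℂ] L2S1 := (hagerGraph g h).toLinearPMap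

/-- Weak derivatives are unique. -/
theorem IsWeakDeriv.eq_zero {v : L2S1} (hv : IsWeakDeriv 0 v) : v = 0 := by
  have hvol : (volume : Measure S1) = ENNReal.ofReal (2 * π) • AddCircle.haarAddCircle :=
    AddCircle.volume_eq_smul_haarAddCircle
  have hac' : (volume : Measure S1) ≪ AddCircle.haarAddCircle := by
    rw [hvol]; exact Measure.smul_absolutelyContinuous
  have hm : MemLp (v : S1 → ℂ) 2 AddCircle.haarAddCircle := (Lp.memLp v).haarAddCircle
  have hcoef : ∀ n : ℤ, fourierCoeff (v : S1 → ℂ) n = 0 := by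
    intro n
    have h1 := hv (fun x => fourier (-n) x) (fun x => 2 * π * Complex.I * ((-n : ℤ) : ℂ) /
      ((2 * π : ℝ) : ℂ) * fourier (-n) x) ?_ (fun x => hasDerivAt_fourier (2 * π) (-n) x)
    · have h0 : ∫ x : S1, (0 : L2S1) x * (2 * π * Complex.I * ((-n : ℤ) : ℂ) /
          ((2 * π : ℝ) : ℂ) * fourier (-n) x) = 0 := by
        rw [← integral_zero S1 ℂ]
        apply integral_congr_ae
        filter_upwards [Lp.coeFn_zero ℂ 2 (volume : Measure S1)] with x hx
        rw [hx]; simp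
      rw [h0] at h1
      have h2 : ∫ x : S1, v x * fourier (-n) x = 0 := by simpa using h1.symm
      have h3 : ∫ t : S1, fourier (-n) t • v t = 0 := by
        rw [← h2]
        congr 1
        ext x
        rw [smul_eq_mul, mul_comm]
      rw [fourierCoeff, AddCircle.integral_haarAddCircle, h3, smul_zero]
    · have : (fun x : ℝ => fourier (T := 2 * π) (-n) (x : S1)) =
          fun x : ℝ => Complex.exp (2 * π * Complex.I * ((-n : ℤ) : ℂ) * x / ((2 * π : ℝ) : ℂ)) := by
        ext x; rw [fourier_coe_apply]
      rw [IsSmooth, this]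
      have hx : ContDiff ℝ ∞ (fun x : ℝ => (x : ℂ)) := Complex.ofRealCLM.contDiff
      exact ((contDiff_const.mul hx).div_const _).cexp
  have hw : hm.toLp v = 0 := by
    rw [← (fourierBasis (T := 2 * π)).repr.map_eq_zero_iff]
    ext n
    rw [fourierBasis_repr]
    have : fourierCoeff (hm.toLp v : S1 → ℂ) n = fourierCoeff (v : S1 → ℂ) n := by
      unfold fourierCoeff
      apply integral_congr_ae
      filter_upwards [hm.coeFn_toLp] with x hx
      rw [hx]
    rw [this, hcoef]; simp
  apply Lp.ext
  have h5 : (v : S1 → ℂ) =ᵐ[AddCircle.haarAddCircle] 0 := by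
    refine hm.coeFn_toLp.symm.trans ?_
    rw [hw]
    exact Lp.coeFn_zero ℂ 2 AddCircle.haarAddCircle
  exact (hac'.ae_eq h5).trans (Lp.coeFn_zero ℂ 2 (volume : Measure S1)).symm

/-- `hagerGraph` is indeed the graph of the operator `hagerOperator`. -/
theorem hagerOperator_graph (g : S1 → ℂ) (h : ℝ) : (hagerOperator g h).graph = hagerGraph g h := by
  apply Submodule.toLinearPMap_graph_eq
  rintro ⟨u, f⟩ ⟨v, hv, hf⟩ (rfl : u = 0)
  have hv0 := hv.eq_zero
  subst hv0
  apply Lp.ext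
  filter_upwards [hf] with x h1
  simp [h1]

/-! ### Resolvents of unbounded operators -/

/-- The bounded operator `R` is the resolvent `(T - z)⁻¹`. -/
def IsResolventAt (T : L2S1 →ₗ.[ℂ] L2S1) (z : ℂ) (R : L2S1 →L[ℂ] L2S1) : Prop :=
  (∀ f : L2S1, ∃ hf : R f ∈ T.domain, T ⟨R f, hf⟩ - z • R f = f) ∧
    ∀ u : T.domain, R (T u - z • (u : L2S1)) = u

/-- The spectrum of an unbounded operator. -/
def spec (T : L2S1 →ₗ.[ℂ] L2S1) : Set ℂ := {z | ¬∃ R, IsResolventAt T z R}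

theorem IsResolventAt.unique {T : L2S1 →ₗ.[ℂ] L2S1} {z : ℂ} {R R' : L2S1 →L[ℂ] L2S1}
    (h : IsResolventAt T z R) (h' : IsResolventAt T z R') : R = R' := by
  ext1 f
  obtain ⟨hf, e⟩ := h.1 f
  have := h'.2 ⟨R f, hf⟩
  rw [e] at this
  exact this.symm

/-- `‖(T - z)⁻¹‖`, with the convention that it is `∞` when `z` is in the spectrum. (The resolvent
is unique if it exists, so the infimum is over at most one operator.) -/
def resolventNorm (T : L2S1 →ₗ.[ℂ] L2S1) (z : ℂ) : ℝ≥0∞ :=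
  ⨅ (R : L2S1 →L[ℂ] L2S1) (_ : IsResolventAt T z R), ‖R‖ₑ

theorem resolventNorm_eq {T : L2S1 →ₗ.[ℂ] L2S1} {z : ℂ} {R : L2S1 →L[ℂ] L2S1}
    (h : IsResolventAt T z R) : resolventNorm T z = ‖R‖ₑ :=
  le_antisymm (iInf₂_le R h) (le_iInf₂ fun _ h' => (h.unique h') ▸ le_rfl)

theorem resolventNorm_of_mem_spec {T : L2S1 →ₗ.[ℂ] L2S1} {z : ℂ} (h : z ∈ spec T) :
    resolventNorm T z = ⊤ := by
  simp only [resolventNorm, iInf_eq_top]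
  exact fun R hR => (h ⟨R, hR⟩).elim

/-! ### Phase space quantities -/

/-- The principal symbol `p(x, ξ) = ξ + g(x)` on `T*S¹`, with `x` lifted to the real line. -/
def symbol (g : S1 → ℂ) (x ξ : ℝ) : ℂ := (ξ : ℂ) + g (x : S1)

/-- The complex conjugate of the principal symbol. -/
def symbolConj (g : S1 → ℂ) (x ξ : ℝ) : ℂ := (starRingEnd ℂ) (symbol g x ξ)

/-- The Poisson bracket `{p, q} = ∂_ξ p ∂_x q - ∂_x p ∂_ξ q` at `(x, ξ)`. -/
def poisson (p q : ℝ → ℝ → ℂ) (x ξ : ℝ) : ℂ :=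
  deriv (fun η => p x η) ξ * deriv (fun y => q y ξ) x -
    deriv (fun y => p y ξ) x * deriv (fun η => q x η) ξ

/-- `Σ`, the closure of the range of the principal symbol. -/
def sigma (g : S1 → ℂ) : Set ℂ := closure {z | ∃ x ξ : ℝ, symbol g x ξ = z}

/-- `d(z) = dist(z, ∂Σ)`. -/
def dBdry (g : S1 → ℂ) (z : ℂ) : ℝ := Metric.infDist z (frontier (sigma g))

/-- `xp = x₊(z)` and `xm = x₋(z)`: `Im g(x_±) = Im z`, `± Im g'(x_±) < 0`, and the
representatives in `ℝ` are chosen with `x₋ - 2π < x₊ < x₋`. -/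
structure IsTurningPair (g : S1 → ℂ) (z : ℂ) (xp xm : ℝ) : Prop where
  im_plus : imLift g xp = z.im
  im_minus : imLift g xm = z.im
  deriv_plus : deriv (imLift g) xp < 0
  deriv_minus : 0 < deriv (imLift g) xm
  lt_plus : xm - 2 * π < xp
  plus_lt : xp < xm

/-- `ξ(x) = Re z - Re g(x)`, so that `ρ_± = (x_±, ξ(x_±))`. -/
def xiOf (g : S1 → ℂ) (z : ℂ) (x : ℝ) : ℝ := z.re - (g (x : S1)).re

/-- `(i/2) {p, p̄}(ρ₊) · (i/2) {p̄, p}(ρ₋)`; this complex number is real and positive. -/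
def bracketProduct (g : S1 → ℂ) (z : ℂ) (xp xm : ℝ) : ℝ :=
  (Complex.I / 2 * poisson (symbol g) (symbolConj g) xp (xiOf g z xp) *
    (Complex.I / 2 * poisson (symbolConj g) (symbol g) xm (xiOf g z xm))).re

/-- The imaginary part of the action between `ρ₊` and `ρ₋`. -/
def action (g : S1 → ℂ) (z : ℂ) (xp xm : ℝ) : ℝ :=
  min (∫ y in xp..xm, (z - g (y : S1))).im (∫ y in xp..(xm - 2 * π), (z - g (y : S1))).im

/-- The mean value `⟨g⟩`; its imaginary part is `⟨Im g⟩`. -/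
def mean (g : S1 → ℂ) : ℂ := (2 * π : ℂ)⁻¹ * ∫ y in (0 : ℝ)..2 * π, g (y : S1)

/-- The function `Φ(z, h)`. On the line `Im z = ⟨Im g⟩` both branches give the same
value of `|1 - e^Φ|`. -/
def phi (g : S1 → ℂ) (h : ℝ) (z : ℂ) : ℂ :=
  if z.im ≤ (mean g).im then -(2 * π * Complex.I / h) * (z - mean g)
  else (2 * π * Complex.I / h) * (z - mean g)

/-- `√π |1 - e^Φ|⁻¹ e^{S/h} / (√h ((i/2){p,p̄}(ρ₊) (i/2){p̄,p}(ρ₋))^{1/4})`, which is `∞` when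
`1 - e^Φ = 0`. -/
def leadingTerm (g : S1 → ℂ) (h : ℝ) (z : ℂ) (xp xm : ℝ) : ℝ≥0∞ :=
  ENNReal.ofReal (√π * Real.exp (action g z xp xm / h) /
      (√h * bracketProduct g z xp xm ^ (1 / 4 : ℝ))) *
    ‖1 - Complex.exp (phi g h z)‖ₑ⁻¹

end Hager

end

namespace Hager

/-! Write w = Im g and E = Im z. The equation (P_h − z)u = f is the first-order linear equation u' =
(i/h)((z − g)u + f), so the resolvent is explicit. Let e = exp((i/h)∫₀ˣ(z − g)) (`wave`), which is
multiplied over a period by λ = exp(2πi(z − ⟨g⟩)/h) (`multiplier`). Variation of constants gives,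
for λ ≠ 1, (P_h − z)⁻¹f(x) = (i/h)(1 − λ)⁻¹ e(x)∫_{x−2π}^{x} f/e (`exists_resolvent`); for λ = 1 the
function e is itself periodic and an eigenfunction. Everything reduces to the L² norm of `windowOp`,
whose kernel has modulus exp((F(y) − F(x))/h) with F = Im∫(z − g), F' = E − w.

Let E ≥ ⟨w⟩, so that F does not decrease over a period. F has its local maxima where w increases
through E (x₋ modulo 2π, called y₀) and its local minima where w decreases through E (x₊, called
x₁). The largest exponent, F(y₀) − F(x₁), is S(z). Cut the circle at the peak b of w, which lies
between y₀ and x₁. For x in (b, b+2π], the part y ≤ b of the window is dominated by a rank-one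
kernel on (b, b+2π] × (b−2π, b], of norm ‖e‖·‖1/e‖. These are two Laplace integrals, and they
produce e^{S/h}(A₁A₀)^{1/2} with A₁ = (πh/|w'(x₁)|)^{1/2} and A₀ = (πh/w'(y₀))^{1/2}. The part b < y
≤ x never sees the full drop of F; it falls short by a multiple of s³, s = √(w(b) − E), and the
Schur test makes it a relative O(h/s³). Testing on the conjugate of 1/e cut off near y₀ gives the
matching lower bound (`windowOp_upper`, `windowOp_lower`, `SinglePeak.exists_kernel_estimates`,
`SinglePeak.exists_windowOp_norm`).

Uniformity up to the boundary is a matter of scaling in s: the slopes of w at the turning points are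
of size s, F − F(x₁) ≥ c s (x − x₁)², F(b) − F(x₁) ≥ c s³, and the Laplace remainder is O(h/s³)
because the cubic term cancels by parity (`SinglePeak.exists_bounds`,
`SinglePeak.exists_laplace_local`). For E ≥ ⟨w⟩ one has s² ≍ d(z), hence the error O(h d^{−3/2}).
Levels below the mean are brought to the same situation by x ↦ −x and w ↦ −w(−x). This costs a
factor |λ|, which turns |1 − λ|⁻¹ into |1 − λ⁻¹|⁻¹ and accounts for the two branches of Φ. -/

/-! ### Laplace's method with explicit constants -/

/-- Mean value inequality on the segment from 0 to t. Iterated, it gives Taylor bounds in which one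
constant C serves at every order. -/
theorem abs_le_mul_pow_succ_of_deriv {f f' : ℝ → ℝ} {C r : ℝ} {n : ℕ} (hC : 0 ≤ C)
    (hf : ∀ t, HasDerivAt f (f' t) t) (h0 : f 0 = 0) (hb : ∀ t, |t| ≤ r → |f' t| ≤ C * |t| ^ n)
    {t : ℝ} (ht : |t| ≤ r) : |f t| ≤ C * |t| ^ (n + 1) := by
  have hsub : ∀ x ∈ Set.uIcc 0 t, |x| ≤ |t| := by
    intro x hx
    rw [Set.mem_uIcc] at hx
    rcases hx with hx | hx
    · rw [abs_of_nonneg hx.1]; exact hx.2.trans (le_abs_self t)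
    · rw [abs_of_nonpos hx.2]; exact (neg_le_neg hx.1).trans (neg_le_abs t)
  have := (convex_uIcc 0 t).norm_image_sub_le_of_norm_hasDerivWithin_le (f := f) (f' := f')
    (C := C * |t| ^ n) (fun x _ => (hf x).hasDerivWithinAt)
    (fun x hx => (hb x ((hsub x hx).trans ht)).trans
      (mul_le_mul_of_nonneg_left (pow_le_pow_left₀ (abs_nonneg x) (hsub x hx) n) hC)) Set.left_mem_uIcc Set.right_mem_uIcc
  rw [h0, sub_zero, sub_zero, Real.norm_eq_abs, Real.norm_eq_abs] at this
  rw [pow_succ, ← mul_assoc]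
  exact this

theorem abs_exp_neg_sub_one_add_le (s : ℝ) : |Real.exp (-s) - 1 + s| ≤ s ^ 2 * Real.exp |s| := by
  have h := Complex.norm_exp_sub_sum_le_norm_mul_exp ((-s : ℝ) : ℂ) 2
  have e : Complex.exp ((-s : ℝ) : ℂ) - ∑ m ∈ Finset.range 2, ((-s : ℝ) : ℂ) ^ m / (m.factorial : ℂ) =
      ((Real.exp (-s) - 1 + s : ℝ) : ℂ) := by
    simp [Finset.sum_range_succ]; ring
  rw [e, Complex.norm_real, Complex.norm_real, Real.norm_eq_abs, Real.norm_eq_abs, abs_neg,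
    sq_abs] at h
  exact h

/-- Half of the exponent pays for the polynomial factor, the other half survives as an integrable
weight. -/
theorem pow_mul_exp_neg_le (n : ℕ) {x y : ℝ} (hx : 0 ≤ x) (hy : 2 * x ≤ y) :
    x ^ n * Real.exp (-y) ≤ n.factorial * Real.exp (-x) := by
  have h1 := Real.pow_div_factorial_le_exp x hx n
  rw [div_le_iff₀ (by positivity)] at h1
  calc x ^ n * Real.exp (-y) ≤ (Real.exp x * n.factorial) * Real.exp (-(2 * x)) := by
        gcongr
    _ = n.factorial * (Real.exp x * Real.exp (-(2 * x))) := by ring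
    _ = n.factorial * Real.exp (-x) := by rw [← Real.exp_add]; ring_nf

theorem integral_exp_neg_mul_sq_quarter {κ h : ℝ} :
    ∫ t : ℝ, Real.exp (-(κ / (4 * h)) * t ^ 2) = 2 * √(π * h / κ) := by
  rw [integral_gaussian]
  have : π / (κ / (4 * h)) = 2 ^ 2 * (π * h / κ) := by
    rw [div_div_eq_mul_div]; ring
  rw [this, Real.sqrt_mul (by norm_num), Real.sqrt_sq (by norm_num)]

/-- Pointwise form of the tail bound for Gaussians. -/
theorem exp_neg_sq_le_of_le_abs {κ h r t : ℝ} (hκ : 0 < κ) (hh : 0 < h) (hr : 0 < r)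
    (ht : r ≤ |t|) : Real.exp (-(κ / h) * t ^ 2) ≤
      4 * h / (κ * r ^ 2) * Real.exp (-(κ / (4 * h)) * t ^ 2) := by
  have hx : 0 ≤ κ / (4 * h) * t ^ 2 := by positivity
  have h1 := pow_mul_exp_neg_le 1 hx (y := κ / h * t ^ 2) (by
    have : κ / h * t ^ 2 = 4 * (κ / (4 * h) * t ^ 2) := by field_simp
    rw [this]; linarith)
  have h2 : r ^ 2 ≤ t ^ 2 := by rw [← sq_abs t]; gcongr
  have h3 : 1 ≤ 4 * h / (κ * r ^ 2) * (κ / (4 * h) * t ^ 2) := by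
    have : 4 * h / (κ * r ^ 2) * (κ / (4 * h) * t ^ 2) = t ^ 2 / r ^ 2 := by field_simp
    rw [this, one_le_div (by positivity)]; exact h2
  calc Real.exp (-(κ / h) * t ^ 2) = 1 * Real.exp (-(κ / h * t ^ 2)) := by rw [one_mul]; ring_nf
    _ ≤ (4 * h / (κ * r ^ 2) * (κ / (4 * h) * t ^ 2)) * Real.exp (-(κ / h * t ^ 2)) := by gcongr
    _ = 4 * h / (κ * r ^ 2) * ((κ / (4 * h) * t ^ 2) ^ 1 * Real.exp (-(κ / h * t ^ 2))) := by ring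
    _ ≤ 4 * h / (κ * r ^ 2) * ((Nat.factorial 1 : ℕ) * Real.exp (-(κ / (4 * h) * t ^ 2))) := by
        gcongr
    _ = _ := by simp

theorem integrable_gaussian {κ h : ℝ} (hκ : 0 < κ) (hh : 0 < h) :
    Integrable fun t : ℝ => Real.exp (-(κ / h) * t ^ 2) :=
  integrable_exp_neg_mul_sq (by positivity)

theorem setIntegral_gaussian_tail_le {κ h r : ℝ} (hκ : 0 < κ) (hh : 0 < h) (hr : 0 < r)
    {s : Set ℝ} (hs : MeasurableSet s) (hsr : ∀ t ∈ s, r ≤ |t|) :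
    ∫ t in s, Real.exp (-(κ / h) * t ^ 2) ≤ 8 * h / (κ * r ^ 2) * √(π * h / κ) := by
  have i4 : Integrable fun t : ℝ => Real.exp (-(κ / (4 * h)) * t ^ 2) :=
    integrable_gaussian hκ (by positivity)
  calc ∫ t in s, Real.exp (-(κ / h) * t ^ 2)
      ≤ ∫ t in s, 4 * h / (κ * r ^ 2) * Real.exp (-(κ / (4 * h)) * t ^ 2) :=
        setIntegral_mono_on (integrable_gaussian hκ hh).integrableOn (i4.const_mul _).integrableOn
          hs fun t ht => exp_neg_sq_le_of_le_abs hκ hh hr (hsr t ht)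
    _ ≤ ∫ t, 4 * h / (κ * r ^ 2) * Real.exp (-(κ / (4 * h)) * t ^ 2) :=
        setIntegral_le_integral (i4.const_mul _)
          (Filter.Eventually.of_forall fun t => by positivity)
    _ = _ := by rw [integral_const_mul, integral_exp_neg_mul_sq_quarter]; ring

/-- With x = κt²/(4h) and s = 2(G − κt²/2)/h the integrand is e^{−4x}e^{−s}. The condition βr ≤ κ/4
gives |s| ≤ 2x, so the quadratic Taylor remainder s²e^{|s|} still leaves e^{−2x}. The β² term comes
from s², the M term from replacing s by its cubic part. -/
theorem abs_laplace_integrand_sub_le {G : ℝ → ℝ} {κ α M β r h : ℝ}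
    (hκ : 0 < κ) (hh : 0 < h) (hM : 0 ≤ M) (hβ0 : 0 ≤ β)
    (hT : ∀ t, |t| ≤ r → |G t - κ / 2 * t ^ 2 - α * t ^ 3| ≤ M * |t| ^ 4)
    (hβ : ∀ t, |t| ≤ r → |G t - κ / 2 * t ^ 2| ≤ β * |t| ^ 3) (hq : β * r ≤ κ / 4)
    {t : ℝ} (ht : |t| ≤ r) :
    |Real.exp (-(2 * G t / h)) - Real.exp (-(κ / h) * t ^ 2) * (1 - 2 * α / h * t ^ 3)| ≤
      (1536 * (β ^ 2 * h / κ ^ 3) + 64 * (M * h / κ ^ 2)) *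
        Real.exp (-(κ / (4 * h)) * t ^ 2) := by
  set s := 2 * (G t - κ / 2 * t ^ 2) / h with hs
  have t4 : |t| ^ 4 = (t ^ 2) ^ 2 := by rw [← sq_abs t]; ring
  have t6 : (|t| ^ 3) ^ 2 = (t ^ 2) ^ 3 := by rw [← sq_abs t]; ring
  set x := κ / (4 * h) * t ^ 2 with hx
  have hx0 : 0 ≤ x := by positivity
  have ht2 : t ^ 2 = 4 * h / κ * x := by rw [hx]; field_simp
  have hκx : κ / h * t ^ 2 = 4 * x := by rw [hx]; field_simp
  have hs1 : |s| ≤ 2 * (β * |t| ^ 3) / h := by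
    rw [hs, abs_div, abs_mul, abs_of_pos hh, abs_two]
    have := hβ t ht
    gcongr
  have hs2 : |s| ≤ 2 * x := by
    refine hs1.trans ?_
    have e1 : β * |t| ^ 3 = β * |t| * t ^ 2 := by rw [← sq_abs t]; ring
    have e2 : β * |t| ≤ κ / 4 := (mul_le_mul_of_nonneg_left ht hβ0).trans hq
    have e3 : β * |t| * t ^ 2 ≤ κ / 4 * t ^ 2 := by gcongr
    rw [e1, div_le_iff₀ hh, hx]
    have e4 : 2 * (κ / (4 * h) * t ^ 2) * h = κ / 2 * t ^ 2 := by field_simp; norm_num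
    rw [e4]; linarith
  have hsq : s ^ 2 ≤ 4 * β ^ 2 / h ^ 2 * (4 * h / κ) ^ 3 * x ^ 3 := by
    rw [← sq_abs]
    calc |s| ^ 2 ≤ (2 * (β * |t| ^ 3) / h) ^ 2 := by gcongr
      _ = 4 * β ^ 2 / h ^ 2 * (|t| ^ 3) ^ 2 := by ring
      _ = _ := by rw [t6, ht2]; ring
  have hlin : |s - 2 * α / h * t ^ 3| ≤ 2 * M / h * (4 * h / κ) ^ 2 * x ^ 2 := by
    have : s - 2 * α / h * t ^ 3 = 2 / h * (G t - κ / 2 * t ^ 2 - α * t ^ 3) := by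
      rw [hs]; ring
    rw [this, abs_mul, abs_of_pos (by positivity : (0 : ℝ) < 2 / h)]
    calc 2 / h * |G t - κ / 2 * t ^ 2 - α * t ^ 3| ≤ 2 / h * (M * |t| ^ 4) := by
          have := hT t ht; gcongr
      _ = _ := by rw [t4, ht2]; ring
  have hexp : Real.exp (-(2 * G t / h)) = Real.exp (-(4 * x)) * Real.exp (-s) := by
    rw [← Real.exp_add]; congr 1; rw [← hκx, hs]; field_simp; ring
  have hgauss : Real.exp (-(κ / h) * t ^ 2) = Real.exp (-(4 * x)) := by
    rw [← hκx]; ring_nf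
  have key : Real.exp (-(2 * G t / h)) - Real.exp (-(κ / h) * t ^ 2) * (1 - 2 * α / h * t ^ 3) =
      Real.exp (-(4 * x)) * ((Real.exp (-s) - 1 + s) - (s - 2 * α / h * t ^ 3)) := by
    rw [hexp, hgauss]; ring
  have hfin : Real.exp (-(κ / (4 * h)) * t ^ 2) = Real.exp (-x) := by rw [hx]; ring_nf
  rw [key, hfin, abs_mul, Real.abs_exp]
  have p3 := pow_mul_exp_neg_le 3 hx0 (y := 2 * x) le_rfl
  have p2 := pow_mul_exp_neg_le 2 hx0 (y := 4 * x) (by linarith)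
  have hE : Real.exp (-(4 * x)) * Real.exp |s| ≤ Real.exp (-(2 * x)) := by
    rw [← Real.exp_add]; apply Real.exp_le_exp.2; linarith
  calc Real.exp (-(4 * x)) * |(Real.exp (-s) - 1 + s) - (s - 2 * α / h * t ^ 3)|
      ≤ Real.exp (-(4 * x)) * (s ^ 2 * Real.exp |s| + 2 * M / h * (4 * h / κ) ^ 2 * x ^ 2) := by
        gcongr
        exact (abs_sub _ _).trans (add_le_add (abs_exp_neg_sub_one_add_le s) hlin)
    _ = s ^ 2 * (Real.exp (-(4 * x)) * Real.exp |s|) +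
        2 * M / h * (4 * h / κ) ^ 2 * (x ^ 2 * Real.exp (-(4 * x))) := by ring
    _ ≤ (4 * β ^ 2 / h ^ 2 * (4 * h / κ) ^ 3 * x ^ 3) * Real.exp (-(2 * x)) +
        2 * M / h * (4 * h / κ) ^ 2 * ((Nat.factorial 2 : ℕ) * Real.exp (-x)) := by gcongr
    _ = 4 * β ^ 2 / h ^ 2 * (4 * h / κ) ^ 3 * (x ^ 3 * Real.exp (-(2 * x))) +
        2 * M / h * (4 * h / κ) ^ 2 * ((Nat.factorial 2 : ℕ) * Real.exp (-x)) := by ring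
    _ ≤ 4 * β ^ 2 / h ^ 2 * (4 * h / κ) ^ 3 * ((Nat.factorial 3 : ℕ) * Real.exp (-x)) +
        2 * M / h * (4 * h / κ) ^ 2 * ((Nat.factorial 2 : ℕ) * Real.exp (-x)) := by gcongr
    _ = _ := by
        simp only [Nat.factorial]
        push_cast
        field_simp
        ring

/-- Laplace's method with an explicit remainder: the cubic term of the phase cancels by parity. -/
theorem abs_integral_exp_sub_gaussian_le {G : ℝ → ℝ} (hG : Continuous G) {κ α M β r h : ℝ}
    (hκ : 0 < κ) (hh : 0 < h) (hr : 0 < r) (hM : 0 ≤ M) (hβ0 : 0 ≤ β)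
    (hT : ∀ t, |t| ≤ r → |G t - κ / 2 * t ^ 2 - α * t ^ 3| ≤ M * |t| ^ 4)
    (hβ : ∀ t, |t| ≤ r → |G t - κ / 2 * t ^ 2| ≤ β * |t| ^ 3) (hq : β * r ≤ κ / 4) :
    |(∫ t in -r..r, Real.exp (-(2 * G t / h))) - √(π * h / κ)| ≤
      √(π * h / κ) * (3072 * (β ^ 2 * h / κ ^ 3) + 128 * (M * h / κ ^ 2) +
        8 * h / (κ * r ^ 2)) := by
  set A := 1536 * (β ^ 2 * h / κ ^ 3) + 64 * (M * h / κ ^ 2) with hA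
  have hA0 : 0 ≤ A := by positivity
  have hrr : -r ≤ r := by linarith
  have i4 : Integrable fun t : ℝ => Real.exp (-(κ / (4 * h)) * t ^ 2) :=
    integrable_gaussian hκ (by positivity)
  have i1 := integrable_gaussian hκ hh
  have c1 : Continuous fun t => Real.exp (-(2 * G t / h)) := by fun_prop
  have c2 : Continuous fun t : ℝ => Real.exp (-(κ / h) * t ^ 2) := by fun_prop
  have c3 : Continuous fun t : ℝ => Real.exp (-(κ / h) * t ^ 2) * (2 * α / h * t ^ 3) := by fun_prop
  have odd : ∫ t in -r..r, Real.exp (-(κ / h) * t ^ 2) * (2 * α / h * t ^ 3) = 0 := by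
    have := intervalIntegral.integral_comp_neg (a := -r) (b := r)
      (fun t : ℝ => Real.exp (-(κ / h) * t ^ 2) * (2 * α / h * t ^ 3))
    rw [neg_neg] at this
    have e : (fun t : ℝ => Real.exp (-(κ / h) * (-t) ^ 2) * (2 * α / h * (-t) ^ 3)) =
        fun t : ℝ => -(Real.exp (-(κ / h) * t ^ 2) * (2 * α / h * t ^ 3)) := by
      ext t; rw [neg_sq]; ring
    rw [e, intervalIntegral.integral_neg] at this
    linarith
  have h1 : |(∫ t in -r..r, Real.exp (-(2 * G t / h))) -
      ∫ t in -r..r, Real.exp (-(κ / h) * t ^ 2)| ≤ A * (2 * √(π * h / κ)) := by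
    have e : (∫ t in -r..r, Real.exp (-(2 * G t / h))) -
        ∫ t in -r..r, Real.exp (-(κ / h) * t ^ 2) =
        ∫ t in -r..r, (Real.exp (-(2 * G t / h)) -
          Real.exp (-(κ / h) * t ^ 2) * (1 - 2 * α / h * t ^ 3)) := by
      have e2 : (fun t : ℝ => Real.exp (-(2 * G t / h)) -
          Real.exp (-(κ / h) * t ^ 2) * (1 - 2 * α / h * t ^ 3)) =
          fun t => (Real.exp (-(2 * G t / h)) - Real.exp (-(κ / h) * t ^ 2)) +
            Real.exp (-(κ / h) * t ^ 2) * (2 * α / h * t ^ 3) := by ext t; ring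
      have c12 : Continuous fun t => Real.exp (-(2 * G t / h)) - Real.exp (-(κ / h) * t ^ 2) :=
        c1.sub c2
      rw [e2, intervalIntegral.integral_add (c12.intervalIntegrable _ _)
        (c3.intervalIntegrable _ _), odd, add_zero,
        intervalIntegral.integral_sub (c1.intervalIntegrable _ _) (c2.intervalIntegrable _ _)]
    rw [e, intervalIntegral.integral_of_le hrr]
    calc |∫ t in Set.Ioc (-r) r, (Real.exp (-(2 * G t / h)) -
          Real.exp (-(κ / h) * t ^ 2) * (1 - 2 * α / h * t ^ 3))|
        ≤ ∫ t in Set.Ioc (-r) r, A * Real.exp (-(κ / (4 * h)) * t ^ 2) := by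
          rw [← Real.norm_eq_abs]
          refine norm_integral_le_of_norm_le (i4.const_mul _).integrableOn ?_
          filter_upwards [ae_restrict_mem measurableSet_Ioc] with t ht
          exact abs_laplace_integrand_sub_le hκ hh hM hβ0 hT hβ hq
            (abs_le.2 ⟨ht.1.le, ht.2⟩)
      _ ≤ ∫ t, A * Real.exp (-(κ / (4 * h)) * t ^ 2) :=
          setIntegral_le_integral (i4.const_mul _)
            (Filter.Eventually.of_forall fun t => by positivity)
      _ = _ := by rw [integral_const_mul, integral_exp_neg_mul_sq_quarter]
  have h2 : |(∫ t in -r..r, Real.exp (-(κ / h) * t ^ 2)) - √(π * h / κ)| ≤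
      8 * h / (κ * r ^ 2) * √(π * h / κ) := by
    have e : √(π * h / κ) = ∫ t, Real.exp (-(κ / h) * t ^ 2) := by
      rw [integral_gaussian]; congr 1; field_simp
    have tail := setIntegral_gaussian_tail_le hκ hh hr (measurableSet_Ioc (a := -r) (b := r)).compl
      (fun t ht => by
        by_contra hlt
        rw [not_le, abs_lt] at hlt
        exact ht ⟨hlt.1, hlt.2.le⟩)
    have split := integral_add_compl (measurableSet_Ioc (a := -r) (b := r)) i1
    have pos : 0 ≤ ∫ t in (Set.Ioc (-r) r)ᶜ, Real.exp (-(κ / h) * t ^ 2) :=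
      integral_nonneg fun t => (Real.exp_pos _).le
    rw [intervalIntegral.integral_of_le hrr, abs_le]
    constructor <;> linarith
  calc _ ≤ A * (2 * √(π * h / κ)) + 8 * h / (κ * r ^ 2) * √(π * h / κ) := by
        refine (abs_sub_le _ _ _).trans (add_le_add h1 h2)
    _ = _ := by rw [hA]; ring

/-! ### Geometry of a periodic function with a single peak -/

theorem exists_abs_le_of_periodic {f : ℝ → ℝ} (hf : Continuous f)
    (hp : Function.Periodic f (2 * π)) : ∃ C > 0, ∀ x, |f x| ≤ C := by
  have hb := hp.isBounded_of_continuous Real.two_pi_pos.ne' hf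
  obtain ⟨C, hC0, hC⟩ := hb.exists_pos_norm_le
  exact ⟨C, hC0, fun x => hC _ ⟨x, rfl⟩⟩

theorem periodic_deriv {f : ℝ → ℝ} {T : ℝ} (hp : Function.Periodic f T) :
    Function.Periodic (deriv f) T := by
  intro x
  have : f = fun y => f (y + T) := funext fun y => (hp y).symm
  rw [← deriv_comp_add_const f T x, ← this]

theorem hasDerivAt_const_mul_sub_sq (c b x : ℝ) :
    HasDerivAt (fun x => c * (x - b) ^ 2) (c * (2 * (x - b))) x := by
  simpa using (((hasDerivAt_id x).sub_const b).pow 2).const_mul c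

/-- A smooth `2π`-periodic function which increases from its minimum at `a` to a nondegenerate
maximum at `b` and decreases from `b` to `a + 2π`. -/
structure SinglePeak (w : ℝ → ℝ) (a b : ℝ) : Prop where
  smooth : ContDiff ℝ ∞ w
  periodic : Function.Periodic w (2 * π)
  lt : a < b
  lt_add : b < a + 2 * π
  deriv_pos : ∀ x ∈ Set.Ioo a b, 0 < deriv w x
  deriv_neg : ∀ x ∈ Set.Ioo b (a + 2 * π), deriv w x < 0
  second_neg : deriv (deriv w) b < 0

namespace SinglePeak

variable {w : ℝ → ℝ} {a b : ℝ}

theorem continuous (hw : SinglePeak w a b) : Continuous w := hw.smooth.continuous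

theorem hasDerivAt (hw : SinglePeak w a b) (x : ℝ) : HasDerivAt w (deriv w x) x :=
  (hw.smooth.differentiable (by simp) x).hasDerivAt

theorem contDiff_deriv (hw : SinglePeak w a b) : ContDiff ℝ ∞ (deriv w) :=
  (contDiff_infty_iff_deriv.1 hw.smooth).2

theorem hasDerivAt_deriv (hw : SinglePeak w a b) (x : ℝ) :
    HasDerivAt (deriv w) (deriv (deriv w) x) x :=
  (hw.contDiff_deriv.differentiable (by simp) x).hasDerivAt

theorem contDiff_deriv2 (hw : SinglePeak w a b) : ContDiff ℝ ∞ (deriv (deriv w)) :=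
  (contDiff_infty_iff_deriv.1 hw.contDiff_deriv).2

theorem strictMonoOn (hw : SinglePeak w a b) : StrictMonoOn w (Set.Icc a b) :=
  strictMonoOn_of_deriv_pos (convex_Icc a b) hw.continuous.continuousOn
    (by rw [interior_Icc]; exact hw.deriv_pos)

theorem strictAntiOn (hw : SinglePeak w a b) : StrictAntiOn w (Set.Icc b (a + 2 * π)) :=
  strictAntiOn_of_deriv_neg (convex_Icc _ _) hw.continuous.continuousOn
    (by rw [interior_Icc]; exact hw.deriv_neg)

theorem deriv_eq_zero (hw : SinglePeak w a b) : deriv w b = 0 := by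
  apply IsLocalMax.deriv_eq_zero
  filter_upwards [Ioo_mem_nhds hw.lt hw.lt_add] with x hx
  rcases le_total x b with h | h
  · exact hw.strictMonoOn.monotoneOn ⟨hx.1.le, h⟩ (Set.right_mem_Icc.2 hw.lt.le) h
  · exact hw.strictAntiOn.antitoneOn (Set.left_mem_Icc.2 hw.lt_add.le) ⟨h, hx.2.le⟩ h

theorem reflect (hw : SinglePeak w a b) :
    SinglePeak (fun x => w (-x)) (-a - 2 * π) (-b) where
  smooth := hw.smooth.comp contDiff_neg
  periodic x := by
    have := hw.periodic (-(x + 2 * π))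
    dsimp only
    rw [← this]; ring_nf
  lt := by linarith [hw.lt_add]
  lt_add := by linarith [hw.lt]
  deriv_pos x hx := by
    rw [deriv_comp_neg]
    have := hw.deriv_neg (-x) ⟨by linarith [hx.2], by linarith [hx.1]⟩
    linarith
  deriv_neg x hx := by
    rw [deriv_comp_neg]
    have := hw.deriv_pos (-x) ⟨by linarith [hx.2], by linarith [hx.1]⟩
    linarith
  second_neg := by
    have e : deriv (fun x => w (-x)) = fun x => -deriv w (-x) := funext fun x => deriv_comp_neg w x
    have e2 : deriv (fun x => -deriv w (-x)) (-b) = deriv (deriv w) b := by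
      rw [deriv.fun_neg, deriv_comp_neg, neg_neg, neg_neg]
    rw [e, e2]; exact hw.second_neg

/-- Away from the minimum the slope of `w` to the right of the peak is at least linear. -/
theorem exists_deriv_le (hw : SinglePeak w a b) {T : ℝ} (hT : b < T) (hT' : T < a + 2 * π) :
    ∃ c > 0, ∀ x ∈ Set.Icc b T, deriv w x ≤ -(c * (x - b)) := by
  -- Close to b the difference quotients of w' tend to w''(b) < w''(b)/2; on the remaining interval
  -- [r, T] compactness gives a slope at most −m.
  have h1 : ∀ᶠ x in nhdsWithin b (Set.Ioi b), slope (deriv w) b x < deriv (deriv w) b / 2 := by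
    have := (hasDerivAt_iff_tendsto_slope.1 (hw.hasDerivAt_deriv b)).mono_left
      (nhdsWithin_mono b (fun x (hx : b < x) => hx.ne'))
    exact this.eventually (gt_mem_nhds (by linarith [hw.second_neg]))
  obtain ⟨r, hr, hr'⟩ := (mem_nhdsGT_iff_exists_Ioo_subset).1 h1
  rw [Set.mem_Ioi] at hr
  obtain ⟨m, hm⟩ : ∃ m > 0, ∀ x ∈ Set.Icc r T, deriv w x ≤ -m := by
    rcases lt_or_ge T r with hTr | hTr
    · exact ⟨1, one_pos, fun x hx => absurd (hx.1.trans hx.2) (not_le.2 hTr)⟩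
    · obtain ⟨y, hy, hmax⟩ := isCompact_Icc.exists_isMaxOn (Set.nonempty_Icc.2 hTr)
        hw.contDiff_deriv.continuous.continuousOn
      refine ⟨-deriv w y, ?_, fun x hx => by rw [neg_neg]; exact hmax hx⟩
      have := hw.deriv_neg y ⟨hr.trans_le hy.1, hy.2.trans_lt hT'⟩
      linarith
  have hTb : 0 < T - b := by linarith
  refine ⟨min (-deriv (deriv w) b / 2) (m / (T - b)),
    lt_min (by linarith [hw.second_neg]) (div_pos hm.1 hTb), fun x hx => ?_⟩
  rcases hx.1.eq_or_lt with rfl | hbx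
  · simp [hw.deriv_eq_zero]
  have hxb : 0 < x - b := by linarith
  rcases lt_or_ge x r with hxr | hxr
  · have := hr' ⟨hbx, hxr⟩
    rw [Set.mem_ofPred_eq, slope_def_field, hw.deriv_eq_zero, sub_zero, div_lt_iff₀ hxb] at this
    have h2 := mul_le_mul_of_nonneg_right (min_le_left (-deriv (deriv w) b / 2) (m / (T - b))) hxb.le
    linarith
  · have h2 := hm.2 x ⟨hxr, hx.2⟩
    have h3 : min (-deriv (deriv w) b / 2) (m / (T - b)) * (x - b) ≤ m / (T - b) * (T - b) := by
      gcongr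
      · exact (div_pos hm.1 hTb).le
      · exact min_le_right _ _
      · exact hx.2
    rw [div_mul_cancel₀ _ hTb.ne'] at h3
    linarith

/-- Integrated form of the linear slope bound. Unlike a comparison with w b alone, it compares the
values of w at any two points of [b, T]. -/
theorem antitoneOn_add_sq (hw : SinglePeak w a b) {c₁ T : ℝ}
    (hd : ∀ x ∈ Set.Icc b T, deriv w x ≤ -(c₁ * (x - b))) :
    AntitoneOn (fun x => w x + c₁ / 2 * (x - b) ^ 2) (Set.Icc b T) := by
  have hder : ∀ x, HasDerivAt (fun x => w x + c₁ / 2 * (x - b) ^ 2)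
      (deriv w x + c₁ / 2 * (2 * (x - b))) x := fun x =>
    (hw.hasDerivAt x).add (hasDerivAt_const_mul_sub_sq _ _ _)
  apply antitoneOn_of_deriv_nonpos (convex_Icc _ _)
  · exact fun x _ => (hder x).continuousAt.continuousWithinAt
  · exact fun x _ => (hder x).differentiableAt.differentiableWithinAt
  · intro x hx
    rw [interior_Icc] at hx
    rw [(hder x).deriv]
    linarith [hd x ⟨hx.1.le, hx.2.le⟩]

/-- Levels at or above e₀ > w a stay away from the minimum. The factor 2 leaves a margin δ between
the turning point and a + 2π − δ, and another δ up to the minimum. -/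
theorem exists_delta (hw : SinglePeak w a b) {e₀ : ℝ} (he : w a < e₀) :
    ∃ δ > 0, b < a + 2 * π - δ ∧ ∀ x ∈ Set.Icc b (a + 2 * π), e₀ ≤ w x → x ≤ a + 2 * π - 2 * δ := by
  have hwa : w (a + 2 * π) < e₀ := by rw [hw.periodic a]; exact he
  have h1 : ∀ᶠ x in nhds (a + 2 * π), w x < e₀ :=
    hw.continuous.continuousAt.eventually (gt_mem_nhds hwa)
  obtain ⟨r, hr, hr'⟩ := Metric.eventually_nhds_iff.1 h1
  have hb := hw.lt_add
  refine ⟨min (r / 4) ((a + 2 * π - b) / 2), lt_min (by linarith) (by linarith), ?_, ?_⟩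
  · have := min_le_right (r / 4) ((a + 2 * π - b) / 2); linarith
  · intro x hx hex
    by_contra hlt
    have hm := min_le_left (r / 4) ((a + 2 * π - b) / 2)
    refine absurd (hr' (y := x) ?_) (not_lt.2 hex)
    rw [Real.dist_eq, abs_lt]
    constructor <;> linarith [hx.2, not_le.1 hlt]

/-- Near the nondegenerate peak w b − w x ≍ (x − b)², so at a level at depth s² both the distance to
the peak and the slope are of size s, with constants uniform in the level. The slope then controls F
from below by a parabola of curvature of order s. -/
theorem exists_right_geometry (hw : SinglePeak w a b) {e₀ : ℝ} (he : w a < e₀) :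
    ∃ c > 0, ∃ C > 0, ∀ x₁ ∈ Set.Ioo b (a + 2 * π), e₀ ≤ w x₁ → ∀ s, s = √(w b - w x₁) →
      0 < s ∧ c * s ≤ x₁ - b ∧ x₁ - b ≤ C * s ∧ c * s ≤ -deriv w x₁ ∧ -deriv w x₁ ≤ C * s ∧
      c ≤ a + 2 * π - x₁ ∧
      ∀ F : ℝ → ℝ, (∀ x, HasDerivAt F (w x₁ - w x) x) → ∀ x ∈ Set.Icc b (a + 2 * π),
        c * s * (x - x₁) ^ 2 ≤ F x - F x₁ := by
  obtain ⟨δ, hδ, hbδ, hδ'⟩ := hw.exists_delta he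
  obtain ⟨c₁, hc₁, hd⟩ := hw.exists_deriv_le (T := a + 2 * π - δ) hbδ (by linarith)
  obtain ⟨C₂, hC₂, hsec⟩ := exists_abs_le_of_periodic hw.contDiff_deriv2.continuous
    (periodic_deriv (periodic_deriv hw.periodic))
  have hlip : ∀ x, |deriv w (b + x)| ≤ C₂ * |x| ^ (0 + 1) := fun x =>
    abs_le_mul_pow_succ_of_deriv (f := fun x => deriv w (b + x)) (r := |x|) hC₂.le
      (fun t => (hw.hasDerivAt_deriv (b + t)).comp_const_add b t) (by simp [hw.deriv_eq_zero])
      (fun t _ => by simpa using hsec _) le_rfl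
  have hup : ∀ x, |w (b + x) - w b| ≤ C₂ * |x| ^ (1 + 1) := fun x =>
    abs_le_mul_pow_succ_of_deriv (f := fun x => w (b + x) - w b) (r := |x|) hC₂.le
      (fun t => ((hw.hasDerivAt (b + t)).comp_const_add b t).sub_const _) (by simp)
      (fun t _ => hlip t) le_rfl
  have hJ := hw.antitoneOn_add_sq hd
  set T := a + 2 * π - δ with hT
  have hbT : b ∈ Set.Icc b T := ⟨le_rfl, hbδ.le⟩
  -- constants
  set q := √(c₁ / 2) with hq
  have hq0 : 0 < q := Real.sqrt_pos.2 (by positivity)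
  have hq2 : q ^ 2 = c₁ / 2 := Real.sq_sqrt (by positivity)
  set Q := √C₂ with hQ
  have hQ0 : 0 < Q := Real.sqrt_pos.2 hC₂
  have hQ2 : Q ^ 2 = C₂ := Real.sq_sqrt hC₂.le
  -- Beyond T only monotonicity of F is available. Since x − x₁ ≤ 2π and T − x₁ ≥ δ, the factor η
  -- makes η(x − x₁)² ≤ (T − x₁)², so the value at T suffices.
  set η := (δ / (2 * π)) ^ 2 with hη
  have hη0 : 0 < η := by positivity
  have hδπ : δ < 2 * π := by linarith [hw.lt]
  have hη1 : η ≤ 1 := by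
    rw [hη, sq_le_one_iff₀ (by positivity), div_le_one Real.two_pi_pos]; exact hδπ.le
  refine ⟨min (min Q⁻¹ (c₁ / Q)) (min (c₁ / 4 * Q⁻¹ * η) δ), by positivity, max q⁻¹ (C₂ / q),
    by positivity, ?_⟩
  intro x₁ hx₁ hex s hs
  have hx₁T : x₁ ≤ T - δ := by linarith [hδ' x₁ ⟨hx₁.1.le, hx₁.2.le⟩ hex]
  have hx₁m : x₁ ∈ Set.Icc b T := ⟨hx₁.1.le, by linarith⟩
  set t := x₁ - b with ht
  have ht0 : 0 < t := by linarith [hx₁.1]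
  have hD1 : c₁ / 2 * t ^ 2 ≤ w b - w x₁ := by
    have := hJ hbT hx₁m hx₁.1.le
    simp only [sub_self] at this
    linarith
  have hD2 : w b - w x₁ ≤ C₂ * t ^ 2 := by
    have := hup t
    rw [ht, add_sub_cancel, ← ht, abs_of_pos ht0, one_add_one_eq_two] at this
    linarith [neg_abs_le (w x₁ - w b)]
  have hDpos : 0 < w b - w x₁ := lt_of_lt_of_le (by positivity) hD1
  have hs0 : 0 < s := by rw [hs]; exact Real.sqrt_pos.2 hDpos
  have hs2 : s ^ 2 = w b - w x₁ := by rw [hs, Real.sq_sqrt hDpos.le]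
  have hsQ : s ≤ Q * t := by
    refine le_of_pow_le_pow_left₀ two_ne_zero (by positivity) ?_
    rw [hs2, mul_pow, hQ2]; exact hD2
  have hqs : q * t ≤ s := by
    refine le_of_pow_le_pow_left₀ two_ne_zero hs0.le ?_
    rw [hs2, mul_pow, hq2]; exact hD1
  have hst : Q⁻¹ * s ≤ t := by rw [inv_mul_le_iff₀ hQ0]; exact hsQ
  have hts : t ≤ q⁻¹ * s := by rw [le_inv_mul_iff₀ hq0]; exact hqs
  have hd1 : c₁ * t ≤ -deriv w x₁ := by linarith [hd x₁ hx₁m]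
  have hd2 : -deriv w x₁ ≤ C₂ * t := by
    have := hlip t
    rw [ht, add_sub_cancel, ← ht, abs_of_pos ht0, zero_add, pow_one] at this
    linarith [neg_abs_le (deriv w x₁)]
  refine ⟨hs0, ?_, ?_, ?_, ?_, ?_, ?_⟩
  · refine le_trans ?_ hst
    gcongr
    exact (min_le_left _ _).trans (min_le_left _ _)
  · refine hts.trans ?_
    gcongr
    exact le_max_left _ _
  · refine le_trans ?_ hd1
    calc _ ≤ c₁ / Q * s := by
          gcongr
          exact (min_le_left _ _).trans (min_le_right _ _)
      _ = c₁ * (Q⁻¹ * s) := by ring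
      _ ≤ c₁ * t := by gcongr
  · refine hd2.trans ?_
    calc C₂ * t ≤ C₂ * (q⁻¹ * s) := by gcongr
      _ = C₂ / q * s := by ring
      _ ≤ _ := by gcongr; exact le_max_right _ _
  · refine (min_le_right _ _).trans ((min_le_right _ _).trans ?_)
    linarith
  · intro F hF x hx
    set k := c₁ / 4 * t with hk
    have hk0 : 0 < k := by positivity
    have hcs : min (min Q⁻¹ (c₁ / Q)) (min (c₁ / 4 * Q⁻¹ * η) δ) * s ≤ k * η := by
      calc _ ≤ c₁ / 4 * Q⁻¹ * η * s := by
            gcongr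
            exact (min_le_right _ _).trans (min_le_left _ _)
        _ = c₁ / 4 * η * (Q⁻¹ * s) := by ring
        _ ≤ c₁ / 4 * η * t := by gcongr
        _ = k * η := by rw [hk]; ring
    have hder : ∀ y, HasDerivAt (fun y => F y - k * (y - x₁) ^ 2)
        (w x₁ - w y - k * (2 * (y - x₁))) y := fun y =>
      (hF y).sub (hasDerivAt_const_mul_sub_sq _ _ _)
    have hcont : ∀ S : Set ℝ, ContinuousOn (fun y => F y - k * (y - x₁) ^ 2) S := fun S y _ =>
      (hder y).continuousAt.continuousWithinAt
    have hdiff : ∀ S : Set ℝ, DifferentiableOn ℝ (fun y => F y - k * (y - x₁) ^ 2) S := fun S y _ =>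
      (hder y).differentiableAt.differentiableWithinAt
    -- Left of x₁, w y − w x₁ ≥ (c₁/2)(t² − (y − b)²) ≥ (c₁/2) t (x₁ − y), after dropping the
    -- nonnegative product (y − b)(x₁ − y). The right side is handled symmetrically below.
    have hanti : AntitoneOn (fun y => F y - k * (y - x₁) ^ 2) (Set.Icc b x₁) := by
      apply antitoneOn_of_deriv_nonpos (convex_Icc _ _) (hcont _) (hdiff _)
      intro y hy
      rw [interior_Icc] at hy
      rw [(hder y).deriv]
      have := hJ ⟨hy.1.le, by linarith [hy.2]⟩ hx₁m hy.2.le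
      dsimp only at this
      have h1 : 0 ≤ (y - b) * (x₁ - y) := mul_nonneg (by linarith [hy.1]) (by linarith [hy.2])
      have h2 : t ^ 2 - (y - b) ^ 2 = t * (x₁ - y) + (y - b) * (x₁ - y) := by rw [ht]; ring
      have h3 : c₁ / 2 * (t * (x₁ - y)) ≤ w y - w x₁ := by
        have : c₁ / 2 * (t * (x₁ - y)) ≤ c₁ / 2 * (t ^ 2 - (y - b) ^ 2) := by
          rw [h2]; gcongr; linarith
        linarith
      rw [hk]; linarith
    have hmono : MonotoneOn (fun y => F y - k * (y - x₁) ^ 2) (Set.Icc x₁ T) := by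
      apply monotoneOn_of_deriv_nonneg (convex_Icc _ _) (hcont _) (hdiff _)
      intro y hy
      rw [interior_Icc] at hy
      rw [(hder y).deriv]
      have := hJ hx₁m ⟨by linarith [hy.1, hx₁.1], hy.2.le⟩ hy.1.le
      dsimp only at this
      have h1 : 0 ≤ (y - b) * (y - x₁) :=
        mul_nonneg (by linarith [hy.1, hx₁.1]) (by linarith [hy.1])
      have h2 : (y - b) ^ 2 - t ^ 2 = t * (y - x₁) + (y - b) * (y - x₁) := by rw [ht]; ring
      have h3 : c₁ / 2 * (t * (y - x₁)) ≤ w x₁ - w y := by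
        have : c₁ / 2 * (t * (y - x₁)) ≤ c₁ / 2 * ((y - b) ^ 2 - t ^ 2) := by
          rw [h2]; gcongr; linarith
        linarith
      rw [hk]; linarith
    have hxT : x₁ ≤ T := hx₁m.2
    have near : ∀ y ∈ Set.Icc b T, k * (y - x₁) ^ 2 ≤ F y - F x₁ := by
      intro y hy
      rcases le_total y x₁ with h | h
      · have := hanti ⟨hy.1, h⟩ (Set.right_mem_Icc.2 hx₁.1.le) h
        simp only [sub_self] at this
        linarith
      · have := hmono (Set.left_mem_Icc.2 hxT) ⟨h, hy.2⟩ h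
        simp only [sub_self] at this
        linarith
    have weak : min (min Q⁻¹ (c₁ / Q)) (min (c₁ / 4 * Q⁻¹ * η) δ) * s * (x - x₁) ^ 2 ≤
        k * (η * (x - x₁) ^ 2) := by
      rw [← mul_assoc]; gcongr
    refine weak.trans ?_
    rcases le_total x T with h | h
    · refine le_trans ?_ (near x ⟨hx.1, h⟩)
      gcongr
      exact mul_le_of_le_one_left (by positivity) hη1
    · have hFm : MonotoneOn F (Set.Icc x₁ (a + 2 * π)) := by
        apply monotoneOn_of_deriv_nonneg (convex_Icc _ _)
          (fun y _ => (hF y).continuousAt.continuousWithinAt)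
          (fun y _ => (hF y).differentiableAt.differentiableWithinAt)
        intro y hy
        rw [interior_Icc] at hy
        rw [(hF y).deriv]
        linarith [hw.strictAntiOn ⟨hx₁.1.le, hx₁.2.le⟩ ⟨by linarith [hy.1, hx₁.1], hy.2.le⟩ hy.1]
      have h1 := hFm ⟨hxT, by linarith⟩ ⟨hxT.trans h, hx.2⟩ h
      have h2 := near T ⟨hbδ.le, le_rfl⟩
      have h3 : η * (x - x₁) ^ 2 ≤ (T - x₁) ^ 2 := by
        have h4 : x - x₁ ≤ 2 * π := by linarith [hx.2, hx₁.1, hw.lt]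
        calc η * (x - x₁) ^ 2 ≤ η * (2 * π) ^ 2 := by
              gcongr; linarith
          _ = δ ^ 2 := by rw [hη]; field_simp
          _ ≤ (T - x₁) ^ 2 := by gcongr; linarith
      have h5 : k * (η * (x - x₁) ^ 2) ≤ k * (T - x₁) ^ 2 := by gcongr
      linarith

theorem exists_quadratic_right (hw : SinglePeak w a b) :
    ∃ c > 0, ∀ x ∈ Set.Icc b (a + 2 * π), c * (x - b) ^ 2 ≤ w b - w x := by
  set T := (b + (a + 2 * π)) / 2 with hT
  have hbT : b < T := by linarith [hw.lt_add]
  have hTa : T < a + 2 * π := by linarith [hw.lt_add]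
  obtain ⟨c₁, hc₁, hd⟩ := hw.exists_deriv_le hbT hTa
  have hJ := hw.antitoneOn_add_sq hd
  have near : ∀ x ∈ Set.Icc b T, c₁ / 2 * (x - b) ^ 2 ≤ w b - w x := by
    intro x hx
    have := hJ (Set.left_mem_Icc.2 hbT.le) hx hx.1
    simp only [sub_self] at this
    linarith
  refine ⟨c₁ / 8, by positivity, fun x hx => ?_⟩
  rcases le_total x T with h | h
  · refine le_trans ?_ (near x ⟨hx.1, h⟩)
    gcongr; norm_num
  · have h1 := near T ⟨hbT.le, le_rfl⟩
    have h2 := hw.strictAntiOn.antitoneOn ⟨hbT.le, hTa.le⟩ hx h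
    have h3 : (x - b) ^ 2 ≤ (2 * (T - b)) ^ 2 := by
      gcongr
      · linarith [hx.1]
      · linarith [hx.2]
    have h4 : c₁ / 8 * (x - b) ^ 2 ≤ c₁ / 8 * (2 * (T - b)) ^ 2 := by gcongr
    have h5 : c₁ / 8 * (2 * (T - b)) ^ 2 = c₁ / 2 * (T - b) ^ 2 := by ring
    linarith

end SinglePeak

/-! ### Primitives of E − w at a level of the peak -/

/-- `E` is a level of the single-peak function `w` lying above `e₀`, attained at `y₀` on the left
and at `x₁` on the right of the peak `b`, and `F` is a primitive of `E - w` which does not decrease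
over a period. -/
structure PeakLevel (w : ℝ → ℝ) (a b e₀ E y₀ x₁ : ℝ) (F : ℝ → ℝ) : Prop where
  peak : SinglePeak w a b
  left_mem : y₀ ∈ Set.Ioo a b
  right_mem : x₁ ∈ Set.Ioo b (a + 2 * π)
  left_eq : w y₀ = E
  right_eq : w x₁ = E
  level : e₀ ≤ E
  hasDerivAt : ∀ x, HasDerivAt F (E - w x) x
  le_period : ∀ x, F x ≤ F (x + 2 * π)

namespace PeakLevel

variable {w : ℝ → ℝ} {a b e₀ E y₀ x₁ : ℝ} {F : ℝ → ℝ}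

/-- Reflection exchanges the two turning points; the sign in −F(−x) preserves both the form F' = E −
w and the growth over a period. Every estimate at x₁ thus yields its mirror at y₀. -/
theorem reflect (hl : PeakLevel w a b e₀ E y₀ x₁ F) :
    PeakLevel (fun x => w (-x)) (-a - 2 * π) (-b) e₀ E (-x₁) (-y₀) (fun x => -F (-x)) where
  peak := hl.peak.reflect
  left_mem := ⟨by linarith [hl.right_mem.2], by linarith [hl.right_mem.1]⟩
  right_mem := ⟨by linarith [hl.left_mem.2], by linarith [hl.left_mem.1]⟩
  left_eq := by rw [neg_neg]; exact hl.right_eq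
  right_eq := by rw [neg_neg]; exact hl.left_eq
  level := hl.level
  hasDerivAt x := by
    exact ((hl.hasDerivAt (-x)).comp x (hasDerivAt_neg x)).neg.congr_deriv (by ring)
  le_period x := by
    have := hl.le_period (-(x + 2 * π))
    rw [show -(x + 2 * π) + 2 * π = -x by ring] at this
    linarith

theorem shift (hl : PeakLevel w a b e₀ E y₀ x₁ F) :
    PeakLevel w a b e₀ E y₀ x₁ (fun x => F (x - 2 * π)) where
  __ := hl
  hasDerivAt x := by
    have := (hl.hasDerivAt (x - 2 * π)).comp_sub_const x (2 * π)
    rwa [hl.peak.periodic.sub_eq] at this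
  le_period x := by
    have := hl.le_period (x - 2 * π)
    rwa [show x - 2 * π + 2 * π = x + 2 * π - 2 * π by ring] at this

theorem continuous (hl : PeakLevel w a b e₀ E y₀ x₁ F) : Continuous F :=
  continuous_iff_continuousAt.2 fun x => (hl.hasDerivAt x).continuousAt

theorem shift_sub (hl : PeakLevel w a b e₀ E y₀ x₁ F) (x y : ℝ) :
    F (x + 2 * π) - F (y + 2 * π) = F x - F y := by
  have hd : ∀ x, HasDerivAt (fun x => F (x + 2 * π) - F x) 0 x := fun x => by
    have := ((hl.hasDerivAt (x + 2 * π)).comp_add_const x (2 * π)).sub (hl.hasDerivAt x)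
    rw [hl.peak.periodic x, sub_self] at this
    exact this
  have := is_const_of_deriv_eq_zero (fun x => (hd x).differentiableAt) (fun x => (hd x).deriv) x y
  linarith

theorem monotoneOn (hl : PeakLevel w a b e₀ E y₀ x₁ F) {D : Set ℝ} (hD : Convex ℝ D)
    (h : ∀ x ∈ D, w x ≤ E) : MonotoneOn F D := by
  apply monotoneOn_of_deriv_nonneg hD hl.continuous.continuousOn
    (fun y _ => (hl.hasDerivAt y).differentiableAt.differentiableWithinAt)
  intro y hy
  rw [(hl.hasDerivAt y).deriv]
  linarith [h y (interior_subset hy)]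

theorem antitoneOn (hl : PeakLevel w a b e₀ E y₀ x₁ F) {D : Set ℝ} (hD : Convex ℝ D)
    (h : ∀ x ∈ D, E ≤ w x) : AntitoneOn F D := by
  apply antitoneOn_of_deriv_nonpos hD hl.continuous.continuousOn
    (fun y _ => (hl.hasDerivAt y).differentiableAt.differentiableWithinAt)
  intro y hy
  rw [(hl.hasDerivAt y).deriv]
  linarith [h y (interior_subset hy)]

theorem antitoneOn_well (hl : PeakLevel w a b e₀ E y₀ x₁ F) : AntitoneOn F (Set.Icc y₀ x₁) := by
  have hy := hl.left_mem
  have hx := hl.right_mem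
  apply hl.antitoneOn (convex_Icc _ _)
  intro x hxm
  rcases le_total x b with h | h
  · rw [← hl.left_eq]
    exact hl.peak.strictMonoOn.monotoneOn ⟨hy.1.le, hy.2.le⟩ ⟨hy.1.le.trans hxm.1, h⟩ hxm.1
  · rw [← hl.right_eq]
    exact hl.peak.strictAntiOn.antitoneOn ⟨h, hxm.2.trans hx.2.le⟩ ⟨hx.1.le, hx.2.le⟩ hxm.2

theorem monotoneOn_hill (hl : PeakLevel w a b e₀ E y₀ x₁ F) :
    MonotoneOn F (Set.Icc x₁ (y₀ + 2 * π)) := by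
  have hy := hl.left_mem
  have hx := hl.right_mem
  apply hl.monotoneOn (convex_Icc _ _)
  intro x hxm
  rcases le_total x (a + 2 * π) with h | h
  · rw [← hl.right_eq]
    exact hl.peak.strictAntiOn.antitoneOn ⟨hx.1.le, hx.2.le⟩ ⟨hx.1.le.trans hxm.1, h⟩ hxm.1
  · rw [← hl.left_eq, ← hl.peak.periodic.sub_eq x]
    exact hl.peak.strictMonoOn.monotoneOn ⟨by linarith, by linarith [hxm.2, hy.2]⟩
      ⟨hy.1.le, hy.2.le⟩ (by linarith [hxm.2])

theorem antitoneOn_well_shift (hl : PeakLevel w a b e₀ E y₀ x₁ F) :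
    AntitoneOn F (Set.Icc (y₀ + 2 * π) (x₁ + 2 * π)) := by
  intro x hx y hy hxy
  have hx' : x - 2 * π ∈ Set.Icc y₀ x₁ := ⟨by linarith [hx.1], by linarith [hx.2]⟩
  have hy' : y - 2 * π ∈ Set.Icc y₀ x₁ := ⟨by linarith [hy.1], by linarith [hy.2]⟩
  have := hl.antitoneOn_well hx' hy' (by linarith)
  have h2 := hl.shift_sub (x - 2 * π) (y - 2 * π)
  rw [sub_add_cancel, sub_add_cancel] at h2
  linarith

/-- On a period starting at the peak, the largest drop of `F`. -/
theorem sub_le_max (hl : PeakLevel w a b e₀ E y₀ x₁ F) {x y : ℝ} (hby : b ≤ y) (hyx : y ≤ x)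
    (hxb : x ≤ b + 2 * π) : F y - F x ≤ max (F b - F x₁) (F y₀ - F b) := by
  have hy := hl.left_mem
  have hx := hl.right_mem
  have hlt := hl.peak.lt
  have hlt' := hl.peak.lt_add
  have hxy : x₁ ≤ y₀ + 2 * π := by linarith [hx.2, hy.1]
  have hbx : F b ≥ F x₁ := hl.antitoneOn_well ⟨hy.2.le, hx.1.le⟩ ⟨by linarith [hy.2, hx.1], le_rfl⟩ hx.1.le
  have top : ∀ u ∈ Set.Icc b (b + 2 * π), F u ≤ F b ∨ F u ≤ F (y₀ + 2 * π) := by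
    intro u hu
    rcases le_total u x₁ with h | h
    · exact Or.inl (hl.antitoneOn_well ⟨hy.2.le, hx.1.le⟩ ⟨by linarith [hy.2, hu.1], h⟩ hu.1)
    · rcases le_total u (y₀ + 2 * π) with h' | h'
      · exact Or.inr (hl.monotoneOn_hill ⟨h, h'⟩ ⟨hxy, le_rfl⟩ h')
      · exact Or.inr (hl.antitoneOn_well_shift ⟨le_rfl, by linarith [hy.2, hx.1]⟩
          ⟨h', by linarith [hu.2, hx.1]⟩ h')
  -- On [b, b + 2π] F falls to x₁, rises to y₀ + 2π and falls again. Before the second fall, no drop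
  -- exceeds the first one, F b − F x₁.
  rcases le_total x (y₀ + 2 * π) with h | h
  · refine le_max_of_le_left ?_
    rcases le_total y x₁ with h' | h'
    · have h1 : F y ≤ F b :=
        hl.antitoneOn_well ⟨hy.2.le, hx.1.le⟩ ⟨by linarith [hy.2], h'⟩ hby
      have h2 : F x₁ ≤ F x := by
        rcases le_total x x₁ with h3 | h3
        · exact hl.antitoneOn_well ⟨by linarith [hy.2], h3⟩ ⟨by linarith [hy.2, hx.1], le_rfl⟩ h3
        · exact hl.monotoneOn_hill ⟨le_rfl, hxy⟩ ⟨h3, h⟩ h3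
      linarith
    · have := hl.monotoneOn_hill ⟨h', hyx.trans h⟩ ⟨h'.trans hyx, h⟩ hyx
      linarith
  -- During the second fall F x ≥ F (b + 2π) ≥ F b, so only the excess of F y over F b counts; this
  -- is where the growth over a period enters.
  · have h1 : F (b + 2 * π) ≤ F x :=
      hl.antitoneOn_well_shift ⟨h, by linarith [hx.1]⟩ ⟨by linarith [hy.2], by linarith [hx.1]⟩ hxb
    have h2 := hl.le_period b
    have h3 := hl.shift_sub y₀ b
    rcases top y ⟨hby, hyx.trans hxb⟩ with h4 | h4
    · exact le_max_of_le_left (by linarith)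
    · exact le_max_of_le_right (by linarith)

end PeakLevel

/-- Extends the parabolic bound across the minimum of w to y₀ + 2π, where F still increases. The
last clause is that bound at x = b, where |b − x₁| ≥ cs; the gap s³ is the source of all exponential
gains. -/
theorem SinglePeak.exists_bounds {w : ℝ → ℝ} {a b e₀ : ℝ} (hw : SinglePeak w a b) (he : w a < e₀) :
    ∃ c > 0, ∃ C > 0, ∀ E y₀ x₁ F, PeakLevel w a b e₀ E y₀ x₁ F → ∀ s, s = √(w b - E) →
      0 < s ∧ s ≤ C ∧ c * s ≤ x₁ - b ∧ x₁ - b ≤ C * s ∧ c * s ≤ -deriv w x₁ ∧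
      -deriv w x₁ ≤ C * s ∧ c ≤ a + 2 * π - x₁ ∧
      (∀ x ∈ Set.Icc b (y₀ + 2 * π), c * s * (x - x₁) ^ 2 ≤ F x - F x₁) ∧
      c * s ^ 3 ≤ F b - F x₁ := by
  obtain ⟨c, hc, C, hC, H⟩ := hw.exists_right_geometry he
  -- Past a + 2π the bound at a + 2π is propagated by monotonicity; η absorbs the ratio between x −
  -- x₁ ≤ 2π and a + 2π − x₁ ≥ c.
  set η := min 1 ((c / (2 * π)) ^ 2) with hη
  have hη0 : 0 < η := by positivity
  have hη1 : η ≤ 1 := min_le_left _ _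
  refine ⟨min c (min (c * η) (c ^ 3)), by positivity, C + √(w b - w a), by positivity, ?_⟩
  intro E y₀ x₁ F hl s hs
  have hy := hl.left_mem
  have hx := hl.right_mem
  obtain ⟨hs0, h1, h2, h3, h4, h5, h6⟩ := H x₁ hl.right_mem (hl.right_eq ▸ hl.level) s
    (by rw [hl.right_eq]; exact hs)
  have hF := h6 F (by rw [hl.right_eq]; exact hl.hasDerivAt)
  set c' := min c (min (c * η) (c ^ 3)) with hc'
  have hc1 : c' ≤ c := min_le_left _ _
  have hc2 : c' ≤ c * η := (min_le_right _ _).trans (min_le_left _ _)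
  have hc3 : c' ≤ c ^ 3 := (min_le_right _ _).trans (min_le_right _ _)
  have hCC : C ≤ C + √(w b - w a) := by linarith [Real.sqrt_nonneg (w b - w a)]
  have hbound : ∀ x ∈ Set.Icc b (a + 2 * π), c * s * (x - x₁) ^ 2 ≤ F x - F x₁ := hF
  refine ⟨hs0, ?_, ?_, ?_, ?_, ?_, ?_, ?_, ?_⟩
  · have : s ≤ √(w b - w a) := by
      rw [hs]; apply Real.sqrt_le_sqrt
      linarith [he, hl.level]
    linarith
  · exact le_trans (by gcongr) h1
  · exact h2.trans (by gcongr)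
  · exact le_trans (by gcongr) h3
  · exact h4.trans (by gcongr)
  · exact hc1.trans h5
  · intro x hxm
    rcases le_total x (a + 2 * π) with h | h
    · refine le_trans ?_ (hbound x ⟨hxm.1, h⟩)
      gcongr
    · have k1 := hbound (a + 2 * π) ⟨hw.lt_add.le, le_rfl⟩
      have k2 := hl.monotoneOn_hill ⟨hx.2.le, by linarith [hy.1]⟩ ⟨hx.2.le.trans h, hxm.2⟩ h
      have k3 : η * (x - x₁) ^ 2 ≤ (a + 2 * π - x₁) ^ 2 := by
        have k4 : x - x₁ ≤ 2 * π := by linarith [hxm.2, hx.1, hy.2]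
        calc η * (x - x₁) ^ 2 ≤ (c / (2 * π)) ^ 2 * (2 * π) ^ 2 := by
              gcongr
              · exact min_le_right _ _
              · linarith [hx.2]
          _ = c ^ 2 := by field_simp
          _ ≤ (a + 2 * π - x₁) ^ 2 := by gcongr
      have k5 : c' * s * (x - x₁) ^ 2 ≤ c * s * (a + 2 * π - x₁) ^ 2 := by
        calc c' * s * (x - x₁) ^ 2 ≤ c * η * s * (x - x₁) ^ 2 := by gcongr
          _ = c * s * (η * (x - x₁) ^ 2) := by ring
          _ ≤ _ := by gcongr
      linarith
  · have k1 := hbound b ⟨le_rfl, hw.lt_add.le⟩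
    refine le_trans ?_ k1
    calc c' * s ^ 3 ≤ c ^ 3 * s ^ 3 := by gcongr
      _ = c * s * (c * s) ^ 2 := by ring
      _ ≤ c * s * (x₁ - b) ^ 2 := by gcongr
      _ = c * s * (b - x₁) ^ 2 := by ring

/-! ### Laplace integrals and kernel sums, uniformly in the level -/

/-- The curvature κ of F at x₁ is of size s while its third and fourth derivatives stay bounded, so
a radius proportional to s keeps the cubic term below the quadratic one. The three remainders h/κ³,
h/κ² and h/(κr²) are then all O(h/s³). -/
theorem SinglePeak.exists_laplace_local {w : ℝ → ℝ} {a b e₀ : ℝ} (hw : SinglePeak w a b)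
    (he : w a < e₀) :
    ∃ ρ₀ > 0, ∀ ρ > 0, ρ ≤ ρ₀ → ∃ C > 0, ∀ E y₀ x₁ F, PeakLevel w a b e₀ E y₀ x₁ F →
      ∀ s h, s = √(w b - E) → 0 < h →
      b ≤ x₁ - ρ * s ∧ x₁ + ρ * s ≤ a + 2 * π ∧
      |(∫ x in (x₁ - ρ * s)..(x₁ + ρ * s), Real.exp (-(2 * (F x - F x₁) / h))) -
        √(π * h / (-deriv w x₁))| ≤ √(π * h / (-deriv w x₁)) * (C * (h / s ^ 3)) := by
  obtain ⟨c, hc, C, hC, H⟩ := hw.exists_bounds he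
  obtain ⟨C₂, hC₂, hsec⟩ := exists_abs_le_of_periodic hw.contDiff_deriv2.continuous
    (periodic_deriv (periodic_deriv hw.periodic))
  obtain ⟨C₃, hC₃, hthird⟩ := exists_abs_le_of_periodic
    (contDiff_infty_iff_deriv.1 hw.contDiff_deriv2).2.continuous
    (periodic_deriv (periodic_deriv (periodic_deriv hw.periodic)))
  -- The three bounds on ρ ensure, in order, C₂ρs ≤ κ/4, x₁ − ρs ≥ b, and x₁ + ρs ≤ a + 2π.
  refine ⟨min (c / (4 * C₂)) (min c (c / C)), by positivity, fun ρ hρ hρ' =>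
    ⟨3072 * (C₂ ^ 2 / c ^ 3) + 128 * (C₃ * C / c ^ 2) + 8 / (c * ρ ^ 2), by positivity, ?_⟩⟩
  intro E y₀ x₁ F hl s h hs hh
  have hρ1 : ρ ≤ c / (4 * C₂) := hρ'.trans (min_le_left _ _)
  have hρ2 : ρ ≤ c := hρ'.trans ((min_le_right _ _).trans (min_le_left _ _))
  have hρ3 : ρ ≤ c / C := hρ'.trans ((min_le_right _ _).trans (min_le_right _ _))
  obtain ⟨hs0, hsC, h1, h2, h3, h4, h5, -, -⟩ := H E y₀ x₁ F hl s hs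
  set κ := -deriv w x₁ with hκ
  have hκ0 : 0 < κ := lt_of_lt_of_le (by positivity) h3
  have hr0 : 0 < ρ * s := by positivity
  refine ⟨?_, ?_, ?_⟩
  · have : ρ * s ≤ c * s := by gcongr
    linarith
  · have : ρ * s ≤ c / C * C := by gcongr
    rw [div_mul_cancel₀ _ hC.ne'] at this
    linarith
  have d0 : ∀ t, HasDerivAt (fun t => F (x₁ + t) - F x₁) (E - w (x₁ + t)) t := fun t =>
    ((hl.hasDerivAt (x₁ + t)).comp_const_add x₁ t).sub_const _
  -- A bound on w'' integrated three times (`b1` to `b3`) and a bound on w''' integrated four times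
  -- (`g1` to `g4`) give the quadratic and cubic Taylor estimates of F at x₁, with constants
  -- independent of the level.
  have b1 : ∀ t, |deriv w (x₁ + t) - deriv w x₁| ≤ C₂ * |t| ^ 1 := fun t =>
    abs_le_mul_pow_succ_of_deriv (f := fun t => deriv w (x₁ + t) - deriv w x₁) (r := |t|) (n := 0)
      hC₂.le (fun t => ((hw.hasDerivAt_deriv (x₁ + t)).comp_const_add x₁ t).sub_const _) (by simp)
      (fun t _ => by simpa using hsec _) le_rfl
  have b2 : ∀ t, |E - w (x₁ + t) - κ * t| ≤ C₂ * |t| ^ 2 := fun t =>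
    abs_le_mul_pow_succ_of_deriv (f := fun t => E - w (x₁ + t) - κ * t)
      (f' := fun t => -deriv w (x₁ + t) - κ * 1) (r := |t|) (n := 1)
      hC₂.le (fun t => (((hw.hasDerivAt (x₁ + t)).comp_const_add x₁ t).const_sub E).sub
        ((hasDerivAt_id t).const_mul κ)) (by simp [hl.right_eq])
      (fun t _ => by
        have := b1 t
        rw [← abs_neg] at this
        convert this using 2; rw [hκ]; ring) le_rfl
  have b3 : ∀ t, |F (x₁ + t) - F x₁ - κ / 2 * t ^ 2| ≤ C₂ * |t| ^ 3 := fun t =>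
    abs_le_mul_pow_succ_of_deriv (f := fun t => F (x₁ + t) - F x₁ - κ / 2 * t ^ 2)
      (f' := fun t => E - w (x₁ + t) - κ * t) (r := |t|) (n := 2)
      hC₂.le (fun t => by
        have := (d0 t).sub ((hasDerivAt_pow 2 t).const_mul (κ / 2))
        exact this.congr_deriv (by push_cast; ring)) (by simp)
      (fun t _ => b2 t) le_rfl
  set α := -(deriv (deriv w) x₁) / 6 with hα
  have g1 : ∀ t, |deriv (deriv w) (x₁ + t) - deriv (deriv w) x₁| ≤ C₃ * |t| ^ 1 := fun t =>
    abs_le_mul_pow_succ_of_deriv (f := fun t => deriv (deriv w) (x₁ + t) - deriv (deriv w) x₁)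
      (r := |t|) (n := 0) hC₃.le
      (fun t => (((hw.contDiff_deriv2.differentiable (by simp)
        (x₁ + t)).hasDerivAt).comp_const_add x₁ t).sub_const _) (by simp)
      (fun t _ => by simpa using hthird _) le_rfl
  have g2 : ∀ t, |-deriv w (x₁ + t) - κ - 6 * α * t| ≤ C₃ * |t| ^ 2 := fun t =>
    abs_le_mul_pow_succ_of_deriv (f := fun t => -deriv w (x₁ + t) - κ - 6 * α * t)
      (f' := fun t => -deriv (deriv w) (x₁ + t) - 6 * α * 1) (r := |t|) (n := 1)
      hC₃.le (fun t => ((((hw.hasDerivAt_deriv (x₁ + t)).comp_const_add x₁ t).neg).sub_const κ).sub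
        ((hasDerivAt_id t).const_mul (6 * α))) (by simp [hκ])
      (fun t _ => by
        have := g1 t
        rw [← abs_neg] at this
        convert this using 2; rw [hα]; ring) le_rfl
  have g3 : ∀ t, |E - w (x₁ + t) - κ * t - 3 * α * t ^ 2| ≤ C₃ * |t| ^ 3 := fun t =>
    abs_le_mul_pow_succ_of_deriv (f := fun t => E - w (x₁ + t) - κ * t - 3 * α * t ^ 2)
      (f' := fun t => -deriv w (x₁ + t) - κ - 6 * α * t) (r := |t|) (n := 2)
      hC₃.le (fun t => by
        have := ((((hw.hasDerivAt (x₁ + t)).comp_const_add x₁ t).const_sub E).sub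
          ((hasDerivAt_id t).const_mul κ)).sub ((hasDerivAt_pow 2 t).const_mul (3 * α))
        exact this.congr_deriv (by push_cast; ring)) (by simp [hl.right_eq])
      (fun t _ => g2 t) le_rfl
  have g4 : ∀ t, |F (x₁ + t) - F x₁ - κ / 2 * t ^ 2 - α * t ^ 3| ≤ C₃ * |t| ^ 4 := fun t =>
    abs_le_mul_pow_succ_of_deriv (f := fun t => F (x₁ + t) - F x₁ - κ / 2 * t ^ 2 - α * t ^ 3)
      (f' := fun t => E - w (x₁ + t) - κ * t - 3 * α * t ^ 2) (r := |t|) (n := 3)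
      hC₃.le (fun t => by
        have := ((d0 t).sub ((hasDerivAt_pow 2 t).const_mul (κ / 2))).sub
          ((hasDerivAt_pow 3 t).const_mul α)
        exact this.congr_deriv (by push_cast; ring)) (by simp)
      (fun t _ => g3 t) le_rfl
  have hcont : Continuous fun t => F (x₁ + t) - F x₁ := by
    have := hl.continuous; fun_prop
  have hq : C₂ * (ρ * s) ≤ κ / 4 := by
    have : C₂ * (ρ * s) ≤ C₂ * (c / (4 * C₂) * s) := by gcongr
    have e : C₂ * (c / (4 * C₂) * s) = c * s / 4 := by field_simp
    linarith
  have key := abs_integral_exp_sub_gaussian_le hcont hκ0 hh hr0 hC₃.le hC₂.le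
    (fun t _ => g4 t) (fun t _ => b3 t) hq
  have hsub := intervalIntegral.integral_comp_add_left (a := -(ρ * s)) (b := ρ * s)
    (fun x => Real.exp (-(2 * (F x - F x₁) / h))) x₁
  rw [← sub_eq_add_neg] at hsub
  rw [← hsub]
  refine key.trans ?_
  gcongr
  have e1 : C₂ ^ 2 * h / κ ^ 3 ≤ C₂ ^ 2 * h / (c * s) ^ 3 := by gcongr
  -- This term is only of order h/s²; the bound s ≤ C weakens it to the common form h/s³.
  have e2 : C₃ * h / κ ^ 2 ≤ C₃ * C / c ^ 2 * (h / s ^ 3) := by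
    calc C₃ * h / κ ^ 2 ≤ C₃ * h / (c * s) ^ 2 := by gcongr
      _ = C₃ * s / c ^ 2 * (h / s ^ 3) := by field_simp
      _ ≤ _ := by gcongr
  have e3 : 8 * h / (κ * (ρ * s) ^ 2) ≤ 8 * h / (c * s * (ρ * s) ^ 2) := by gcongr
  have e4 : C₂ ^ 2 * h / (c * s) ^ 3 = C₂ ^ 2 / c ^ 3 * (h / s ^ 3) := by field_simp
  have e5 : 8 * h / (c * s * (ρ * s) ^ 2) = 8 / (c * ρ ^ 2) * (h / s ^ 3) := by field_simp
  rw [e4] at e1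
  rw [e5] at e3
  linarith

theorem exp_neg_le_two_div_sq {y : ℝ} (hy : 0 < y) : Real.exp (-y) ≤ 2 / y ^ 2 := by
  have h1 := Real.pow_div_factorial_le_exp y hy.le 2
  rw [Real.exp_neg, inv_le_comm₀ (Real.exp_pos _) (by positivity), inv_div]
  simpa using h1

/-- For h ≤ s³ one has (h/s²)² ≤ h/s, and h/s is at most C times h/κ. It lets h/s² be absorbed into
the Gaussian width. -/
theorem div_sq_le_sqrt_mul_sqrt {h s κ C : ℝ} (hh : 0 < h) (hs : 0 < s) (hhs : h ≤ s ^ 3)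
    (hκ : 0 < κ) (hC : 0 < C) (hκC : κ ≤ C * s) : h / s ^ 2 ≤ √C * √(π * h / κ) := by
  rw [← Real.sqrt_mul hC.le]
  apply Real.le_sqrt_of_sq_le
  calc (h / s ^ 2) ^ 2 = h * h / s ^ 4 := by rw [div_pow]; ring
    _ ≤ h * s ^ 3 / s ^ 4 := by gcongr
    _ = C * (1 * h / (C * s)) := by field_simp
    _ ≤ C * (π * h / κ) := by
        gcongr
        linarith [Real.pi_gt_three]

/-- `s e^{-c s³/h}` is small compared with `h / s²`. -/
theorem mul_exp_neg_cube_le {h s c : ℝ} (hh : 0 < h) (hs : 0 < s) (hc : 0 < c) :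
    s * Real.exp (-(c * s ^ 3 / h)) ≤ 2 / c ^ 2 * (h / s ^ 3) * (h / s ^ 2) := by
  have := exp_neg_le_two_div_sq (y := c * s ^ 3 / h) (by positivity)
  calc s * Real.exp (-(c * s ^ 3 / h)) ≤ s * (2 / (c * s ^ 3 / h) ^ 2) := by gcongr
    _ = _ := by field_simp

theorem integral_exp_le_gaussian_tail {F : ℝ → ℝ} (hF : Continuous F) {k h r x₁ p q : ℝ}
    (hk : 0 < k) (hh : 0 < h) (hr : 0 < r) (hpq : p ≤ q)
    (hfar : ∀ x ∈ Set.Ioc p q, r ≤ |x - x₁|)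
    (hb : ∀ x ∈ Set.Icc p q, k * (x - x₁) ^ 2 ≤ F x - F x₁) :
    ∫ x in p..q, Real.exp (-(2 * (F x - F x₁) / h)) ≤
      8 * h / (2 * k * r ^ 2) * √(π * h / (2 * k)) := by
  have c1 : Continuous fun x => Real.exp (-(2 * (F x - F x₁) / h)) := by fun_prop
  have c2 : Continuous fun x => Real.exp (-(2 * k / h) * (x - x₁) ^ 2) := by fun_prop
  calc ∫ x in p..q, Real.exp (-(2 * (F x - F x₁) / h))
      ≤ ∫ x in p..q, Real.exp (-(2 * k / h) * (x - x₁) ^ 2) := by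
        apply intervalIntegral.integral_mono_on hpq (c1.intervalIntegrable _ _)
          (c2.intervalIntegrable _ _)
        intro x hx
        apply Real.exp_le_exp.2
        have h1 := hb x hx
        have h2 : -(2 * k / h) * (x - x₁) ^ 2 = -(2 * (k * (x - x₁) ^ 2) / h) := by ring
        rw [h2]
        gcongr
    _ = ∫ t in (p - x₁)..(q - x₁), Real.exp (-(2 * k / h) * t ^ 2) :=
        intervalIntegral.integral_comp_sub_right (fun t => Real.exp (-(2 * k / h) * t ^ 2)) x₁
    _ ≤ _ := by
        rw [intervalIntegral.integral_of_le (by linarith)]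
        apply setIntegral_gaussian_tail_le (by positivity) hh hr measurableSet_Ioc
        intro t ht
        have := hfar (t + x₁) ⟨by linarith [ht.1], by linarith [ht.2]⟩
        rwa [add_sub_cancel_right] at this

theorem SinglePeak.reflect_apply_lt {w : ℝ → ℝ} {a b e₀ : ℝ} (hw : SinglePeak w a b)
    (he : w a < e₀) : (fun x => w (-x)) (-a - 2 * π) < e₀ := by
  dsimp only
  rw [show -(-a - 2 * π) = a + 2 * π by ring, hw.periodic a]
  exact he

/-- Four pieces: the core around x₁, a Gaussian tail on each side of it, and the stretch from y₀ +
2π to b + 2π where the parabolic bound is not available. On that last piece, of length O(s), F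
exceeds F x₁ by at least c s³. -/
theorem SinglePeak.exists_laplace_upper {w : ℝ → ℝ} {a b e₀ : ℝ} (hw : SinglePeak w a b)
    (he : w a < e₀) :
    ∃ C > 0, ∀ E y₀ x₁ F, PeakLevel w a b e₀ E y₀ x₁ F → ∀ s h, s = √(w b - E) → 0 < h →
      h ≤ s ^ 3 → ∫ x in b..(b + 2 * π), Real.exp (-(2 * (F x - F x₁) / h)) ≤
        √(π * h / (-deriv w x₁)) * (1 + C * (h / s ^ 3)) := by
  obtain ⟨c, hc, C, hC, H⟩ := hw.exists_bounds he
  obtain ⟨_, _, C', hC', H'⟩ := hw.reflect.exists_bounds (hw.reflect_apply_lt he)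
  obtain ⟨ρ, hρ, hloc⟩ := hw.exists_laplace_local he
  obtain ⟨C₁, hC₁, hloc⟩ := hloc ρ hρ le_rfl
  refine ⟨C₁ + 2 * (8 / (2 * c * ρ ^ 2) * √(C / (2 * c))) + C' * (2 / (2 * c) ^ 2 * √C),
    by positivity, ?_⟩
  intro E y₀ x₁ F hl s h hs hh hhs
  obtain ⟨hs0, hsC, h1, h2, h3, h4, h5, h6, h7⟩ := H E y₀ x₁ F hl s hs
  -- The mirrored bounds are needed only for b − y₀ ≤ C's, the length of the last piece.
  obtain ⟨-, -, -, hy, -, -, -, -, -⟩ := H' E (-x₁) (-y₀) _ hl.reflect s (by simpa using hs)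
  obtain ⟨l1, l2, l3⟩ := hloc E y₀ x₁ F hl s h hs hh
  set κ := -deriv w x₁ with hκ
  have hκ0 : 0 < κ := lt_of_lt_of_le (by positivity) h3
  have hy0 := hl.left_mem
  have hx1 := hl.right_mem
  set A := √(π * h / κ) with hA
  have hA0 : 0 ≤ A := Real.sqrt_nonneg _
  have cf : Continuous fun x => Real.exp (-(2 * (F x - F x₁) / h)) := by
    have := hl.continuous; fun_prop
  have ii : ∀ p q, IntervalIntegrable (fun x => Real.exp (-(2 * (F x - F x₁) / h))) volume p q :=
    fun p q => cf.intervalIntegrable p q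
  have hr0 : 0 < ρ * s := by positivity
  have hxy : x₁ + ρ * s ≤ y₀ + 2 * π := by linarith [hy0.1]
  have hk0 : 0 < c * s := by positivity
  have tail : 8 * h / (2 * (c * s) * (ρ * s) ^ 2) * √(π * h / (2 * (c * s))) ≤
      A * (8 / (2 * c * ρ ^ 2) * √(C / (2 * c)) * (h / s ^ 3)) := by
    have e1 : √(π * h / (2 * (c * s))) ≤ √(C / (2 * c)) * A := by
      rw [hA, ← Real.sqrt_mul (by positivity)]
      apply Real.sqrt_le_sqrt
      calc π * h / (2 * (c * s)) = C / (2 * c) * (π * h / (C * s)) := by field_simp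
        _ ≤ C / (2 * c) * (π * h / κ) := by gcongr
    calc _ ≤ 8 * h / (2 * (c * s) * (ρ * s) ^ 2) * (√(C / (2 * c)) * A) := by gcongr
      _ = _ := by field_simp
  have t1 := (integral_exp_le_gaussian_tail hl.continuous hk0 hh hr0 l1
    (fun x hx => by rw [abs_sub_comm]; exact le_trans (by linarith [hx.2]) (le_abs_self _))
    (fun x hx => h6 x ⟨hx.1, by linarith [hx.2]⟩)).trans tail
  have t2 := (integral_exp_le_gaussian_tail hl.continuous hk0 hh hr0 hxy
    (fun x hx => le_trans (by linarith [hx.1]) (le_abs_self _))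
    (fun x hx => h6 x ⟨by linarith [hx.1, hx1.1], hx.2⟩)).trans tail
  have t3 : ∫ x in (y₀ + 2 * π)..(b + 2 * π), Real.exp (-(2 * (F x - F x₁) / h)) ≤
      A * (C' * (2 / (2 * c) ^ 2 * √C) * (h / s ^ 3)) := by
    have hle : y₀ + 2 * π ≤ b + 2 * π := by linarith [hy0.2]
    have hbound : ∀ x ∈ Set.Icc (y₀ + 2 * π) (b + 2 * π),
        Real.exp (-(2 * (F x - F x₁) / h)) ≤ Real.exp (-(2 * c * s ^ 3 / h)) := by
      intro x hx
      have k1 : F (b + 2 * π) ≤ F x := hl.antitoneOn_well_shift ⟨hx.1, by linarith [hx.2, hx1.1]⟩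
        ⟨hle, by linarith [hx1.1]⟩ hx.2
      have k2 := hl.le_period b
      apply Real.exp_le_exp.2
      have k3 : 2 * c * s ^ 3 ≤ 2 * (F x - F x₁) := by linarith
      exact neg_le_neg (div_le_div_of_nonneg_right k3 hh.le)
    calc ∫ x in (y₀ + 2 * π)..(b + 2 * π), Real.exp (-(2 * (F x - F x₁) / h))
        ≤ ∫ x in (y₀ + 2 * π)..(b + 2 * π), Real.exp (-(2 * c * s ^ 3 / h)) :=
          intervalIntegral.integral_mono_on hle (ii _ _) intervalIntegrable_const hbound
      _ = (b - y₀) * Real.exp (-(2 * c * s ^ 3 / h)) := by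
          rw [intervalIntegral.integral_const, smul_eq_mul]; ring
      _ ≤ C' * s * Real.exp (-(2 * c * s ^ 3 / h)) := by
          gcongr; linarith
      _ = C' * (s * Real.exp (-(2 * c * s ^ 3 / h))) := by ring
      _ ≤ C' * (2 / (2 * c) ^ 2 * (h / s ^ 3) * (h / s ^ 2)) := by
          exact mul_le_mul_of_nonneg_left
            (mul_exp_neg_cube_le hh hs0 (c := 2 * c) (by positivity)) hC'.le
      _ ≤ C' * (2 / (2 * c) ^ 2 * (h / s ^ 3) * (√C * A)) := by
          gcongr; exact div_sq_le_sqrt_mul_sqrt hh hs0 hhs hκ0 hC h4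
      _ = _ := by ring
  rw [← intervalIntegral.integral_add_adjacent_intervals (ii b (y₀ + 2 * π)) (ii _ _),
    ← intervalIntegral.integral_add_adjacent_intervals (ii b (x₁ + ρ * s)) (ii _ _),
    ← intervalIntegral.integral_add_adjacent_intervals (ii b (x₁ - ρ * s)) (ii _ _)]
  have l4 := (abs_le.1 l3).2
  linarith

theorem SinglePeak.exists_quadratic {w : ℝ → ℝ} {a b : ℝ} (hw : SinglePeak w a b) :
    ∃ c > 0, (∀ x ∈ Set.Icc b (a + 2 * π), c * (x - b) ^ 2 ≤ w b - w x) ∧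
      ∀ x ∈ Set.Icc (a + 2 * π) (b + 2 * π), c * (b + 2 * π - x) ^ 2 ≤ w b - w x := by
  obtain ⟨c, hc, h⟩ := hw.exists_quadratic_right
  obtain ⟨c', hc', h'⟩ := hw.reflect.exists_quadratic_right
  refine ⟨min c c', by positivity, fun x hx => le_trans ?_ (h x hx), fun x hx => ?_⟩
  · gcongr; exact min_le_left _ _
  · have := h' (2 * π - x) ⟨by linarith [hx.2], by linarith [hx.1]⟩
    rw [neg_neg, show -(2 * π - x) = x - 2 * π by ring, hw.periodic.sub_eq,
      show 2 * π - x - -b = b + 2 * π - x by ring] at this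
    refine le_trans ?_ this
    gcongr; exact min_le_right _ _

/-- Row sums of the near-diagonal part of the resolvent kernel. -/
theorem SinglePeak.exists_row_bound {w : ℝ → ℝ} {a b : ℝ} (hw : SinglePeak w a b) :
    ∃ C > 0, ∀ e₀ E y₀ x₁ F, PeakLevel w a b e₀ E y₀ x₁ F → ∀ s h, s = √(w b - E) → 0 < s →
      0 < h → h ≤ s ^ 3 → ∀ x ∈ Set.Icc b (b + 2 * π),
      ∫ y in b..x, Real.exp ((F y - F x) / h) ≤
        Real.exp (max (F b - F x₁) (F y₀ - F b) / h) * (C * s) := by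
  obtain ⟨c, hc, hq1, hq2⟩ := hw.exists_quadratic
  -- Chosen so that cℓ² = 2s² for ℓ = Ks: at distance ℓ from the peaks b and b + 2π, w lies at least
  -- 2s² below its maximum, hence at least s² below E, and F has slope at least s² there.
  set K := √(2 / c) with hK
  have hK0 : 0 < K := Real.sqrt_pos.2 (by positivity)
  have hK2 : K ^ 2 = 2 / c := Real.sq_sqrt (by positivity)
  refine ⟨2 * K + 1, by positivity, ?_⟩
  intro e₀ E y₀ x₁ F hl s h hs hs0 hh hhs x hx
  have hs2 : s ^ 2 = w b - E := by
    rw [hs, Real.sq_sqrt]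
    have : 0 < √(w b - E) := hs ▸ hs0
    exact (Real.sqrt_pos.1 this).le
  set ℓ := K * s with hℓ
  have hℓ0 : 0 < ℓ := by positivity
  set M := max (F b - F x₁) (F y₀ - F b) with hM
  have hcℓ : c * ℓ ^ 2 = 2 * s ^ 2 := by rw [hℓ, mul_pow, hK2]; field_simp
  have hwE : ∀ y, b + ℓ ≤ y → y ≤ b + 2 * π - ℓ → s ^ 2 ≤ E - w y := by
    intro y h1 h2
    have : c * ℓ ^ 2 ≤ w b - w y := by
      rcases le_total y (a + 2 * π) with h | h
      · refine le_trans ?_ (hq1 y ⟨by linarith, h⟩)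
        gcongr; linarith
      · refine le_trans ?_ (hq2 y ⟨h, by linarith⟩)
        gcongr; linarith
    rw [hcℓ] at this
    linarith
  -- The integrand is compared with its value at m, the last point reached at slope s²; from m to x
  -- only the maximal drop M is used. The middle zone contributes h/s², the two end zones ℓ each.
  set m := min x (b + 2 * π - ℓ) with hm
  have hgrow : ∀ y, b + ℓ ≤ y → y ≤ m → s ^ 2 * (m - y) ≤ F m - F y := by
    intro y h1 h2
    refine (convex_Icc y m).mul_sub_le_image_sub_of_le_deriv hl.continuous.continuousOn
      (fun z _ => (hl.hasDerivAt z).differentiableAt.differentiableWithinAt) ?_ y ⟨le_rfl, h2⟩ m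
      ⟨h2, le_rfl⟩ h2
    intro z hz
    rw [interior_Icc] at hz
    rw [(hl.hasDerivAt z).deriv]
    exact hwE z (by linarith [hz.1]) (by linarith [hz.2, min_le_right x (b + 2 * π - ℓ)])
  have hlam : 0 < s ^ 2 / h := by positivity
  have i1 : Integrable ((Set.Icc b (b + ℓ)).indicator fun _ => (1 : ℝ)) :=
    (integrable_indicator_iff measurableSet_Icc).2 (by simp)
  have i2 : Integrable ((Set.Icc (b + 2 * π - ℓ) (b + 2 * π)).indicator fun _ => (1 : ℝ)) :=
    (integrable_indicator_iff measurableSet_Icc).2 (by simp)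
  have i3 : Integrable ((Set.Iic m).indicator fun y =>
      Real.exp (-(s ^ 2 / h * m)) * Real.exp (s ^ 2 / h * y)) :=
    (integrable_indicator_iff measurableSet_Iic).2 ((integrableOn_exp_mul_Iic hlam m).const_mul _)
  set g : ℝ → ℝ := fun y => Real.exp (M / h) * ((Set.Icc b (b + ℓ)).indicator (fun _ => (1 : ℝ)) y +
    (Set.Icc (b + 2 * π - ℓ) (b + 2 * π)).indicator (fun _ => (1 : ℝ)) y +
    (Set.Iic m).indicator (fun y => Real.exp (-(s ^ 2 / h * m)) * Real.exp (s ^ 2 / h * y)) y) with hg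
  have ig : Integrable g := ((i1.add i2).add i3).const_mul _
  have n1 : ∀ y, 0 ≤ (Set.Icc b (b + ℓ)).indicator (fun _ => (1 : ℝ)) y := fun y =>
    Set.indicator_nonneg (fun _ _ => zero_le_one) y
  have n2 : ∀ y, 0 ≤ (Set.Icc (b + 2 * π - ℓ) (b + 2 * π)).indicator (fun _ => (1 : ℝ)) y := fun y =>
    Set.indicator_nonneg (fun _ _ => zero_le_one) y
  have n3 : ∀ y, 0 ≤ (Set.Iic m).indicator
      (fun y => Real.exp (-(s ^ 2 / h * m)) * Real.exp (s ^ 2 / h * y)) y := fun y =>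
    Set.indicator_nonneg (fun _ _ => by positivity) y
  have cf : Continuous fun y => Real.exp ((F y - F x) / h) := by
    have := hl.continuous; fun_prop
  have hpt : ∀ y ∈ Set.Ioc b x, Real.exp ((F y - F x) / h) ≤ g y := by
    intro y hy
    have crude : Real.exp ((F y - F x) / h) ≤ Real.exp (M / h) := by
      apply Real.exp_le_exp.2
      gcongr
      exact hl.sub_le_max hy.1.le hy.2 hx.2
    have a1 := n1 y
    have a2 := n2 y
    have a3 := n3 y
    rcases le_or_gt y (b + ℓ) with h1 | h1
    · rw [hg]
      refine crude.trans (le_mul_of_one_le_right (Real.exp_pos _).le ?_)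
      have : (Set.Icc b (b + ℓ)).indicator (fun _ => (1 : ℝ)) y = 1 :=
        Set.indicator_of_mem (Set.mem_Icc.2 ⟨hy.1.le, h1⟩) _
      linarith
    rcases le_or_gt (b + 2 * π - ℓ) y with h2 | h2
    · rw [hg]
      refine crude.trans (le_mul_of_one_le_right (Real.exp_pos _).le ?_)
      have : (Set.Icc (b + 2 * π - ℓ) (b + 2 * π)).indicator (fun _ => (1 : ℝ)) y = 1 :=
        Set.indicator_of_mem (Set.mem_Icc.2 ⟨h2, hy.2.trans hx.2⟩) _
      linarith
    have hym : y ≤ m := le_min hy.2 h2.le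
    have k1 := hgrow y h1.le hym
    have k2 := hl.sub_le_max (y := m) (x := x) (by linarith [hy.1]) (min_le_left _ _) hx.2
    have k3 : (Set.Iic m).indicator
        (fun y => Real.exp (-(s ^ 2 / h * m)) * Real.exp (s ^ 2 / h * y)) y =
        Real.exp (-(s ^ 2 / h * m)) * Real.exp (s ^ 2 / h * y) := Set.indicator_of_mem (Set.mem_Iic.2 hym) _
    calc Real.exp ((F y - F x) / h) ≤ Real.exp ((M - s ^ 2 * (m - y)) / h) := by
          apply Real.exp_le_exp.2
          have : F y - F x ≤ M - s ^ 2 * (m - y) := by linarith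
          gcongr
      _ = Real.exp (M / h) * (Real.exp (-(s ^ 2 / h * m)) * Real.exp (s ^ 2 / h * y)) := by
          rw [← Real.exp_add, ← Real.exp_add]; congr 1; ring
      _ ≤ g y := by
          rw [hg]
          exact mul_le_mul_of_nonneg_left (by linarith) (Real.exp_pos _).le
  have ng : ∀ y, 0 ≤ g y := fun y =>
    mul_nonneg (Real.exp_pos _).le (add_nonneg (add_nonneg (n1 y) (n2 y)) (n3 y))
  have val : ∫ y, g y = Real.exp (M / h) * (ℓ + ℓ + h / s ^ 2) := by
    have v1 : ∫ y, (Set.Icc b (b + ℓ)).indicator (fun _ => (1 : ℝ)) y = ℓ := by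
      rw [integral_indicator measurableSet_Icc]; simp [hℓ0.le]
    have v2 : ∫ y, (Set.Icc (b + 2 * π - ℓ) (b + 2 * π)).indicator (fun _ => (1 : ℝ)) y = ℓ := by
      rw [integral_indicator measurableSet_Icc]; simp [hℓ0.le]
    have v3 : ∫ y, (Set.Iic m).indicator
        (fun y => Real.exp (-(s ^ 2 / h * m)) * Real.exp (s ^ 2 / h * y)) y = h / s ^ 2 := by
      rw [integral_indicator measurableSet_Iic, integral_const_mul, integral_exp_mul_Iic hlam,
        ← mul_div_assoc, ← Real.exp_add, neg_add_cancel, Real.exp_zero, one_div_div]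
    have i12 := i1.add i2
    rw [hg, integral_const_mul]
    congr 1
    rw [integral_add (f := fun y => (Set.Icc b (b + ℓ)).indicator (fun _ => (1 : ℝ)) y +
      (Set.Icc (b + 2 * π - ℓ) (b + 2 * π)).indicator (fun _ => (1 : ℝ)) y) i12 i3,
      integral_add i1 i2, v1, v2, v3]
  rw [intervalIntegral.integral_of_le hx.1]
  calc ∫ y in Set.Ioc b x, Real.exp ((F y - F x) / h) ≤ ∫ y in Set.Ioc b x, g y :=
        setIntegral_mono_on (cf.integrableOn_Ioc) ig.integrableOn measurableSet_Ioc hpt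
    _ ≤ ∫ y, g y := setIntegral_le_integral ig (Filter.Eventually.of_forall ng)
    _ = Real.exp (M / h) * (ℓ + ℓ + h / s ^ 2) := val
    _ ≤ _ := by
        have : h / s ^ 2 ≤ s := by
          rw [div_le_iff₀ (by positivity)]
          calc h ≤ s ^ 3 := hhs
            _ = s * s ^ 2 := by ring
        gcongr
        rw [hℓ]; linarith

/-- Everything the resolvent kernel estimates need, for a level of a single-peak function:
Laplace asymptotics at both turning points and Schur bounds near the diagonal. -/
theorem SinglePeak.exists_kernel_estimates {w : ℝ → ℝ} {a b e₀ : ℝ} (hw : SinglePeak w a b)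
    (he : w a < e₀) :
    ∃ C > 0, ∃ ρ > 0, ∀ E y₀ x₁ F, PeakLevel w a b e₀ E y₀ x₁ F → ∀ s h A₁ A₀ δ, s = √(w b - E) →
      0 < h → h ≤ s ^ 3 → A₁ = √(π * h / (-deriv w x₁)) → A₀ = √(π * h / deriv w y₀) →
      δ = C * (h / s ^ 3) →
      0 < A₁ ∧ 0 < A₀ ∧ 0 < s ∧
      (b ≤ x₁ - ρ * s ∧ x₁ + ρ * s ≤ a + 2 * π) ∧ (a ≤ y₀ - ρ * s ∧ y₀ + ρ * s ≤ b) ∧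
      ∫ x in b..(b + 2 * π), Real.exp (-(2 * (F x - F x₁) / h)) ≤ A₁ * (1 + δ) ∧
      ∫ y in (b - 2 * π)..b, Real.exp (2 * (F y - F y₀) / h) ≤ A₀ * (1 + δ) ∧
      A₁ * (1 - δ) ≤
        ∫ x in (x₁ - ρ * s)..(x₁ + ρ * s), Real.exp (-(2 * (F x - F x₁) / h)) ∧
      A₀ * (1 - δ) ≤ ∫ y in (y₀ - ρ * s)..(y₀ + ρ * s), Real.exp (2 * (F y - F y₀) / h) ∧
      (∀ x ∈ Set.Icc b (b + 2 * π), ∫ y in b..x, Real.exp ((F y - F x) / h) ≤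
        Real.exp ((F y₀ - F x₁) / h) * (√(A₁ * A₀) * δ)) ∧
      (∀ y ∈ Set.Icc b (b + 2 * π), ∫ x in y..(b + 2 * π), Real.exp ((F y - F x) / h) ≤
        Real.exp ((F y₀ - F x₁) / h) * (√(A₁ * A₀) * δ)) := by
  have hr := hw.reflect
  have her := hw.reflect_apply_lt he
  obtain ⟨c, hc, C, hC, H⟩ := hw.exists_bounds he
  obtain ⟨c', hc', C', hC', H'⟩ := hr.exists_bounds her
  obtain ⟨ρ₁, hρ₁, hloc⟩ := hw.exists_laplace_local he
  obtain ⟨ρ₂, hρ₂, hloc'⟩ := hr.exists_laplace_local her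
  obtain ⟨C₁, hC₁, hloc⟩ := hloc (min ρ₁ ρ₂) (by positivity) (min_le_left _ _)
  obtain ⟨C₂, hC₂, hloc'⟩ := hloc' (min ρ₁ ρ₂) (by positivity) (min_le_right _ _)
  obtain ⟨C₃, hC₃, hup⟩ := hw.exists_laplace_upper he
  obtain ⟨C₄, hC₄, hup'⟩ := hr.exists_laplace_upper her
  obtain ⟨C₅, hC₅, hrow⟩ := hw.exists_row_bound
  obtain ⟨C₆, hC₆, hcol⟩ := hr.exists_row_bound
  set m := min c c' with hm
  have hm0 : 0 < m := by positivity
  set D := max C C' with hD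
  have hD0 : 0 < D := by positivity
  set Cr := max C₅ C₆ * (2 / m ^ 2) * √D with hCr
  have hCr0 : 0 < Cr := by positivity
  refine ⟨C₁ + C₂ + C₃ + C₄ + Cr, by positivity, min ρ₁ ρ₂, by positivity, ?_⟩
  intro E y₀ x₁ F hl s h A₁ A₀ δ hs hh hhs hA₁ hA₀ hδ
  have hlr := hl.reflect
  have hs' : s = √((fun x => w (-x)) (-b) - E) := by simpa using hs
  obtain ⟨hs0, -, -, -, h3, h4, -, -, h7⟩ := H E y₀ x₁ F hl s hs
  obtain ⟨-, -, -, -, h3', h4', -, -, h7'⟩ := H' E (-x₁) (-y₀) _ hlr s hs'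
  have hd : -deriv (fun x => w (-x)) (-y₀) = deriv w y₀ := by
    rw [deriv_comp_neg, neg_neg, neg_neg]
  rw [hd] at h3' h4'
  simp only [neg_neg] at h7'
  have hκ : 0 < -deriv w x₁ := lt_of_lt_of_le (by positivity) h3
  have hκ' : 0 < deriv w y₀ := lt_of_lt_of_le (by positivity) h3'
  have hA₁0 : 0 < A₁ := by rw [hA₁]; exact Real.sqrt_pos.2 (by positivity)
  have hA₀0 : 0 < A₀ := by rw [hA₀]; exact Real.sqrt_pos.2 (by positivity)
  have hq : 0 < h / s ^ 3 := by positivity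
  obtain ⟨l1, l2, l3⟩ := hloc E y₀ x₁ F hl s h hs hh
  obtain ⟨l1', l2', l3'⟩ := hloc' E (-x₁) (-y₀) _ hlr s h hs' hh
  have u := hup E y₀ x₁ F hl s h hs hh hhs
  have u' := hup' E (-x₁) (-y₀) _ hlr s h hs' hh hhs
  rw [← hA₁] at l3 u
  rw [hd, ← hA₀] at l3' u'
  have hle : ∀ K, 0 < K → K ≤ C₁ + C₂ + C₃ + C₄ + Cr → K * (h / s ^ 3) ≤ δ := fun K _ hK => by
    rw [hδ]; gcongr
  have e1 := hle C₁ hC₁ (by linarith)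
  have e2 := hle C₂ hC₂ (by linarith)
  have e3 := hle C₃ hC₃ (by linarith)
  have e4 := hle C₄ hC₄ (by linarith)
  have e5 := hle Cr hCr0 (by linarith)
  have refl_int : ∀ p q : ℝ, ∫ x in p..q, Real.exp (-(2 * (-F (-x) - -F (-(-y₀))) / h)) =
      ∫ y in (-q)..(-p), Real.exp (2 * (F y - F y₀) / h) := by
    intro p q
    rw [← intervalIntegral.integral_comp_neg (fun y => Real.exp (2 * (F y - F y₀) / h))]
    congr 1; ext x; congr 1; rw [neg_neg]; ring
  rw [refl_int] at l3' u'
  -- Geometric mean of the absorption bounds at the two turning points, since the main term carries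
  -- √(A₁A₀).
  have hgm : h / s ^ 2 ≤ √D * √(A₁ * A₀) := by
    have g1 := div_sq_le_sqrt_mul_sqrt hh hs0 hhs hκ hD0
      (h4.trans (by gcongr; exact le_max_left _ _))
    have g2 := div_sq_le_sqrt_mul_sqrt hh hs0 hhs hκ' hD0
      (h4'.trans (by gcongr; exact le_max_right _ _))
    rw [← hA₁] at g1
    rw [← hA₀] at g2
    rw [← Real.sqrt_mul hD0.le]
    apply Real.le_sqrt_of_sq_le
    calc (h / s ^ 2) ^ 2 = (h / s ^ 2) * (h / s ^ 2) := sq _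
      _ ≤ (√D * A₁) * (√D * A₀) := by gcongr
      _ = √D ^ 2 * (A₁ * A₀) := by ring
      _ = D * (A₁ * A₀) := by rw [Real.sq_sqrt hD0.le]
  -- Each partial drop misses the other one, which is at least m s³. This gives the factor exp(−m
  -- s³/h) in the near-diagonal part.
  have hM : max (F b - F x₁) (F y₀ - F b) ≤ F y₀ - F x₁ - m * s ^ 3 := by
    have k1 : m * s ^ 3 ≤ c * s ^ 3 := by gcongr; exact min_le_left _ _
    have k2 : m * s ^ 3 ≤ c' * s ^ 3 := by gcongr; exact min_le_right _ _
    apply max_le <;> linarith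
  have schur : ∀ K, 0 < K → K ≤ max C₅ C₆ →
      Real.exp (max (F b - F x₁) (F y₀ - F b) / h) * (K * s) ≤
        Real.exp ((F y₀ - F x₁) / h) * (√(A₁ * A₀) * δ) := by
    intro K hK hK'
    calc Real.exp (max (F b - F x₁) (F y₀ - F b) / h) * (K * s)
        ≤ Real.exp ((F y₀ - F x₁ - m * s ^ 3) / h) * (max C₅ C₆ * s) := by gcongr
      _ = Real.exp ((F y₀ - F x₁) / h) * (max C₅ C₆ * (s * Real.exp (-(m * s ^ 3 / h)))) := by
          rw [sub_div, sub_eq_add_neg, Real.exp_add]; ring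
      _ ≤ Real.exp ((F y₀ - F x₁) / h) *
          (max C₅ C₆ * (2 / m ^ 2 * (h / s ^ 3) * (h / s ^ 2))) := by
          refine mul_le_mul_of_nonneg_left (mul_le_mul_of_nonneg_left
            (mul_exp_neg_cube_le hh hs0 hm0) (by positivity)) (Real.exp_pos _).le
      _ ≤ Real.exp ((F y₀ - F x₁) / h) *
          (max C₅ C₆ * (2 / m ^ 2 * (h / s ^ 3) * (√D * √(A₁ * A₀)))) := by gcongr
      _ = Real.exp ((F y₀ - F x₁) / h) * (√(A₁ * A₀) * (Cr * (h / s ^ 3))) := by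
          rw [hCr]; ring
      _ ≤ _ := by gcongr
  refine ⟨hA₁0, hA₀0, hs0, ⟨l1, l2⟩, ⟨by linarith, by linarith⟩, ?_, ?_, ?_, ?_, ?_, ?_⟩
  · exact u.trans (by gcongr)
  · rw [show -(-b + 2 * π) = b - 2 * π by ring, neg_neg] at u'
    exact u'.trans (by gcongr)
  · have := (abs_le.1 l3).1
    have k : A₁ * (C₁ * (h / s ^ 3)) ≤ A₁ * δ := by gcongr
    linarith
  · have := (abs_le.1 l3').1
    have k : A₀ * (C₂ * (h / s ^ 3)) ≤ A₀ * δ := by gcongr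
    rw [show -(-y₀ + min ρ₁ ρ₂ * s) = y₀ - min ρ₁ ρ₂ * s by ring,
      show -(-y₀ - min ρ₁ ρ₂ * s) = y₀ + min ρ₁ ρ₂ * s by ring] at this
    linarith
  · intro x hx
    exact (hrow e₀ E y₀ x₁ F hl s h hs hs0 hh hhs x hx).trans (schur C₅ hC₅ (le_max_left _ _))
  · intro y hy
    -- A column integral is a row integral for the reflected data. The map y ↦ 2π − y, not y ↦ −y,
    -- carries [b, b + 2π] to the period starting at the reflected peak −b, hence the shift of F by
    -- a period.
    have := hcol e₀ E (-x₁) (-y₀) _ hlr.shift s h hs' hs0 hh hhs (2 * π - y)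
      ⟨by linarith [hy.2], by linarith [hy.1]⟩
    have hmax : max (-F (-(-b - 2 * π)) - -F (-(-y₀ - 2 * π)))
        (-F (-(-x₁ - 2 * π)) - -F (-(-b - 2 * π))) = max (F b - F x₁) (F y₀ - F b) := by
      have k1 := hl.shift_sub y₀ b
      have k2 := hl.shift_sub b x₁
      rw [show -(-b - 2 * π) = b + 2 * π by ring, show -(-y₀ - 2 * π) = y₀ + 2 * π by ring,
        show -(-x₁ - 2 * π) = x₁ + 2 * π by ring, max_comm]
      congr 1 <;> linarith
    rw [hmax] at this
    refine le_trans (le_of_eq ?_) (this.trans (schur C₆ hC₆ (le_max_right _ _)))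
    have k := intervalIntegral.integral_comp_sub_left (a := -b) (b := 2 * π - y)
      (fun x => Real.exp ((F y - F x) / h)) (2 * π)
    rw [show 2 * π - (2 * π - y) = y by ring, show 2 * π - -b = b + 2 * π by ring] at k
    rw [← k]
    congr 1; ext x; congr 1
    rw [show -(x - 2 * π) = 2 * π - x by ring, show -(2 * π - y - 2 * π) = y by ring]
    ring

/-! ### Cauchy–Schwarz, Minkowski and the Schur test -/

section LIntegral

variable {α : Type*} [MeasurableSpace α] {μ : Measure α}

theorem sq_rpow_half (x : ℝ≥0∞) : (x ^ (1 / 2 : ℝ)) ^ 2 = x := by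
  rw [← ENNReal.rpow_natCast, ← ENNReal.rpow_mul]; norm_num

theorem lintegral_mul_sq_le {f g : α → ℝ≥0∞} (hf : Measurable f) (hg : Measurable g) :
    (∫⁻ x, f x * g x ∂μ) ^ 2 ≤ (∫⁻ x, f x ^ 2 ∂μ) * ∫⁻ x, g x ^ 2 ∂μ := by
  have h := ENNReal.lintegral_mul_le_Lp_mul_Lq μ Real.HolderConjugate.two_two
    hf.aemeasurable hg.aemeasurable
  simp only [Pi.mul_apply, ENNReal.rpow_two] at h
  calc (∫⁻ x, f x * g x ∂μ) ^ 2
      ≤ ((∫⁻ x, f x ^ 2 ∂μ) ^ (1 / 2 : ℝ) * (∫⁻ x, g x ^ 2 ∂μ) ^ (1 / 2 : ℝ)) ^ 2 := by gcongr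
    _ = _ := by rw [mul_pow, sq_rpow_half, sq_rpow_half]

theorem lintegral_add_sq_le {f g : α → ℝ≥0∞} (hf : Measurable f) (hg : Measurable g)
    {p q : ℝ≥0∞} (hp : ∫⁻ x, f x ^ 2 ∂μ ≤ p ^ 2) (hq : ∫⁻ x, g x ^ 2 ∂μ ≤ q ^ 2) :
    ∫⁻ x, (f x + g x) ^ 2 ∂μ ≤ (p + q) ^ 2 := by
  have h := ENNReal.lintegral_Lp_add_le hf.aemeasurable hg.aemeasurable (μ := μ) one_le_two
  simp only [Pi.add_apply, ENNReal.rpow_two] at h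
  have root : ∀ {x y : ℝ≥0∞}, x ≤ y ^ 2 → x ^ (1 / 2 : ℝ) ≤ y := by
    intro x y hxy
    calc x ^ (1 / 2 : ℝ) ≤ (y ^ 2) ^ (1 / 2 : ℝ) := by gcongr
      _ = y := by rw [← ENNReal.rpow_natCast, ← ENNReal.rpow_mul]; norm_num
  calc ∫⁻ x, (f x + g x) ^ 2 ∂μ = ((∫⁻ x, (f x + g x) ^ 2 ∂μ) ^ (1 / 2 : ℝ)) ^ 2 :=
        (sq_rpow_half _).symm
    _ ≤ (p + q) ^ 2 := by
        gcongr
        exact h.trans (add_le_add (root hp) (root hq))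

/-- The Schur test. -/
theorem lintegral_schur_le [SFinite μ] {k : α → α → ℝ≥0∞} (hk : Measurable (Function.uncurry k))
    {φ : α → ℝ≥0∞} (hφ : Measurable φ) {B : ℝ≥0∞} (h₁ : ∀ᵐ x ∂μ, ∫⁻ y, k x y ∂μ ≤ B)
    (h₂ : ∀ᵐ y ∂μ, ∫⁻ x, k x y ∂μ ≤ B) :
    ∫⁻ x, (∫⁻ y, k x y * φ y ∂μ) ^ 2 ∂μ ≤ B ^ 2 * ∫⁻ y, φ y ^ 2 ∂μ := by
  have hkx : ∀ x, Measurable (k x) := fun x => hk.comp measurable_prodMk_left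
  have hky : ∀ y, Measurable fun x => k x y := fun y => hk.comp measurable_prodMk_right
  have hkφ : Measurable (Function.uncurry fun x y => k x y * φ y ^ 2) :=
    hk.mul ((hφ.comp measurable_snd).pow_const 2)
  have cs : ∀ x, (∫⁻ y, k x y * φ y ∂μ) ^ 2 ≤ (∫⁻ y, k x y ∂μ) * ∫⁻ y, k x y * φ y ^ 2 ∂μ := by
    intro x
    have := lintegral_mul_sq_le (μ := μ) ((hkx x).pow_const (1 / 2 : ℝ))
      (((hkx x).pow_const (1 / 2 : ℝ)).mul hφ)
    have e : ∀ y, k x y ^ (1 / 2 : ℝ) * ((fun y => k x y ^ (1 / 2 : ℝ)) * φ) y = k x y * φ y := by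
      intro y
      rw [Pi.mul_apply, ← mul_assoc, ← sq, sq_rpow_half]
    have e2 : ∀ y, ((fun y => k x y ^ (1 / 2 : ℝ)) * φ) y ^ 2 = k x y * φ y ^ 2 := by
      intro y
      rw [Pi.mul_apply, mul_pow, sq_rpow_half]
    simpa only [e, e2, sq_rpow_half] using this
  calc ∫⁻ x, (∫⁻ y, k x y * φ y ∂μ) ^ 2 ∂μ
      ≤ ∫⁻ x, B * ∫⁻ y, k x y * φ y ^ 2 ∂μ ∂μ := by
        apply lintegral_mono_ae
        filter_upwards [h₁] with x hx
        exact (cs x).trans (by gcongr)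
    _ = B * ∫⁻ y, ∫⁻ x, k x y * φ y ^ 2 ∂μ ∂μ := by
        rw [lintegral_const_mul _ hkφ.lintegral_prod_right,
          lintegral_lintegral_swap hkφ.aemeasurable]
    _ ≤ B * ∫⁻ y, B * φ y ^ 2 ∂μ := by
        refine mul_le_mul' le_rfl (lintegral_mono_ae ?_)
        filter_upwards [h₂] with y hy
        rw [lintegral_mul_const _ (hky y)]
        gcongr
    _ = _ := by rw [lintegral_const_mul _ (hφ.pow_const 2), ← mul_assoc, sq]

end LIntegral

/-! ### The window operator: upper and lower norm bounds -/

/-- The integral operator `f ↦ e(x) ∫_{x-2π}^x f(y) / e(y) dy`. -/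
noncomputable def windowOp (e : ℝ → ℂ) (f : S1 → ℂ) (x : ℝ) : ℂ :=
  e x * ∫ y in (x - 2 * π)..x, f (y : S1) / e y

theorem measurable_mk : Measurable fun y : ℝ => (y : S1) := AddCircle.measurable_mk'

/-- For x in (b, b + 2π] the window (x − 2π, x] lies in (b − 2π, b] ∪ (b, x]. The first part is
enlarged to all of (b − 2π, b], which makes the dominating kernel |e(x)|·|1/e(y)| a tensor product,
of norm √(PQ) ≤ N. The second is a triangular kernel bounded by B through the Schur test. -/
theorem windowOp_upper {e : ℝ → ℂ} (he : Continuous e) (hne : ∀ x, e x ≠ 0) {b : ℝ}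
    {P Q B N : ℝ≥0∞} (hP : ∫⁻ x in Set.Ioc b (b + 2 * π), ‖e x‖ₑ ^ 2 ≤ P)
    (hQ : ∫⁻ y in Set.Ioc (b - 2 * π) b, ‖(e y)⁻¹‖ₑ ^ 2 ≤ Q) (hPQ : P * Q ≤ N ^ 2)
    (hrow : ∀ x ∈ Set.Ioc b (b + 2 * π), ∫⁻ y in Set.Ioc b x, ‖e x * (e y)⁻¹‖ₑ ≤ B)
    (hcol : ∀ y ∈ Set.Ioc b (b + 2 * π), ∫⁻ x in Set.Icc y (b + 2 * π), ‖e x * (e y)⁻¹‖ₑ ≤ B)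
    {f : S1 → ℂ} (hf : Measurable f) :
    ∫⁻ x in Set.Ioc b (b + 2 * π), ‖windowOp e f x‖ₑ ^ 2 ≤ (N + B) ^ 2 * ∫⁻ x, ‖f x‖ₑ ^ 2 := by
  have hei : Continuous fun y => (e y)⁻¹ := he.inv₀ hne
  have hfm : Measurable fun y : ℝ => ‖f (y : S1)‖ₑ := (hf.comp measurable_mk).enorm
  set μ := (volume : Measure ℝ).restrict (Set.Ioc b (b + 2 * π)) with hμ
  set X := ∫⁻ x, ‖f x‖ₑ ^ 2 with hX
  set k : ℝ → ℝ → ℝ≥0∞ := fun x y =>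
    Set.indicator {p : ℝ × ℝ | p.2 ≤ p.1} (fun p => ‖e p.1 * (e p.2)⁻¹‖ₑ) (x, y) with hk
  have hkm : Measurable (Function.uncurry k) := by
    have : Function.uncurry k =
        Set.indicator {p : ℝ × ℝ | p.2 ≤ p.1} (fun p => ‖e p.1 * (e p.2)⁻¹‖ₑ) := by
      ext ⟨x, y⟩; rfl
    rw [this]
    refine Measurable.indicator ?_ (measurableSet_le measurable_snd measurable_fst)
    exact ((he.comp continuous_fst).mul (hei.comp continuous_snd)).measurable.enorm
  have kx : ∀ x y, k x y = (Set.Iic x).indicator (fun y => ‖e x * (e y)⁻¹‖ₑ) y := fun x y => by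
    simp [hk, Set.indicator_apply]
  have ky : ∀ x y, k x y = (Set.Ici y).indicator (fun x => ‖e x * (e y)⁻¹‖ₑ) x := fun x y => by
    simp [hk, Set.indicator_apply]
  have hsch : ∫⁻ x, (∫⁻ y, k x y * ‖f (y : S1)‖ₑ ∂μ) ^ 2 ∂μ ≤ B ^ 2 * X := by
    have hXe : X = ∫⁻ y, ‖f (y : S1)‖ₑ ^ 2 ∂μ := (AddCircle.lintegral_preimage (2 * π) b _).symm
    rw [hXe]
    apply lintegral_schur_le hkm hfm
    · filter_upwards [ae_restrict_mem measurableSet_Ioc] with x hx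
      simp only [kx]
      rw [hμ, setLIntegral_indicator measurableSet_Iic]
      refine (lintegral_mono_set ?_).trans (hrow x hx)
      exact fun y hy => ⟨hy.2.1, hy.1⟩
    · filter_upwards [ae_restrict_mem measurableSet_Ioc] with y hy
      simp only [ky]
      rw [hμ, setLIntegral_indicator measurableSet_Ici]
      refine (lintegral_mono_set ?_).trans (hcol y hy)
      exact fun x hx => ⟨hx.1, hx.2.2⟩
  set A := ∫⁻ y in Set.Ioc (b - 2 * π) b, ‖f (y : S1)‖ₑ * ‖(e y)⁻¹‖ₑ with hA
  have hA2 : A ^ 2 ≤ X * Q := by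
    have hXe : X = ∫⁻ y in Set.Ioc (b - 2 * π) b, ‖f (y : S1)‖ₑ ^ 2 := by
      have := AddCircle.lintegral_preimage (2 * π) (b - 2 * π) (fun x => ‖f x‖ₑ ^ 2)
      rw [sub_add_cancel] at this
      exact this.symm
    refine (lintegral_mul_sq_le hfm hei.measurable.enorm).trans ?_
    rw [hXe]; gcongr
  have hpt : ∀ x ∈ Set.Ioc b (b + 2 * π), ‖windowOp e f x‖ₑ ≤
      ‖e x‖ₑ * A + ∫⁻ y, k x y * ‖f (y : S1)‖ₑ ∂μ := by
    intro x hx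
    have h1 : ‖windowOp e f x‖ₑ ≤
        ‖e x‖ₑ * ∫⁻ y in Set.Ioc (x - 2 * π) x, ‖f (y : S1)‖ₑ * ‖(e y)⁻¹‖ₑ := by
      rw [windowOp, enorm_mul,
        intervalIntegral.integral_of_le (by linarith [Real.pi_pos] : x - 2 * π ≤ x)]
      gcongr
      refine (enorm_integral_le_lintegral_enorm _).trans (le_of_eq ?_)
      simp only [div_eq_mul_inv, enorm_mul]
    have h2 : ∫⁻ y in Set.Ioc (x - 2 * π) x, ‖f (y : S1)‖ₑ * ‖(e y)⁻¹‖ₑ ≤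
        A + ∫⁻ y in Set.Ioc b x, ‖f (y : S1)‖ₑ * ‖(e y)⁻¹‖ₑ := by
      refine (lintegral_mono_set ?_).trans (lintegral_union_le _ _ _)
      intro y hy
      rcases le_or_gt y b with h | h
      · exact Or.inl ⟨by linarith [hy.1, hx.1], h⟩
      · exact Or.inr ⟨h, hy.2⟩
    have h3 : ‖e x‖ₑ * ∫⁻ y in Set.Ioc b x, ‖f (y : S1)‖ₑ * ‖(e y)⁻¹‖ₑ ≤
        ∫⁻ y, k x y * ‖f (y : S1)‖ₑ ∂μ := by
      have e1 : ∀ y, k x y * ‖f (y : S1)‖ₑ =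
          (Set.Iic x).indicator (fun y => ‖e x * (e y)⁻¹‖ₑ * ‖f (y : S1)‖ₑ) y := by
        intro y
        rw [kx, Set.indicator_mul_left]
      simp only [e1]
      rw [hμ, setLIntegral_indicator measurableSet_Iic,
        ← lintegral_const_mul (f := fun y : ℝ => ‖f (y : S1)‖ₑ * ‖(e y)⁻¹‖ₑ) _
          (hfm.mul hei.measurable.enorm)]
      refine le_trans (le_of_eq ?_) (lintegral_mono_set (s := Set.Ioc b x)
        (fun y hy => ⟨hy.2, hy.1, hy.2.trans hx.2⟩))
      congr 1; ext y; rw [enorm_mul]; ring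
    calc ‖windowOp e f x‖ₑ ≤ ‖e x‖ₑ * (A + ∫⁻ y in Set.Ioc b x, ‖f (y : S1)‖ₑ * ‖(e y)⁻¹‖ₑ) :=
          h1.trans (by gcongr)
      _ = ‖e x‖ₑ * A + ‖e x‖ₑ * ∫⁻ y in Set.Ioc b x, ‖f (y : S1)‖ₑ * ‖(e y)⁻¹‖ₑ := mul_add _ _ _
      _ ≤ _ := by gcongr
  set Y := X ^ (1 / 2 : ℝ) with hY
  have hY2 : Y ^ 2 = X := sq_rpow_half X
  calc ∫⁻ x, ‖windowOp e f x‖ₑ ^ 2 ∂μ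
      ≤ ∫⁻ x, (‖e x‖ₑ * A + ∫⁻ y, k x y * ‖f (y : S1)‖ₑ ∂μ) ^ 2 ∂μ := by
        apply lintegral_mono_ae
        filter_upwards [ae_restrict_mem measurableSet_Ioc] with x hx
        gcongr
        exact hpt x hx
    _ ≤ (N * Y + B * Y) ^ 2 := by
        apply lintegral_add_sq_le (he.measurable.enorm.mul_const A)
        · exact (hkm.mul (hfm.comp measurable_snd)).lintegral_prod_right
        · simp only [mul_pow]
          rw [lintegral_mul_const _ (he.measurable.enorm.pow_const 2), hY2]
          calc (∫⁻ x, ‖e x‖ₑ ^ 2 ∂μ) * A ^ 2 ≤ P * (X * Q) := by gcongr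
            _ = P * Q * X := by ring
            _ ≤ N ^ 2 * X := by gcongr
        · rw [mul_pow, hY2]; exact hsch
    _ = _ := by rw [← add_mul, mul_pow, hY2]

/-- The extremal input for a rank-one kernel is the conjugate of 1/e, here cut off to (r, t]. Every
window ending in (p, q] contains this support exactly once modulo 2π, so the output there is exactly
e(x) times the integral of |e|⁻². -/
theorem windowOp_lower {e : ℝ → ℂ} (he : Continuous e) (hne : ∀ x, e x ≠ 0) {b p q r t : ℝ}
    (hrt : r ≤ t) (htp : t ≤ p) (hpq : p ≤ q) (hqr : q - 2 * π ≤ r) (hbp : b ≤ p)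
    (hqb : q ≤ b + 2 * π) :
    ∃ f : S1 → ℂ, Measurable f ∧
      ∫⁻ x, ‖f x‖ₑ ^ 2 = ∫⁻ y in Set.Ioc r t, ‖(e y)⁻¹‖ₑ ^ 2 ∧
      (∫⁻ x in Set.Ioc p q, ‖e x‖ₑ ^ 2) * (∫⁻ y in Set.Ioc r t, ‖(e y)⁻¹‖ₑ ^ 2) *
        (∫⁻ x, ‖f x‖ₑ ^ 2) ≤ ∫⁻ x in Set.Ioc b (b + 2 * π), ‖windowOp e f x‖ₑ ^ 2 := by
  have hei : Continuous fun y => (e y)⁻¹ := he.inv₀ hne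
  set φ : ℝ → ℂ := (Set.Ioc r t).indicator fun y => (starRingEnd ℂ) (e y)⁻¹ with hφ
  have hφm : Measurable φ :=
    (Complex.continuous_conj.comp hei).measurable.indicator measurableSet_Ioc
  set f : S1 → ℂ := AddCircle.liftIoc (2 * π) r φ with hf
  have hfm : Measurable f :=
    (hφm.comp measurable_subtype_coe).comp (AddCircle.measurableEquivIoc (2 * π) r).measurable
  have hfx : ∀ y ∈ Set.Ioc r (r + 2 * π), f (y : S1) = φ y := fun y hy =>
    AddCircle.liftIoc_coe_apply hy
  have htr : t ≤ r + 2 * π := by linarith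
  set Q := ∫⁻ y in Set.Ioc r t, ‖(e y)⁻¹‖ₑ ^ 2 with hQ
  have hnorm : ∫⁻ x, ‖f x‖ₑ ^ 2 = Q := by
    rw [← AddCircle.lintegral_preimage (2 * π) r]
    have e1 : ∫⁻ y in Set.Ioc r (r + 2 * π), ‖f (y : S1)‖ₑ ^ 2 =
        ∫⁻ y in Set.Ioc r (r + 2 * π), (Set.Ioc r t).indicator (fun y => ‖(e y)⁻¹‖ₑ ^ 2) y := by
      apply setLIntegral_congr_fun measurableSet_Ioc
      intro y hy
      dsimp only
      rw [hfx y hy, hφ]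
      by_cases hm : y ∈ Set.Ioc r t
      · rw [Set.indicator_of_mem hm, Set.indicator_of_mem hm, RCLike.enorm_conj]
      · rw [Set.indicator_of_notMem hm, Set.indicator_of_notMem hm]; simp
    rw [e1, setLIntegral_indicator measurableSet_Ioc, Set.inter_eq_left.2
      (Set.Ioc_subset_Ioc_right htr)]
  refine ⟨f, hfm, hnorm, ?_⟩
  have hval : ∀ x ∈ Set.Ioc p q, ‖windowOp e f x‖ₑ = ‖e x‖ₑ * Q := by
    intro x hx
    have hc : Continuous fun y => ‖(e y)⁻¹‖ ^ 2 := by fun_prop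
    have e1 : ∫ y in (x - 2 * π)..x, f (y : S1) / e y =
        ((∫ y in Set.Ioc r t, ‖(e y)⁻¹‖ ^ 2 : ℝ) : ℂ) := by
      rw [intervalIntegral.integral_of_le (by linarith [Real.pi_pos])]
      have e2 : ∫ y in Set.Ioc (x - 2 * π) x, f (y : S1) / e y =
          ∫ y in Set.Ioc (x - 2 * π) x,
            (Set.Ioc r t).indicator (fun y => ((‖(e y)⁻¹‖ ^ 2 : ℝ) : ℂ)) y := by
        apply setIntegral_congr_fun measurableSet_Ioc
        intro y hy
        dsimp only
        -- For y ≤ r, f at y equals φ at y + 2π, and y + 2π > x > p ≥ t lies outside the support, so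
        -- no second copy enters the window.
        rcases le_or_gt y r with h | h
        · have h2 : f (y : S1) = φ (y + 2 * π) := by
            rw [← hfx (y + 2 * π) ⟨by linarith [hy.1, hx.1], by linarith⟩,
              AddCircle.coe_add_period]
          rw [h2, hφ, Set.indicator_of_notMem, Set.indicator_of_notMem, zero_div]
          · exact fun hm => absurd hm.1 (not_lt.2 h)
          · exact fun hm => absurd hm.2 (not_le.2 (by linarith [hy.1, hx.1]))
        · rw [hfx y ⟨h, by linarith [hy.2, hx.2]⟩, hφ]
          by_cases hm : y ∈ Set.Ioc r t
          · rw [Set.indicator_of_mem hm, Set.indicator_of_mem hm, div_eq_mul_inv, mul_comm,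
              Complex.mul_conj, Complex.normSq_eq_norm_sq]
          · rw [Set.indicator_of_notMem hm, Set.indicator_of_notMem hm, zero_div]
      rw [e2, setIntegral_indicator measurableSet_Ioc, Set.inter_eq_right.2
        (Set.Ioc_subset_Ioc (by linarith [hx.2]) (by linarith [hx.1])), integral_complex_ofReal]
    have hn : (0 : ℝ) ≤ ∫ y in Set.Ioc r t, ‖(e y)⁻¹‖ ^ 2 := integral_nonneg fun y => by positivity
    have e3 : ‖((∫ y in Set.Ioc r t, ‖(e y)⁻¹‖ ^ 2 : ℝ) : ℂ)‖ₑ = Q := by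
      rw [← ofReal_norm, Complex.norm_real, Real.norm_of_nonneg hn,
        ofReal_integral_eq_lintegral_ofReal hc.integrableOn_Ioc
          (Filter.Eventually.of_forall fun y => by positivity), hQ]
      congr 1; ext y
      rw [ENNReal.ofReal_pow (norm_nonneg _), ofReal_norm]
    rw [windowOp, enorm_mul, e1, e3]
  calc (∫⁻ x in Set.Ioc p q, ‖e x‖ₑ ^ 2) * Q * ∫⁻ x, ‖f x‖ₑ ^ 2
      = ∫⁻ x in Set.Ioc p q, ‖e x‖ₑ ^ 2 * Q ^ 2 := by
        rw [hnorm, lintegral_mul_const _ (he.measurable.enorm.pow_const 2)]; ring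
    _ = ∫⁻ x in Set.Ioc p q, ‖windowOp e f x‖ₑ ^ 2 := by
        apply setLIntegral_congr_fun measurableSet_Ioc
        intro x hx
        dsimp only
        rw [hval x hx, mul_pow]
    _ ≤ _ := lintegral_mono_set (Set.Ioc_subset_Ioc hbp hqb)

theorem setLIntegral_ofReal_eq {φ : ℝ → ℝ} (hφ : Continuous φ) (h0 : ∀ x, 0 ≤ φ x) {p q : ℝ}
    (hpq : p ≤ q) :
    ∫⁻ x in Set.Ioc p q, ENNReal.ofReal (φ x) = ENNReal.ofReal (∫ x in p..q, φ x) := by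
  rw [intervalIntegral.integral_of_le hpq, ofReal_integral_eq_lintegral_ofReal
    hφ.integrableOn_Ioc (Filter.Eventually.of_forall h0)]

/-- The norm of `windowOp e`, when `|e| = e^{-F/h}` and `F` is a primitive of `E - w`. -/
theorem SinglePeak.exists_windowOp_norm {w : ℝ → ℝ} {a b e₀ : ℝ} (hw : SinglePeak w a b)
    (he : w a < e₀) :
    ∃ C > 0, ∀ E y₀ x₁ F, PeakLevel w a b e₀ E y₀ x₁ F → ∀ s h N, s = √(w b - E) → 0 < h →
      h ≤ s ^ 3 → N = Real.exp ((F y₀ - F x₁) / h) *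
        √(√(π * h / (-deriv w x₁)) * √(π * h / deriv w y₀)) →
      ∀ e : ℝ → ℂ, Continuous e → (∀ x, ‖e x‖ = Real.exp (-(F x / h))) →
      (∀ f : S1 → ℂ, Measurable f → ∫⁻ x in Set.Ioc b (b + 2 * π), ‖windowOp e f x‖ₑ ^ 2 ≤
        ENNReal.ofReal (N * (1 + C * (h / s ^ 3))) ^ 2 * ∫⁻ x, ‖f x‖ₑ ^ 2) ∧
      ∃ f : S1 → ℂ, Measurable f ∧ ∫⁻ x, ‖f x‖ₑ ^ 2 ≠ 0 ∧ ∫⁻ x, ‖f x‖ₑ ^ 2 ≠ ⊤ ∧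
        ENNReal.ofReal (N * (1 - C * (h / s ^ 3))) ^ 2 * ∫⁻ x, ‖f x‖ₑ ^ 2 ≤
          ∫⁻ x in Set.Ioc b (b + 2 * π), ‖windowOp e f x‖ₑ ^ 2 := by
  obtain ⟨C, hC, ρ, hρ, H⟩ := hw.exists_kernel_estimates he
  -- One C comes from the Laplace integrals, the other from the Schur part.
  refine ⟨2 * C, by positivity, ?_⟩
  intro E y₀ x₁ F hl s h N hs hh hhs hN e hec hen
  obtain ⟨hA₁, hA₀, hs0, ⟨d1, d2⟩, ⟨d3, d4⟩, hP, hQ, hP', hQ', hrow, hcol⟩ :=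
    H E y₀ x₁ F hl s h _ _ _ hs hh hhs rfl rfl rfl
  set A₁ := √(π * h / (-deriv w x₁)) with hA₁d
  set A₀ := √(π * h / deriv w y₀) with hA₀d
  set δ := C * (h / s ^ 3) with hδ
  have hδ0 : 0 < δ := by positivity
  have hFc := hl.continuous
  have hpi := Real.two_pi_pos
  have hne : ∀ x, e x ≠ 0 := fun x => norm_pos_iff.1 (by rw [hen]; exact Real.exp_pos _)
  have he2 : ∀ x, ‖e x‖ₑ ^ 2 = ENNReal.ofReal (Real.exp (-(2 * F x₁ / h)) *
      Real.exp (-(2 * (F x - F x₁) / h))) := fun x => by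
    rw [← ofReal_norm, hen, ← ENNReal.ofReal_pow (Real.exp_pos _).le, ← Real.exp_nat_mul,
      ← Real.exp_add]
    congr 2; push_cast; ring
  have hi2 : ∀ x, ‖(e x)⁻¹‖ₑ ^ 2 = ENNReal.ofReal (Real.exp (2 * F y₀ / h) *
      Real.exp (2 * (F x - F y₀) / h)) := fun x => by
    rw [← ofReal_norm, norm_inv, hen, ← Real.exp_neg, ← ENNReal.ofReal_pow (Real.exp_pos _).le,
      ← Real.exp_nat_mul, ← Real.exp_add]
    congr 2; push_cast; ring
  have hei : ∀ x y, ‖e x * (e y)⁻¹‖ₑ = ENNReal.ofReal (Real.exp ((F y - F x) / h)) := fun x y => by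
    rw [← ofReal_norm, norm_mul, norm_inv, hen, hen, ← Real.exp_neg, ← Real.exp_add]
    congr 2; ring
  have lp : ∀ p q, p ≤ q → ∫⁻ x in Set.Ioc p q, ‖e x‖ₑ ^ 2 = ENNReal.ofReal
      (Real.exp (-(2 * F x₁ / h)) * ∫ x in p..q, Real.exp (-(2 * (F x - F x₁) / h))) := by
    intro p q hpq
    simp only [he2]
    rw [setLIntegral_ofReal_eq (by fun_prop) (fun x => by positivity) hpq,
      intervalIntegral.integral_const_mul]
  have lq : ∀ p q, p ≤ q → ∫⁻ x in Set.Ioc p q, ‖(e x)⁻¹‖ₑ ^ 2 = ENNReal.ofReal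
      (Real.exp (2 * F y₀ / h) * ∫ x in p..q, Real.exp (2 * (F x - F y₀) / h)) := by
    intro p q hpq
    simp only [hi2]
    rw [setLIntegral_ofReal_eq (by fun_prop) (fun x => by positivity) hpq,
      intervalIntegral.integral_const_mul]
  have hN2 : ∀ t, (N * t) ^ 2 = (Real.exp (-(2 * F x₁ / h)) * (A₁ * t)) *
      (Real.exp (2 * F y₀ / h) * (A₀ * t)) := by
    intro t
    have e1 : Real.exp ((F y₀ - F x₁) / h) ^ 2 =
        Real.exp (-(2 * F x₁ / h)) * Real.exp (2 * F y₀ / h) := by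
      rw [← Real.exp_nat_mul, ← Real.exp_add]; congr 1; push_cast; ring
    rw [hN, mul_pow, mul_pow, Real.sq_sqrt (by positivity), e1]; ring
  have hN0 : 0 < N := by rw [hN]; positivity
  constructor
  · intro f hf
    have hB : ENNReal.ofReal (N * (1 + 2 * C * (h / s ^ 3))) =
        ENNReal.ofReal (N * (1 + δ)) + ENNReal.ofReal (N * δ) := by
      rw [← ENNReal.ofReal_add (by positivity) (by positivity), hδ]; congr 1; ring
    rw [hB]
    apply windowOp_upper hec hne (P := ENNReal.ofReal (Real.exp (-(2 * F x₁ / h)) * (A₁ * (1 + δ))))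
      (Q := ENNReal.ofReal (Real.exp (2 * F y₀ / h) * (A₀ * (1 + δ))))
    · rw [lp _ _ (by linarith)]
      gcongr
    · rw [lq _ _ (by linarith)]
      gcongr
    · rw [← ENNReal.ofReal_mul (by positivity), ← ENNReal.ofReal_pow (by positivity), hN2]
    · intro x hx
      simp only [hei]
      rw [setLIntegral_ofReal_eq (by fun_prop) (fun x => by positivity) hx.1.le]
      apply ENNReal.ofReal_le_ofReal
      refine (hrow x ⟨hx.1.le, hx.2⟩).trans (le_of_eq ?_)
      rw [hN]; ring
    · intro y hy
      simp only [hei]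
      rw [setLIntegral_congr Ioc_ae_eq_Icc.symm,
        setLIntegral_ofReal_eq (by fun_prop) (fun x => by positivity) hy.2]
      apply ENNReal.ofReal_le_ofReal
      refine (hcol y ⟨hy.1.le, hy.2⟩).trans (le_of_eq ?_)
      rw [hN]; ring
    · exact hf
  · have hr0 : 0 < ρ * s := by positivity
    have hab := hw.lt
    obtain ⟨f, hf, hf2, hlow⟩ := windowOp_lower hec hne (b := b) (p := x₁ - ρ * s)
      (q := x₁ + ρ * s) (r := y₀ - ρ * s) (t := y₀ + ρ * s) (by linarith) (by linarith)
      (by linarith) (by linarith) d1 (by linarith)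
    have hpos : 0 < ∫ x in (y₀ - ρ * s)..(y₀ + ρ * s), Real.exp (2 * (F x - F y₀) / h) :=
      intervalIntegral.intervalIntegral_pos_of_pos
        ((by fun_prop : Continuous fun x => Real.exp (2 * (F x - F y₀) / h)).intervalIntegrable _ _)
        (fun x => Real.exp_pos _) (by linarith)
    refine ⟨f, hf, ?_, ?_, ?_⟩
    · rw [hf2, lq _ _ (by linarith)]
      exact (ENNReal.ofReal_pos.2 (by positivity)).ne'
    · rw [hf2, lq _ _ (by linarith)]
      exact ENNReal.ofReal_ne_top
    · refine le_trans ?_ hlow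
      -- For δ > 1 the lower bound is void: N(1 − 2δ) is negative and its `ENNReal.ofReal` is 0.
      rcases lt_or_ge (1 - δ) 0 with hneg | hnn
      · rw [ENNReal.ofReal_of_nonpos]
        · simp
        · apply mul_nonpos_of_nonneg_of_nonpos hN0.le
          rw [hδ] at hneg hδ0; linarith
      · gcongr
        rw [lp _ _ (by linarith), lq _ _ (by linarith)]
        calc ENNReal.ofReal (N * (1 - 2 * C * (h / s ^ 3))) ^ 2
            ≤ ENNReal.ofReal (N * (1 - δ)) ^ 2 := by
              gcongr
              rw [hδ] at hδ0; linarith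
          _ = ENNReal.ofReal (Real.exp (-(2 * F x₁ / h)) * (A₁ * (1 - δ))) *
              ENNReal.ofReal (Real.exp (2 * F y₀ / h) * (A₀ * (1 - δ))) := by
              rw [← ENNReal.ofReal_mul (by positivity), ← ENNReal.ofReal_pow (by positivity), hN2]
          _ ≤ _ := by gcongr

/-! ### The window operator on the circle -/

/-- `e` is continuous, does not vanish, and is multiplied by `lam` over a period. -/
structure IsQuasiPeriodic (e : ℝ → ℂ) (lam : ℂ) : Prop where
  continuous : Continuous e
  ne_zero : ∀ x, e x ≠ 0
  add_period : ∀ x, e (x + 2 * π) = lam * e x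

theorem ae_restrict_window {p : S1 → Prop} (h : ∀ᵐ x, p x) (x : ℝ) :
    ∀ᵐ y : ℝ ∂(volume : Measure ℝ).restrict (Set.Ioc (x - 2 * π) x), p (y : S1) := by
  have := (AddCircle.measurePreserving_mk (2 * π) (x - 2 * π)).quasiMeasurePreserving.ae h
  rwa [sub_add_cancel] at this

theorem periodic_comp_mk {β : Type*} (f : S1 → β) :
    Function.Periodic (fun y : ℝ => f (y : S1)) (2 * π) := fun y => by
  dsimp only
  rw [AddCircle.coe_add_period]

theorem intervalIntegrable_comp_mk {f : S1 → ℂ} (hf : Integrable f) (p q : ℝ) :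
    IntervalIntegrable (fun y : ℝ => f (y : S1)) volume p q := by
  refine Function.Periodic.intervalIntegrable (periodic_comp_mk f) Real.two_pi_pos.ne' (t := 0) ?_ p q
  rw [intervalIntegrable_iff_integrableOn_Ioc_of_le (by linarith [Real.two_pi_pos])]
  exact (AddCircle.measurePreserving_mk (2 * π) 0).integrable_comp_of_integrable hf

theorem exists_circle_lift {β : Type*} {f : ℝ → β} (hf : Function.Periodic f (2 * π)) :
    ∃ F : S1 → β, ∀ x : ℝ, F (x : S1) = f x :=
  ⟨hf.lift, fun x => hf.lift_coe x⟩

theorem eq_of_lift_eq {β : Type*} {F G : S1 → β} (h : ∀ x : ℝ, F (x : S1) = G (x : S1)) : F = G := by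
  ext x
  induction x using QuotientAddGroup.induction_on with
  | H x => exact h x

/-- `windowOp e f` as a function on the circle. -/
noncomputable def windowCircle (e : ℝ → ℂ) (f : S1 → ℂ) : S1 → ℂ :=
  AddCircle.liftIoc (2 * π) 0 (windowOp e f)

theorem windowOp_congr_ae (e : ℝ → ℂ) {f f' : S1 → ℂ} (h : f =ᵐ[volume] f') (x : ℝ) :
    windowOp e f x = windowOp e f' x := by
  rw [windowOp, windowOp, intervalIntegral.integral_of_le (by linarith [Real.two_pi_pos]),
    intervalIntegral.integral_of_le (by linarith [Real.two_pi_pos])]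
  congr 1
  apply integral_congr_ae
  filter_upwards [ae_restrict_window h x] with y hy
  rw [hy]

theorem windowCircle_congr_ae (e : ℝ → ℂ) {f f' : S1 → ℂ} (h : f =ᵐ[volume] f') :
    windowCircle e f = windowCircle e f' := by
  rw [windowCircle, windowCircle, funext (windowOp_congr_ae e h)]

namespace IsQuasiPeriodic

variable {e : ℝ → ℂ} {lam : ℂ}

theorem lam_ne_zero (he : IsQuasiPeriodic e lam) : lam ≠ 0 := by
  intro h
  have := he.add_period 0
  rw [h, zero_mul] at this
  exact he.ne_zero _ this

theorem continuous_inv (he : IsQuasiPeriodic e lam) : Continuous fun x => (e x)⁻¹ :=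
  he.continuous.inv₀ he.ne_zero

theorem integral_add_period (he : IsQuasiPeriodic e lam) (f : S1 → ℂ) (p q : ℝ) :
    ∫ y in (p + 2 * π)..(q + 2 * π), f (y : S1) / e y =
      lam⁻¹ * ∫ y in p..q, f (y : S1) / e y := by
  rw [← intervalIntegral.integral_comp_add_right (fun y : ℝ => f (y : S1) / e y),
    ← intervalIntegral.integral_const_mul]
  congr 1; ext y
  rw [AddCircle.coe_add_period, he.add_period, div_eq_mul_inv, mul_inv, div_eq_mul_inv]; ring

theorem windowOp_periodic (he : IsQuasiPeriodic e lam) (f : S1 → ℂ) :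
    Function.Periodic (windowOp e f) (2 * π) := by
  intro x
  have h := he.integral_add_period f (x - 2 * π) x
  rw [show x - 2 * π + 2 * π = x + 2 * π - 2 * π by ring] at h
  rw [windowOp, windowOp, h, he.add_period]
  have := he.lam_ne_zero
  field_simp

theorem windowCircle_coe (he : IsQuasiPeriodic e lam) (f : S1 → ℂ) (x : ℝ) :
    windowCircle e f (x : S1) = windowOp e f x := by
  obtain ⟨F, hF⟩ := exists_circle_lift (he.windowOp_periodic f)
  have : windowCircle e f = F := by
    ext y
    obtain ⟨x, hx, rfl⟩ : ∃ x ∈ Set.Ioc (0 : ℝ) (0 + 2 * π), (x : S1) = y := by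
      obtain ⟨x, rfl⟩ := (AddCircle.equivIoc (2 * π) (0 : ℝ)).symm.surjective y
      exact ⟨x, x.2, rfl⟩
    rw [windowCircle, AddCircle.liftIoc_coe_apply hx, hF]
  rw [this, hF]

theorem intervalIntegrable_div (he : IsQuasiPeriodic e lam) {f : S1 → ℂ} (hf : Integrable f)
    (p q : ℝ) : IntervalIntegrable (fun y : ℝ => f (y : S1) / e y) volume p q := by
  simp only [div_eq_mul_inv]
  exact (intervalIntegrable_comp_mk hf p q).mul_continuousOn he.continuous_inv.continuousOn

/-- Both limits of the window move with x, but ∫ over (−2π, x − 2π) is λ times ∫ over (0, x). One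
moving endpoint remains, from which continuity and, for continuous f, the derivative can be read
off. -/
theorem windowOp_eq_primitive (he : IsQuasiPeriodic e lam) {f : S1 → ℂ} (hf : Integrable f)
    (x : ℝ) : windowOp e f x =
      e x * ((1 - lam) * ∫ y in (0 : ℝ)..x, f (y : S1) / e y) +
        e x * ∫ y in (-(2 * π))..0, f (y : S1) / e y := by
  have ii := he.intervalIntegrable_div hf
  have h1 := he.integral_add_period f (-(2 * π)) (x - 2 * π)
  rw [neg_add_cancel, sub_add_cancel] at h1
  have h2 : ∫ y in (x - 2 * π)..x, f (y : S1) / e y =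
      (∫ y in (0 : ℝ)..x, f (y : S1) / e y) + (∫ y in (-(2 * π))..0, f (y : S1) / e y) -
        ∫ y in (-(2 * π))..(x - 2 * π), f (y : S1) / e y := by
    rw [← intervalIntegral.integral_add_adjacent_intervals (ii (x - 2 * π) 0) (ii 0 x),
      ← intervalIntegral.integral_add_adjacent_intervals (ii (-(2 * π)) (x - 2 * π))
        (ii (x - 2 * π) 0)]
    ring
  have h3 : ∫ y in (-(2 * π))..(x - 2 * π), f (y : S1) / e y =
      lam * ∫ y in (0 : ℝ)..x, f (y : S1) / e y := by
    rw [h1, ← mul_assoc, mul_inv_cancel₀ he.lam_ne_zero, one_mul]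
  rw [windowOp, h2, h3]; ring

theorem continuous_windowOp (he : IsQuasiPeriodic e lam) {f : S1 → ℂ} (hf : Integrable f) :
    Continuous (windowOp e f) := by
  rw [funext (he.windowOp_eq_primitive hf)]
  have := intervalIntegral.continuous_primitive (he.intervalIntegrable_div hf) 0
  have := he.continuous
  fun_prop

theorem continuous_windowCircle (he : IsQuasiPeriodic e lam) {f : S1 → ℂ} (hf : Integrable f) :
    Continuous (windowCircle e f) := by
  apply continuous_of_lift
  simp only [he.windowCircle_coe]
  exact he.continuous_windowOp hf

theorem windowCircle_add (he : IsQuasiPeriodic e lam) {f f' : S1 → ℂ} (hf : Integrable f)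
    (hf' : Integrable f') (x : S1) :
    windowCircle e (f + f') x = windowCircle e f x + windowCircle e f' x := by
  refine congrFun (eq_of_lift_eq (F := windowCircle e (f + f'))
    (G := fun x => windowCircle e f x + windowCircle e f' x) fun x => ?_) x
  simp only [he.windowCircle_coe, windowOp, Pi.add_apply, add_div]
  rw [intervalIntegral.integral_add (he.intervalIntegrable_div hf _ _)
    (he.intervalIntegrable_div hf' _ _), mul_add]

theorem windowCircle_smul (he : IsQuasiPeriodic e lam) (c : ℂ) (f : S1 → ℂ) (x : S1) :
    windowCircle e (c • f) x = c * windowCircle e f x := by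
  refine congrFun (eq_of_lift_eq (F := windowCircle e (c • f))
    (G := fun x => c * windowCircle e f x) fun x => ?_) x
  simp only [he.windowCircle_coe, windowOp, Pi.smul_apply, smul_eq_mul, mul_div_assoc]
  rw [intervalIntegral.integral_const_mul]; ring

theorem lintegral_windowCircle (he : IsQuasiPeriodic e lam) (f : S1 → ℂ) (b : ℝ) :
    ∫⁻ x, ‖windowCircle e f x‖ₑ ^ 2 = ∫⁻ x in Set.Ioc b (b + 2 * π), ‖windowOp e f x‖ₑ ^ 2 := by
  rw [← AddCircle.lintegral_preimage (2 * π) b]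
  simp only [he.windowCircle_coe]

/-- A crude bound, valid for every quasi-periodic e, whose only purpose is to make the window
operator bounded on L² before its norm is estimated. -/
theorem exists_bound (he : IsQuasiPeriodic e lam) : ∃ K : ℝ, 0 ≤ K ∧ ∀ f : S1 → ℂ, Measurable f →
    ∫⁻ x, ‖windowCircle e f x‖ₑ ^ 2 ≤ ENNReal.ofReal K ^ 2 * ∫⁻ x, ‖f x‖ₑ ^ 2 := by
  obtain ⟨M₁, hM₁⟩ := (isCompact_Icc (a := -(2 * π)) (b := 2 * π)).exists_bound_of_continuousOn
    he.continuous.continuousOn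
  obtain ⟨M₂, hM₂⟩ := (isCompact_Icc (a := -(2 * π)) (b := 2 * π)).exists_bound_of_continuousOn
    he.continuous_inv.continuousOn
  have hpi := Real.two_pi_pos
  have hM₁0 : 0 ≤ M₁ := (norm_nonneg _).trans (hM₁ 0 ⟨by linarith, by linarith⟩)
  have hM₂0 : 0 ≤ M₂ := (norm_nonneg _).trans (hM₂ 0 ⟨by linarith, by linarith⟩)
  have b₁ : ∀ x ∈ Set.Icc (-(2 * π)) (2 * π), ‖e x‖ₑ ≤ ENNReal.ofReal M₁ := fun x hx => by
    rw [← ofReal_norm]; exact ENNReal.ofReal_le_ofReal (hM₁ x hx)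
  have b₂ : ∀ x ∈ Set.Icc (-(2 * π)) (2 * π), ‖(e x)⁻¹‖ₑ ≤ ENNReal.ofReal M₂ := fun x hx => by
    rw [← ofReal_norm]; exact ENNReal.ofReal_le_ofReal (hM₂ x hx)
  set m₁ := ENNReal.ofReal M₁
  set m₂ := ENNReal.ofReal M₂
  set v := ENNReal.ofReal (2 * π) with hv
  have bound : ∀ (p q : ℝ) (φ : ℝ → ℝ≥0∞) (c : ℝ≥0∞), q - p ≤ 2 * π → (∀ x ∈ Set.Icc p q, φ x ≤ c) →
      ∫⁻ x in Set.Icc p q, φ x ≤ c * v := by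
    intro p q φ c hpq hφ
    calc ∫⁻ x in Set.Icc p q, φ x ≤ ∫⁻ _ in Set.Icc p q, c :=
          setLIntegral_mono' measurableSet_Icc hφ
      _ ≤ c * v := by
          rw [setLIntegral_const, Real.volume_Icc]
          exact mul_le_mul' le_rfl (ENNReal.ofReal_le_ofReal hpq)
  have bound' : ∀ (p q : ℝ) (φ : ℝ → ℝ≥0∞) (c : ℝ≥0∞), q - p ≤ 2 * π →
      (∀ x ∈ Set.Icc p q, φ x ≤ c) → ∫⁻ x in Set.Ioc p q, φ x ≤ c * v := fun p q φ c hpq hφ =>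
    (lintegral_mono_set Set.Ioc_subset_Icc_self).trans (bound p q φ c hpq hφ)
  have hup := fun (f : S1 → ℂ) (hf : Measurable f) =>
    windowOp_upper he.continuous he.ne_zero (b := 0) (P := m₁ ^ 2 * v) (Q := m₂ ^ 2 * v)
    (N := m₁ * m₂ * v) (B := m₁ * m₂ * v) (f := f)
    (bound' _ _ _ _ (by linarith) fun x hx => by
      have := b₁ x ⟨by linarith [hx.1], by linarith [hx.2]⟩
      gcongr)
    (bound' _ _ _ _ (by linarith) fun x hx => by
      have := b₂ x ⟨by linarith [hx.1], by linarith [hx.2]⟩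
      gcongr) (le_of_eq (by ring))
    (fun x hx => bound' _ _ _ _ (by linarith [hx.2]) fun y hy => by
      rw [enorm_mul]
      have h1 := b₁ x ⟨by linarith [hx.1], by linarith [hx.2]⟩
      have h2 := b₂ y ⟨by linarith [hy.1], by linarith [hy.2, hx.2]⟩
      gcongr)
    (fun y hy => bound _ _ _ _ (by linarith [hy.1]) fun x hx => by
      rw [enorm_mul]
      have h1 := b₁ x ⟨by linarith [hx.1, hy.1], by linarith [hx.2]⟩
      have h2 := b₂ y ⟨by linarith [hy.1], by linarith [hy.2]⟩
      gcongr) hf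
  refine ⟨2 * (M₁ * M₂ * (2 * π)), by positivity, fun f hf => ?_⟩
  rw [he.lintegral_windowCircle f 0]
  refine (hup f hf).trans (le_of_eq ?_)
  congr 2
  rw [← two_mul, ENNReal.ofReal_mul zero_le_two, ENNReal.ofReal_mul (by positivity),
    ENNReal.ofReal_mul hM₁0]
  simp [hv, m₁, m₂]

end IsQuasiPeriodic

theorem integrable_L2 (f : L2S1) : Integrable f := (Lp.memLp f).integrable one_le_two

theorem enorm_sq_L2 (f : L2S1) : ‖f‖ₑ ^ 2 = ∫⁻ x, ‖f x‖ₑ ^ 2 := by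
  rw [Lp.enorm_def, eLpNorm_eq_lintegral_rpow_enorm_toReal two_ne_zero ENNReal.ofNat_ne_top]
  simp only [ENNReal.toReal_ofNat, ENNReal.rpow_two]
  exact sq_rpow_half _

theorem memLp_of_continuous {φ : S1 → ℂ} (h : Continuous φ) : MemLp φ 2 (volume : Measure S1) :=
  h.memLp_of_hasCompactSupport (HasCompactSupport.of_compactSpace φ)

theorem norm_le_of_enorm_sq_le {f f' : L2S1} {K : ℝ} (hK : 0 ≤ K)
    (h : ‖f‖ₑ ^ 2 ≤ ENNReal.ofReal K ^ 2 * ‖f'‖ₑ ^ 2) : ‖f‖ ≤ K * ‖f'‖ := by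
  rw [← mul_pow, ENNReal.pow_le_pow_left_iff two_ne_zero, ← ofReal_norm, ← ofReal_norm,
    ← ENNReal.ofReal_mul hK, ENNReal.ofReal_le_ofReal_iff (by positivity)] at h
  exact h

theorem IsQuasiPeriodic.exists_clm {e : ℝ → ℂ} {lam : ℂ} (he : IsQuasiPeriodic e lam) :
    ∃ T : L2S1 →L[ℂ] L2S1, ∀ f : L2S1, T f =ᵐ[volume] windowCircle e f := by
  obtain ⟨K, hK, hb⟩ := he.exists_bound
  have hm : ∀ f : L2S1, MemLp (windowCircle e f) 2 (volume : Measure S1) := fun f =>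
    memLp_of_continuous (he.continuous_windowCircle (integrable_L2 f))
  let L : L2S1 →ₗ[ℂ] L2S1 :=
    { toFun := fun f => (hm f).toLp _
      map_add' := fun f f' => by
        apply Lp.ext
        filter_upwards [(hm (f + f')).coeFn_toLp, (hm f).coeFn_toLp, (hm f').coeFn_toLp,
          Lp.coeFn_add ((hm f).toLp _) ((hm f').toLp _)] with x h1 h2 h3 h4
        rw [h1, h4, Pi.add_apply, h2, h3, windowCircle_congr_ae e (Lp.coeFn_add f f'),
          he.windowCircle_add (integrable_L2 f) (integrable_L2 f')]
      map_smul' := fun c f => by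
        apply Lp.ext
        filter_upwards [(hm (c • f)).coeFn_toLp, (hm f).coeFn_toLp,
          Lp.coeFn_smul c ((hm f).toLp _)] with x h1 h2 h3
        rw [h1, RingHom.id_apply, h3, Pi.smul_apply, h2,
          windowCircle_congr_ae e (Lp.coeFn_smul c f), he.windowCircle_smul, smul_eq_mul] }
  have hL : ∀ f, L f =ᵐ[volume] windowCircle e f := fun f => (hm f).coeFn_toLp
  refine ⟨L.mkContinuous K fun f => norm_le_of_enorm_sq_le hK ?_, hL⟩
  rw [enorm_sq_L2, enorm_sq_L2]
  refine le_trans (le_of_eq (lintegral_congr_ae ?_)) (hb f (Lp.stronglyMeasurable f).measurable)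
  filter_upwards [hL f] with x hx
  rw [hx]

/-! ### The explicit resolvent and the spectrum -/

/-- The phase `∫₀ˣ (z - g)`. -/
noncomputable def phase (g : S1 → ℂ) (z : ℂ) (x : ℝ) : ℂ := ∫ y in (0 : ℝ)..x, (z - g (y : S1))

/-- The solution `e^{iθ/h}` of `(P_h - z) u = 0` on the line, where `θ` is the phase. -/
noncomputable def wave (g : S1 → ℂ) (h : ℝ) (z : ℂ) (x : ℝ) : ℂ :=
  Complex.exp (Complex.I / h * phase g z x)

/-- The monodromy of `wave`. -/
noncomputable def multiplier (g : S1 → ℂ) (h : ℝ) (z : ℂ) : ℂ :=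
  Complex.exp (2 * π * Complex.I / h * (z - mean g))

variable {g : S1 → ℂ} {h : ℝ} {z : ℂ}

theorem IsSmooth.continuous_lift (hg : IsSmooth g) : Continuous fun x : ℝ => g (x : S1) :=
  ContDiff.continuous hg

theorem IsSmooth.continuous (hg : IsSmooth g) : Continuous g := continuous_of_lift hg.continuous_lift

theorem hasDerivAt_phase (hg : IsSmooth g) (x : ℝ) :
    HasDerivAt (phase g z) (z - g (x : S1)) x :=
  (continuous_const.sub hg.continuous_lift).integral_hasStrictDerivAt 0 x |>.hasDerivAt

theorem integral_sub_period (hg : IsSmooth g) (x : ℝ) :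
    ∫ y in x..(x + 2 * π), (z - g (y : S1)) = 2 * π * (z - mean g) := by
  have h1 := (periodic_comp_mk fun y => z - g y).intervalIntegral_add_eq x 0
  rw [h1, zero_add, intervalIntegral.integral_sub intervalIntegrable_const
    (hg.continuous_lift.intervalIntegrable _ _), intervalIntegral.integral_const, mean]
  have : (2 * π : ℂ) ≠ 0 := by exact_mod_cast Real.two_pi_pos.ne'
  rw [sub_zero, Complex.real_smul]
  push_cast
  field_simp

theorem phase_add_period (hg : IsSmooth g) (x : ℝ) :
    phase g z (x + 2 * π) = phase g z x + 2 * π * (z - mean g) := by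
  have ii : ∀ p q : ℝ, IntervalIntegrable (fun y : ℝ => z - g (y : S1)) volume p q := fun p q =>
    (continuous_const.sub hg.continuous_lift).intervalIntegrable p q
  rw [phase, ← intervalIntegral.integral_add_adjacent_intervals (ii 0 x) (ii x _),
    integral_sub_period hg, phase]

theorem hasDerivAt_wave (hg : IsSmooth g) (x : ℝ) :
    HasDerivAt (wave g h z) (Complex.I / h * (z - g (x : S1)) * wave g h z x) x := by
  have := ((hasDerivAt_phase (z := z) hg x).const_mul (Complex.I / h)).cexp
  exact this.congr_deriv (by rw [wave]; ring)

theorem isQuasiPeriodic_wave (hg : IsSmooth g) :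
    IsQuasiPeriodic (wave g h z) (multiplier g h z) where
  continuous := continuous_iff_continuousAt.2 fun x => (hasDerivAt_wave hg x).continuousAt
  ne_zero x := Complex.exp_ne_zero _
  add_period x := by
    rw [wave, wave, multiplier, phase_add_period hg, ← Complex.exp_add]
    congr 1; ring

theorem contDiff_wave (hg : IsSmooth g) : ContDiff ℝ ∞ (wave g h z) := by
  have h1 : ContDiff ℝ ∞ (phase g z) := by
    rw [contDiff_infty_iff_deriv]
    refine ⟨fun x => (hasDerivAt_phase hg x).differentiableAt, ?_⟩
    rw [funext fun x => (hasDerivAt_phase (z := z) hg x).deriv]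
    exact contDiff_const.sub hg
  exact (contDiff_const.mul h1).cexp

theorem norm_wave (x : ℝ) :
    ‖wave g h z x‖ = Real.exp (-((phase g z x).im / h)) := by
  rw [wave, Complex.norm_exp]
  congr 1
  rw [div_mul_eq_mul_div, Complex.div_ofReal_re, Complex.I_mul_re, neg_div]

theorem integral_circle_eq_zero {Ψ Ψ' : S1 → ℂ} (hc : Continuous Ψ')
    (hd : ∀ x : ℝ, HasDerivAt (fun y : ℝ => Ψ (y : S1)) (Ψ' (x : S1)) x) : ∫ x, Ψ' x = 0 := by
  rw [← AddCircle.intervalIntegral_preimage (2 * π) 0, intervalIntegral.integral_eq_sub_of_hasDerivAt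
    (fun x _ => hd x)]
  · rw [AddCircle.coe_add_period, sub_self]
  · exact (hc.comp (AddCircle.continuous_mk' _)).intervalIntegrable _ _

theorem isWeakDeriv_of_hasDerivAt {u v : L2S1} {U V : S1 → ℂ} (hu : u =ᵐ[volume] U)
    (hv : v =ᵐ[volume] V) (hV : Continuous V)
    (hd : ∀ x : ℝ, HasDerivAt (fun y : ℝ => U (y : S1)) (V (x : S1)) x) : IsWeakDeriv u v := by
  intro φ φ' hs hφ
  have cU : Continuous U := continuous_of_lift
    (continuous_iff_continuousAt.2 fun x => (hd x).continuousAt)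
  have cφ : Continuous φ := continuous_of_lift (ContDiff.continuous hs)
  have cφ' : Continuous φ' := continuous_deriv_of_isSmooth hs hφ
  have e1 : ∫ x, u x * φ' x = ∫ x, U x * φ' x := integral_congr_ae (by
    filter_upwards [hu] with x hx; rw [hx])
  have e2 : ∫ x, v x * φ x = ∫ x, V x * φ x := integral_congr_ae (by
    filter_upwards [hv] with x hx; rw [hx])
  have hz := integral_circle_eq_zero (Ψ := fun x => U x * φ x)
    (Ψ' := fun x => V x * φ x + U x * φ' x) ((hV.mul cφ).add (cU.mul cφ'))
    (fun x => (hd x).mul (hφ x))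
  have i : ∀ {ψ : S1 → ℂ}, Continuous ψ → Integrable ψ := fun hψ =>
    (memLp_of_continuous hψ).integrable one_le_two
  have c1 : Continuous fun x => V x * φ x := hV.mul cφ
  have c2 : Continuous fun x => U x * φ' x := cU.mul cφ'
  rw [integral_add (i c1) (i c2)] at hz
  rw [e1, e2]
  linear_combination hz

theorem exists_pairing {ψ : S1 → ℂ} (hψ : Continuous ψ) :
    ∃ ℓ : L2S1 →L[ℂ] ℂ, ∀ f : L2S1, ℓ f = ∫ x, f x * ψ x := by
  have hc : Continuous fun x => (starRingEnd ℂ) (ψ x) := Complex.continuous_conj.comp hψ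
  refine ⟨innerSL ℂ ((memLp_of_continuous hc).toLp _), fun f => ?_⟩
  rw [innerSL_apply_apply, L2.inner_def]
  apply integral_congr_ae
  filter_upwards [(memLp_of_continuous hc).coeFn_toLp] with x hx
  rw [hx, RCLike.inner_apply, Complex.conj_conj]

/-- The lower endpoint contributes −λ f(x), because e(x) = λ e(x − 2π) and f is periodic; this is
the origin of the factor (1 − λ)⁻¹ in the resolvent. -/
theorem hasDerivAt_windowOp {e e' : ℝ → ℂ} {lam : ℂ} (he : IsQuasiPeriodic e lam)
    (hd : ∀ x, HasDerivAt e (e' x) x) {f : S1 → ℂ} (hf : Continuous f) (x : ℝ) :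
    HasDerivAt (windowOp e f) (e' x / e x * windowOp e f x + (1 - lam) * f (x : S1)) x := by
  have hfi : Integrable f := (memLp_of_continuous hf).integrable one_le_two
  have cf : Continuous fun y : ℝ => f (y : S1) / e y :=
    (hf.comp (AddCircle.continuous_mk' _)).div he.continuous he.ne_zero
  have hp := (cf.integral_hasStrictDerivAt 0 x).hasDerivAt
  have h1 := ((hd x).mul (hp.const_mul (1 - lam))).add
    ((hd x).mul_const (∫ y in (-(2 * π))..0, f (y : S1) / e y))
  have e1 : windowOp e f = (e * fun y => (1 - lam) * ∫ y in (0 : ℝ)..y, f (y : S1) / e y) +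
      fun y => e y * ∫ y in (-(2 * π))..0, f (y : S1) / e y := by
    ext y; rw [he.windowOp_eq_primitive hfi]; rfl
  rw [e1]
  refine h1.congr_deriv ?_
  have := he.ne_zero x
  simp only [Pi.add_apply, Pi.mul_apply]
  field_simp
  ring

/-- For continuous f the window function is C¹ and the identity is integration by parts. Both sides
depend continuously on f in L², where continuous functions are dense. -/
theorem windowCircle_isWeakDeriv (hg : IsSmooth g) (hlam : multiplier g h z ≠ 1)
    {T : L2S1 →L[ℂ] L2S1} (hT : ∀ f : L2S1, T f =ᵐ[volume] windowCircle (wave g h z) f) {c : ℂ}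
    (hc : c = Complex.I / h * (1 - multiplier g h z)⁻¹) (f : L2S1) {φ φ' : S1 → ℂ} (hs : IsSmooth φ)
    (hφ : ∀ x : ℝ, HasDerivAt (fun y : ℝ => φ (y : S1)) (φ' (x : S1)) x) :
    ∫ x, (c • T) f x * φ' x = -(Complex.I / h) * ((∫ x, f x * φ x) +
      ∫ x, (c • T) f x * ((z - g x) * φ x)) := by
  have he := isQuasiPeriodic_wave (h := h) (z := z) hg
  have cφ : Continuous φ := continuous_of_lift (ContDiff.continuous hs)
  have cφ' : Continuous φ' := continuous_deriv_of_isSmooth hs hφ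
  have czg : Continuous fun x => (z - g x) := continuous_const.sub hg.continuous
  have czφ : Continuous fun x => (z - g x) * φ x := czg.mul cφ
  obtain ⟨ℓ₁, hℓ₁⟩ := exists_pairing cφ'
  obtain ⟨ℓ₂, hℓ₂⟩ := exists_pairing cφ
  obtain ⟨ℓ₃, hℓ₃⟩ := exists_pairing czφ
  rw [← hℓ₁, ← hℓ₂, ← hℓ₃]
  have key := (ContinuousMap.toLp_denseRange ℂ (volume : Measure S1) (p := 2) ℂ
    ENNReal.ofNat_ne_top).equalizer (g := fun f => ℓ₁ ((c • T) f))
    (h := fun f => -(Complex.I / h) * (ℓ₂ f + ℓ₃ ((c • T) f))) (by fun_prop) (by fun_prop) ?_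
  · exact congrFun key f
  ext F
  simp only [Function.comp_apply]
  set f₀ : L2S1 := ContinuousMap.toLp 2 volume ℂ F with hf₀
  have hF : f₀ =ᵐ[volume] F := ContinuousMap.coeFn_toLp volume F
  have hl : (1 - multiplier g h z) ≠ 0 := sub_ne_zero.2 (Ne.symm hlam)
  set U : S1 → ℂ := fun x => c * windowCircle (wave g h z) F x with hU
  have hFi : Integrable (F : S1 → ℂ) := (memLp_of_continuous F.continuous).integrable one_le_two
  have cU : Continuous U := continuous_const.mul (he.continuous_windowCircle hFi)
  have hu : (c • T) f₀ =ᵐ[volume] U := by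
    filter_upwards [Lp.coeFn_smul c (T f₀), hT f₀] with x h1 h2
    rw [smul_apply, h1, Pi.smul_apply, h2, windowCircle_congr_ae _ hF, hU,
      smul_eq_mul]
  set V : S1 → ℂ := fun x => Complex.I / h * ((z - g x) * U x + F x) with hV
  have cV : Continuous V := continuous_const.mul ((czg.mul cU).add F.continuous)
  have hd : ∀ x : ℝ, HasDerivAt (fun y : ℝ => U (y : S1)) (V (x : S1)) x := by
    intro x
    have h1 := (hasDerivAt_windowOp he (hasDerivAt_wave hg) F.continuous x).const_mul c
    have e1 : (fun y : ℝ => U (y : S1)) = fun y => c * windowOp (wave g h z) F y := by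
      ext y; rw [hU]; dsimp only; rw [he.windowCircle_coe]
    rw [e1]
    refine h1.congr_deriv ?_
    rw [hV, hU]
    dsimp only
    rw [he.windowCircle_coe, mul_div_cancel_right₀ _ (he.ne_zero x), hc]
    field_simp
  have hw := isWeakDeriv_of_hasDerivAt (u := (c • T) f₀) (v := (memLp_of_continuous cV).toLp _) hu
    (memLp_of_continuous cV).coeFn_toLp cV hd φ φ' hs hφ
  rw [hℓ₁, hw, hℓ₂, hℓ₃, ← integral_add (integrable_mul f₀ cφ)
    (integrable_mul ((c • T) f₀) czφ), ← integral_const_mul, ← integral_neg]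
  apply integral_congr_ae
  filter_upwards [(memLp_of_continuous cV).coeFn_toLp, hu, hF] with x h1 h2 h3
  rw [h1, h2, h3, hV]
  ring

theorem mem_hagerGraph_of_window (hg : IsSmooth g) (hh : 0 < h) (hlam : multiplier g h z ≠ 1)
    {T : L2S1 →L[ℂ] L2S1} (hT : ∀ f : L2S1, T f =ᵐ[volume] windowCircle (wave g h z) f) {c : ℂ}
    (hc : c = Complex.I / h * (1 - multiplier g h z)⁻¹) (f : L2S1) :
    ((c • T) f, f + z • (c • T) f) ∈ hagerGraph g h := by
  have he := isQuasiPeriodic_wave (h := h) (z := z) hg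
  set U : S1 → ℂ := fun x => c * windowCircle (wave g h z) f x with hU
  have cU : Continuous U := continuous_const.mul (he.continuous_windowCircle (integrable_L2 f))
  have hu : (c • T) f =ᵐ[volume] U := by
    filter_upwards [Lp.coeFn_smul c (T f), hT f] with x h1 h2
    rw [smul_apply, h1, Pi.smul_apply, h2, smul_eq_mul]
  have czg : Continuous fun x => (z - g x) := continuous_const.sub hg.continuous
  have hm := memLp_of_continuous (czg.mul cU)
  set v : L2S1 := (Complex.I / h : ℂ) • (f + hm.toLp _) with hv
  have hvae : v =ᵐ[volume] fun x => Complex.I / h * (f x + (z - g x) * (c • T) f x) := by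
    filter_upwards [Lp.coeFn_smul (Complex.I / h : ℂ) (f + hm.toLp _), Lp.coeFn_add f (hm.toLp _),
      hm.coeFn_toLp, hu] with x h1 h2 h3 h4
    rw [hv, h1, Pi.smul_apply, h2, Pi.add_apply, h3, h4, smul_eq_mul]
    rfl
  have hh' : (h : ℂ) ≠ 0 := by exact_mod_cast hh.ne'
  refine ⟨v, ?_, ?_⟩
  · intro φ φ' hs hφ
    have cφ : Continuous φ := continuous_of_lift (ContDiff.continuous hs)
    have czφ : Continuous fun x => (z - g x) * φ x := czg.mul cφ
    dsimp only
    rw [windowCircle_isWeakDeriv hg hlam hT hc f hs hφ, ← integral_add (integrable_mul f cφ)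
      (integrable_mul ((c • T) f) czφ), ← integral_const_mul, ← integral_neg]
    apply integral_congr_ae
    filter_upwards [hvae] with x h1
    rw [h1]; ring
  · filter_upwards [hvae, Lp.coeFn_add f (z • (c • T) f), Lp.coeFn_smul z ((c • T) f)]
      with x h1 h2 h3
    rw [h2, Pi.add_apply, h3, Pi.smul_apply, h1, smul_eq_mul]
    field_simp
    ring

/-- Solvability of the transposed equation among smooth functions. -/
theorem exists_transposed_solution (hg : IsSmooth g) (hlam : multiplier g h z ≠ 1)
    {ψ : S1 → ℂ} (hψ : IsSmooth ψ) : ∃ φ : S1 → ℂ, IsSmooth φ ∧ ∀ x : ℝ,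
      HasDerivAt (fun y : ℝ => φ (y : S1))
        ((fun x => ψ x - Complex.I / h * ((z - g x) * φ x)) (x : S1)) x := by
  have he := isQuasiPeriodic_wave (h := h) (z := z) hg
  set e := wave g h z with hew
  set lam := multiplier g h z with hlamd
  have hl : lam - 1 ≠ 0 := sub_ne_zero.2 hlam
  have cf : Continuous fun y : ℝ => e y * ψ (y : S1) := he.continuous.mul hψ.continuous_lift
  have ii : ∀ p q : ℝ, IntervalIntegrable (fun y : ℝ => e y * ψ (y : S1)) volume p q := fun p q =>
    cf.intervalIntegrable p q
  -- The transposed equation has homogeneous solution 1/e, so its periodic solution (λ − 1)⁻¹ e⁻¹ G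
  -- uses a window looking forward from x.
  set G : ℝ → ℂ := fun x => ∫ y in x..(x + 2 * π), e y * ψ (y : S1) with hG
  have hGp : ∀ x, G (x + 2 * π) = lam * G x := by
    intro x
    rw [hG]
    dsimp only
    rw [← intervalIntegral.integral_comp_add_right (fun y : ℝ => e y * ψ (y : S1)),
      ← intervalIntegral.integral_const_mul]
    congr 1; ext y
    rw [AddCircle.coe_add_period, he.add_period]; ring
  have hGd : ∀ x, HasDerivAt G ((lam - 1) * (e x * ψ (x : S1))) x := by
    intro x
    have h1 : ∀ x, HasDerivAt (fun x => ∫ y in (0 : ℝ)..x, e y * ψ (y : S1)) (e x * ψ (x : S1)) x :=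
      fun x => (cf.integral_hasStrictDerivAt 0 x).hasDerivAt
    have h2 := ((h1 (x + 2 * π)).comp_add_const x (2 * π)).sub (h1 x)
    have e1 : G = (fun x => ∫ y in (0 : ℝ)..(x + 2 * π), e y * ψ (y : S1)) -
        fun x => ∫ y in (0 : ℝ)..x, e y * ψ (y : S1) := by
      ext x
      rw [Pi.sub_apply, intervalIntegral.integral_interval_sub_left (ii _ _) (ii _ _)]
    rw [e1]
    refine h2.congr_deriv ?_
    rw [AddCircle.coe_add_period, he.add_period]; ring
  have hGs : ContDiff ℝ ∞ G := by
    rw [contDiff_infty_iff_deriv]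
    refine ⟨fun x => (hGd x).differentiableAt, ?_⟩
    rw [funext fun x => (hGd x).deriv]
    exact contDiff_const.mul ((contDiff_wave hg).mul hψ)
  have hper : Function.Periodic (fun y => (lam - 1)⁻¹ * ((e y)⁻¹ * G y)) (2 * π) := by
    intro y
    dsimp only
    rw [hGp, he.add_period]
    have := he.lam_ne_zero
    field_simp
  obtain ⟨φ, hφ⟩ := exists_circle_lift hper
  refine ⟨φ, ?_, fun x => ?_⟩
  · rw [IsSmooth, funext hφ]
    exact contDiff_const.mul (((contDiff_wave hg).inv he.ne_zero).mul hGs)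
  · rw [funext hφ]
    have h1 := (((hasDerivAt_wave (h := h) (z := z) hg x).inv (he.ne_zero x)).mul
      (hGd x)).const_mul (lam - 1)⁻¹
    refine h1.congr_deriv ?_
    dsimp only
    rw [hφ, ← hew, Pi.inv_apply]
    have := he.ne_zero x
    field_simp
    ring

/-- Duality: pairing an eigenfunction u with the smooth solution of the transposed equation gives ∫
uψ = 0 for every smooth ψ. This says that u is a weak derivative of 0, and uniqueness of weak
derivatives applies. -/
theorem eq_zero_of_mem_hagerGraph (hg : IsSmooth g) (hh : 0 < h) (hlam : multiplier g h z ≠ 1)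
    {u : L2S1} (hu : (u, z • u) ∈ hagerGraph g h) : u = 0 := by
  obtain ⟨v, hv, hae⟩ := hu
  apply IsWeakDeriv.eq_zero
  intro ψ ψ' hψ _
  obtain ⟨φ, hφ, hφd⟩ := exists_transposed_solution hg hlam hψ
  have h1 := hv φ (fun x => ψ x - Complex.I / h * ((z - g x) * φ x)) hφ hφd
  have hh' : (h : ℂ) ≠ 0 := by exact_mod_cast hh.ne'
  have czg : Continuous fun x => (z - g x) := continuous_const.sub hg.continuous
  have h2 : ∫ x, v x * φ x = ∫ x, u x * (Complex.I / h * ((z - g x) * φ x)) := by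
    apply integral_congr_ae
    filter_upwards [hae, Lp.coeFn_smul z u] with x h1 h2
    rw [h2, Pi.smul_apply, smul_eq_mul] at h1
    have h3 : v x = Complex.I / h * ((z - g x) * u x) := by
      have : (z - g x) * u x = h / Complex.I * v x := by linear_combination h1
      rw [this]
      field_simp
    rw [h3]; ring
  have h0 : ∫ x, (0 : L2S1) x * ψ' x = 0 := by
    rw [← integral_zero S1 ℂ]
    apply integral_congr_ae
    filter_upwards [Lp.coeFn_zero ℂ 2 (volume : Measure S1)] with x hx
    rw [hx]; simp
  have cc : Continuous fun x => Complex.I / h * ((z - g x) * φ x) :=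
    continuous_const.mul (czg.mul hφ.continuous)
  have h3 : ∫ x, u x * (ψ x - Complex.I / h * ((z - g x) * φ x)) =
      (∫ x, u x * ψ x) - ∫ x, u x * (Complex.I / h * ((z - g x) * φ x)) := by
    rw [← integral_sub (integrable_mul u hψ.continuous) (integrable_mul u cc)]
    congr 1; ext x; ring
  rw [h0]
  dsimp only at h1
  rw [h3, h2] at h1
  linear_combination h1

theorem mem_hagerGraph_iff {u f : L2S1} : (u, f) ∈ hagerGraph g h ↔
    ∃ hu : u ∈ (hagerOperator g h).domain, hagerOperator g h ⟨u, hu⟩ = f := by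
  rw [← hagerOperator_graph, LinearPMap.mem_graph_iff]
  constructor
  · rintro ⟨⟨y, hy⟩, rfl, h2⟩
    exact ⟨hy, h2⟩
  · rintro ⟨hu, h2⟩
    exact ⟨⟨u, hu⟩, rfl, h2⟩

/-- Away from the spectrum the resolvent is a multiple of `windowCircle`. -/
theorem exists_resolvent (hg : IsSmooth g) (hh : 0 < h) (hlam : multiplier g h z ≠ 1) :
    ∃ R : L2S1 →L[ℂ] L2S1, IsResolventAt (hagerOperator g h) z R ∧ ∀ f : L2S1,
      R f =ᵐ[volume] fun x => Complex.I / h * (1 - multiplier g h z)⁻¹ *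
        windowCircle (wave g h z) f x := by
  obtain ⟨T, hT⟩ := (isQuasiPeriodic_wave (h := h) (z := z) hg).exists_clm
  set c := Complex.I / h * (1 - multiplier g h z)⁻¹ with hc
  have hgr := mem_hagerGraph_of_window hg hh hlam hT hc
  refine ⟨c • T, ⟨fun f => ?_, fun u => ?_⟩, fun f => ?_⟩
  · obtain ⟨hd, he⟩ := mem_hagerGraph_iff.1 (hgr f)
    exact ⟨hd, by rw [he]; abel⟩
  · set f := hagerOperator g h u - z • (u : L2S1) with hf
    have h1 : ((u : L2S1), f + z • (u : L2S1)) ∈ hagerGraph g h :=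
      mem_hagerGraph_iff.2 ⟨u.2, by rw [hf]; simp⟩
    have h2 := (hagerGraph g h).sub_mem (hgr f) h1
    have e : ((c • T) f, f + z • (c • T) f) - ((u : L2S1), f + z • (u : L2S1)) =
        ((c • T) f - u, z • ((c • T) f - u)) := by
      rw [Prod.mk_sub_mk, smul_sub]; congr 1; abel
    rw [e] at h2
    exact sub_eq_zero.1 (eq_zero_of_mem_hagerGraph hg hh hlam h2)
  · filter_upwards [Lp.coeFn_smul c (T f), hT f] with x h1 h2
    rw [smul_apply, h1, Pi.smul_apply, h2, smul_eq_mul]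

/-- With trivial monodromy the wave descends to the circle as a nowhere vanishing eigenfunction,
which a left inverse of P_h − z would have to kill. -/
theorem mem_spec_of_multiplier_eq_one (hg : IsSmooth g) (hh : 0 < h) (hlam : multiplier g h z = 1) :
    z ∈ spec (hagerOperator g h) := by
  rintro ⟨R, hR⟩
  have he := isQuasiPeriodic_wave (h := h) (z := z) hg
  obtain ⟨U, hU⟩ := exists_circle_lift (f := wave g h z) (fun x => by
    rw [he.add_period, hlam, one_mul])
  have cU : Continuous U := continuous_of_lift (by rw [funext hU]; exact he.continuous)
  have czg : Continuous fun x => (z - g x) := continuous_const.sub hg.continuous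
  have cV : Continuous fun x => Complex.I / h * (z - g x) * U x :=
    (continuous_const.mul czg).mul cU
  have hu := (memLp_of_continuous cU).coeFn_toLp
  have hv := (memLp_of_continuous cV).coeFn_toLp
  set u : L2S1 := (memLp_of_continuous cU).toLp _ with hud
  have hh' : (h : ℂ) ≠ 0 := by exact_mod_cast hh.ne'
  have hmem : (u, z • u) ∈ hagerGraph g h := by
    refine ⟨(memLp_of_continuous cV).toLp _, ?_, ?_⟩
    · refine isWeakDeriv_of_hasDerivAt hu hv cV fun x => ?_
      rw [funext hU, hU]
      exact hasDerivAt_wave hg x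
    · filter_upwards [hu, hv, Lp.coeFn_smul z u] with x h1 h2 h3
      rw [h3, h2, Pi.smul_apply, h1, smul_eq_mul]
      field_simp
      ring
  obtain ⟨hd, heq⟩ := mem_hagerGraph_iff.1 hmem
  have h0 := hR.2 ⟨u, hd⟩
  rw [heq, sub_self, map_zero] at h0
  replace h0 : u = 0 := h0.symm
  have hae : U =ᵐ[volume] 0 := by
    filter_upwards [hu, Lp.coeFn_zero ℂ 2 (volume : Measure S1)] with x h1 h2
    rw [← h1, h0, h2]
  have hUz : U = 0 := (cU.ae_eq_iff_eq volume continuous_zero).1 hae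
  have := hU 0
  rw [hUz] at this
  exact he.ne_zero 0 this.symm

/-! ### From the potential to the single-peak setting -/

theorem deriv_nonpos_of_nonpos_right {f : ℝ → ℝ} {f' c d : ℝ} (hf : HasDerivAt f f' c)
    (hc : f c = 0) (hcd : c < d) (h : ∀ x ∈ Set.Ioo c d, f x ≤ 0) : f' ≤ 0 := by
  have ht : Filter.Tendsto (slope f c) (nhdsWithin c (Set.Ioi c)) (nhds f') :=
    (hasDerivAt_iff_tendsto_slope.1 hf).mono_left
      (nhdsWithin_mono c (fun x (hx : c < x) => hx.ne'))
  refine le_of_tendsto ht ?_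
  filter_upwards [Ioo_mem_nhdsGT hcd] with x hx
  rw [slope_def_field, hc, sub_zero]
  exact div_nonpos_of_nonpos_of_nonneg (h x hx) (by linarith [hx.1])

theorem pos_on_Ioo_of_ne_zero {f : ℝ → ℝ} (hf : Continuous f) {p q ξ : ℝ}
    (hne : ∀ x ∈ Set.Ioo p q, f x ≠ 0) (hξ : ξ ∈ Set.Ioo p q) (hpos : 0 < f ξ) :
    ∀ x ∈ Set.Ioo p q, 0 < f x := by
  intro x hx
  by_contra hle
  obtain ⟨y, hy, hy0⟩ := isPreconnected_Ioo.intermediate_value hx hξ hf.continuousOn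
    ⟨not_lt.1 hle, hpos.le⟩
  exact hne y hy hy0

section SinglePeak

variable {w : ℝ → ℝ} {a b : ℝ}

theorem SinglePeak.mem_Icc (hw : SinglePeak w a b) (x : ℝ) : w x ∈ Set.Icc (w a) (w b) := by
  obtain ⟨k, hk, -⟩ := existsUnique_sub_zsmul_mem_Ico Real.two_pi_pos x a
  suffices h : w (x - k • (2 * π)) ∈ Set.Icc (w a) (w b) by
    rwa [hw.periodic.sub_zsmul_eq k] at h
  set y := x - k • (2 * π)
  rcases le_total y b with h | h
  · exact ⟨hw.strictMonoOn.monotoneOn ⟨le_rfl, hw.lt.le⟩ ⟨hk.1, h⟩ hk.1,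
      hw.strictMonoOn.monotoneOn ⟨hk.1, h⟩ ⟨hw.lt.le, le_rfl⟩ h⟩
  · refine ⟨?_, hw.strictAntiOn.antitoneOn ⟨le_rfl, hw.lt_add.le⟩ ⟨h, hk.2.le⟩ h⟩
    rw [← hw.periodic a]
    exact hw.strictAntiOn.antitoneOn ⟨h, hk.2.le⟩ ⟨hw.lt_add.le, le_rfl⟩ hk.2.le

theorem SinglePeak.deriv_left_eq_zero (hw : SinglePeak w a b) : deriv w a = 0 :=
  IsLocalMin.deriv_eq_zero (Filter.Eventually.of_forall fun x => (hw.mem_Icc x).1)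

/-- Two points of opposite slopes can be translated next to the peak `b`. -/
theorem SinglePeak.exists_shift (hw : SinglePeak w a b) {x y : ℝ} (hx : deriv w x < 0)
    (hy : 0 < deriv w y) (hxy : x - 2 * π < y) (hyx : y < x) :
    ∃ k : ℤ, x + k • (2 * π) ∈ Set.Ioo b (a + 2 * π) ∧ y + k • (2 * π) ∈ Set.Ioo a b := by
  have hp := periodic_deriv hw.periodic
  have dec : ∀ t ∈ Set.Icc b (a + 2 * π), deriv w t ≤ 0 := by
    intro t ht
    rcases ht.1.eq_or_lt with h | h
    · rw [← h, hw.deriv_eq_zero]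
    rcases ht.2.eq_or_lt with h' | h'
    · rw [h', hp a, hw.deriv_left_eq_zero]
    · exact (hw.deriv_neg t ⟨h, h'⟩).le
  obtain ⟨k, hk, -⟩ := existsUnique_add_zsmul_mem_Ico Real.two_pi_pos x a
  refine ⟨k, ?_⟩
  rw [← hp.zsmul k x] at hx
  rw [← hp.zsmul k y] at hy
  set x' := x + k • (2 * π) with hx'
  set y' := y + k • (2 * π) with hy'
  have hxy' : x' - 2 * π < y' := by linarith
  have hyx' : y' < x' := by linarith
  have hbx : b < x' := by
    by_contra hle
    have hle := not_lt.1 hle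
    rcases hle.eq_or_lt with h | h
    · rw [h, hw.deriv_eq_zero] at hx; exact lt_irrefl _ hx
    rcases hk.1.eq_or_lt with h' | h'
    · rw [← h', hw.deriv_left_eq_zero] at hx; exact lt_irrefl _ hx
    · exact lt_asymm hx (hw.deriv_pos x' ⟨h', h⟩)
  refine ⟨⟨hbx, hk.2⟩, ?_, ?_⟩
  · by_contra hle
    have hle := not_lt.1 hle
    have := dec (y' + 2 * π) ⟨by linarith, by linarith⟩
    rw [hp y'] at this
    linarith
  · by_contra hle
    have := dec y' ⟨not_lt.1 hle, by linarith [hk.2]⟩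
    linarith

/-- The constants of a level, on both sides of the peak. -/
theorem SinglePeak.exists_slope_bounds {e₀ : ℝ} (hw : SinglePeak w a b) (he : w a < e₀) :
    ∃ c > 0, ∃ C > 0, ∀ E y₀ x₁ F, PeakLevel w a b e₀ E y₀ x₁ F →
      c * (w b - E) ≤ -deriv w x₁ * deriv w y₀ ∧ -deriv w x₁ * deriv w y₀ ≤ C * (w b - E) := by
  obtain ⟨c, hc, C, hC, H⟩ := hw.exists_bounds he
  obtain ⟨c', hc', C', hC', H'⟩ := hw.reflect.exists_bounds (hw.reflect_apply_lt he)
  refine ⟨c * c', by positivity, C * C', by positivity, fun E y₀ x₁ F hl => ?_⟩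
  obtain ⟨hs0, -, -, -, h3, h4, -⟩ := H E y₀ x₁ F hl _ rfl
  obtain ⟨-, -, -, -, h3', h4', -⟩ := H' E (-x₁) (-y₀) _ hl.reflect _ rfl
  have hd : -deriv (fun x => w (-x)) (-y₀) = deriv w y₀ := by
    rw [deriv_comp_neg, neg_neg, neg_neg]
  rw [hd, neg_neg] at h3' h4'
  set s := √(w b - E)
  have hs2 : s ^ 2 = w b - E := Real.sq_sqrt (Real.sqrt_pos.1 hs0).le
  rw [← hs2]
  have p1 : 0 ≤ c * s := by positivity
  have p2 : 0 ≤ c' * s := by positivity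
  constructor
  · calc c * c' * s ^ 2 = (c * s) * (c' * s) := by ring
      _ ≤ _ := mul_le_mul h3 h3' p2 (p1.trans h3)
  · calc -deriv w x₁ * deriv w y₀ ≤ (C * s) * (C' * s) :=
          mul_le_mul h4 h4' (p2.trans h3') (by positivity)
      _ = _ := by ring

end SinglePeak

section Potential

variable {g : S1 → ℂ} {a b : ℝ} {z : ℂ}

theorem IsSmooth.contDiff_imLift (hg : IsSmooth g) : ContDiff ℝ ∞ (imLift g) :=
  Complex.imCLM.contDiff.comp hg

theorem periodic_imLift (g : S1 → ℂ) : Function.Periodic (imLift g) (2 * π) :=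
  periodic_comp_mk fun x => (g x).im

namespace IsHagerPotential

/-- The mean value theorem on each arc between the critical points supplies one point where the
derivative has the expected sign, and absence of zeros spreads the sign over the arc. Nondegeneracy
then makes the second-derivative inequalities strict. -/
theorem deriv_signs (hg : IsHagerPotential g a b) :
    (∀ x ∈ Set.Ioo a b, 0 < deriv (imLift g) x) ∧
      (∀ x ∈ Set.Ioo b (a + 2 * π), deriv (imLift g) x < 0) ∧
      deriv (deriv (imLift g)) b < 0 ∧ 0 < deriv (deriv (imLift g)) a := by
  have hs := hg.smooth.contDiff_imLift
  have hs' : ContDiff ℝ ∞ (deriv (imLift g)) := (contDiff_infty_iff_deriv.1 hs).2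
  have hd : ∀ x, HasDerivAt (imLift g) (deriv (imLift g) x) x := fun x =>
    (hs.differentiable (by simp) x).hasDerivAt
  have hd' : ∀ x, HasDerivAt (deriv (imLift g)) (deriv (deriv (imLift g)) x) x := fun x =>
    (hs'.differentiable (by simp) x).hasDerivAt
  have hab := hg.lt
  have hba := hg.lt_add
  have ne1 : ∀ x ∈ Set.Ioo a b, deriv (imLift g) x ≠ 0 := fun x hx h0 => by
    rcases (hg.critical x ⟨hx.1.le, by linarith [hx.2]⟩).1 h0 with h | h
    · exact hx.1.ne' h
    · exact hx.2.ne h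
  have ne2 : ∀ x ∈ Set.Ioo b (a + 2 * π), -deriv (imLift g) x ≠ 0 := fun x hx h0 => by
    rcases (hg.critical x ⟨by linarith [hx.1], hx.2⟩).1 (neg_eq_zero.1 h0) with h | h
    · linarith [hx.1]
    · exact hx.1.ne' h
  have p1 : ∀ x ∈ Set.Ioo a b, 0 < deriv (imLift g) x := by
    obtain ⟨ξ, hξ, e⟩ := exists_hasDerivAt_eq_slope (imLift g) _ hab hs.continuous.continuousOn
      (fun x _ => hd x)
    refine pos_on_Ioo_of_ne_zero hs'.continuous ne1 hξ ?_
    rw [e]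
    exact div_pos (by linarith [hg.im_lt]) (by linarith)
  have p2 : ∀ x ∈ Set.Ioo b (a + 2 * π), 0 < -deriv (imLift g) x := by
    obtain ⟨ξ, hξ, e⟩ := exists_hasDerivAt_eq_slope (imLift g) _ hba hs.continuous.continuousOn
      (fun x _ => hd x)
    refine pos_on_Ioo_of_ne_zero (f := fun x => -deriv (imLift g) x) hs'.continuous.neg ne2 hξ ?_
    rw [e, periodic_imLift g a, ← neg_div, neg_sub]
    exact div_pos (by linarith [hg.im_lt]) (by linarith)
  have z1 : deriv (imLift g) a = 0 := (hg.critical a ⟨le_rfl, by linarith⟩).2 (Or.inl rfl)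
  have z2 : deriv (imLift g) b = 0 := (hg.critical b ⟨hab.le, hba⟩).2 (Or.inr rfl)
  refine ⟨p1, fun x hx => by linarith [p2 x hx], lt_of_le_of_ne ?_ hg.nondeg_max,
    lt_of_le_of_ne ?_ hg.nondeg_min.symm⟩
  · exact deriv_nonpos_of_nonpos_right (hd' b) z2 hba fun x hx => by linarith [p2 x hx]
  · have := deriv_nonpos_of_nonpos_right (hd' a).neg (by simp [z1]) hab fun x hx => by
      simpa using (p1 x hx).le
    linarith

theorem singlePeak (hg : IsHagerPotential g a b) : SinglePeak (imLift g) a b where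
  smooth := hg.smooth.contDiff_imLift
  periodic := periodic_imLift g
  lt := hg.lt
  lt_add := hg.lt_add
  deriv_pos := hg.deriv_signs.1
  deriv_neg := hg.deriv_signs.2.1
  second_neg := hg.deriv_signs.2.2.1

/-- For levels below the mean the relevant extremum is the minimum a. Changing the sign of both w
and x makes it a peak at −a and keeps the form F' = E − w, with −Im z as the level and F(−x) as the
primitive. -/
theorem singlePeak_neg (hg : IsHagerPotential g a b) :
    SinglePeak (fun x => -imLift g (-x)) (-b) (-a) := by
  have hd : deriv (fun x => -imLift g (-x)) = fun x => deriv (imLift g) (-x) := by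
    ext x; rw [deriv.fun_neg, deriv_comp_neg, neg_neg]
  obtain ⟨h1, h2, h3, h4⟩ := hg.deriv_signs
  exact
  { smooth := (hg.smooth.contDiff_imLift.comp contDiff_neg).neg
    periodic := fun x => by
      have := periodic_imLift g (-(x + 2 * π))
      dsimp only
      rw [← this]; ring_nf
    lt := by linarith [hg.lt]
    lt_add := by linarith [hg.lt_add]
    deriv_pos := fun x hx => by
      rw [hd]; exact h1 (-x) ⟨by linarith [hx.2], by linarith [hx.1]⟩
    deriv_neg := fun x hx => by
      rw [hd]
      dsimp only
      rw [← periodic_deriv (periodic_imLift g) (-x)]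
      exact h2 _ ⟨by linarith [hx.2], by linarith [hx.1]⟩
    second_neg := by
      rw [hd, deriv_comp_neg (f := deriv (imLift g)), neg_neg]; linarith }

theorem sigma_eq (hg : IsHagerPotential g a b) :
    sigma g = Complex.im ⁻¹' Set.Icc (imLift g a) (imLift g b) := by
  have hw := hg.singlePeak
  have e : {z : ℂ | ∃ x ξ : ℝ, symbol g x ξ = z} =
      Complex.im ⁻¹' Set.Icc (imLift g a) (imLift g b) := by
    ext z
    constructor
    · rintro ⟨x, ξ, rfl⟩
      have := hw.mem_Icc x
      simpa [symbol, imLift] using this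
    · intro hz
      obtain ⟨x, -, hx⟩ := intermediate_value_Icc hw.lt.le hw.continuous.continuousOn hz
      refine ⟨x, z.re - (g (x : S1)).re, ?_⟩
      apply Complex.ext
      · simp [symbol]
      · simpa [symbol, imLift] using hx
  rw [sigma, e]
  exact (isClosed_Icc.preimage Complex.continuous_im).closure_eq

theorem frontier_sigma (hg : IsHagerPotential g a b) :
    frontier (sigma g) = Complex.im ⁻¹' {imLift g a, imLift g b} := by
  rw [hg.sigma_eq, Complex.frontier_preimage_im, frontier_Icc hg.im_lt.le]

theorem dBdry_le (hg : IsHagerPotential g a b) {t : ℝ} (ht : t ∈ ({imLift g a, imLift g b} : Set ℝ)) :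
    dBdry g z ≤ |z.im - t| := by
  rw [dBdry, hg.frontier_sigma]
  have hm : (⟨z.re, t⟩ : ℂ) ∈ Complex.im ⁻¹' ({imLift g a, imLift g b} : Set ℝ) := ht
  refine (Metric.infDist_le_dist_of_mem hm).trans (le_of_eq ?_)
  rw [Complex.dist_of_re_eq (z := z) (w := ⟨z.re, t⟩) rfl, Real.dist_eq]

theorem le_dBdry (hg : IsHagerPotential g a b) {r : ℝ} (ha : r ≤ |z.im - imLift g a|)
    (hb : r ≤ |z.im - imLift g b|) : r ≤ dBdry g z := by
  have hne : (Complex.im ⁻¹' ({imLift g a, imLift g b} : Set ℝ)).Nonempty :=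
    ⟨⟨0, imLift g a⟩, Or.inl rfl⟩
  rw [dBdry, hg.frontier_sigma, Metric.le_infDist hne]
  intro y hy
  have h1 : |z.im - y.im| ≤ dist z y := by
    rw [Complex.dist_eq, ← Complex.sub_im]; exact Complex.abs_im_le_norm _
  rcases hy with h | h
  · have h : y.im = imLift g a := h
    rw [h] at h1; exact ha.trans h1
  · have h : y.im = imLift g b := h
    rw [h] at h1; exact hb.trans h1

theorem exists_turningPair (hg : IsHagerPotential g a b) (hz : z ∈ interior (sigma g)) :
    ∃ xp xm : ℝ, IsTurningPair g z xp xm := by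
  have hw := hg.singlePeak
  rw [hg.sigma_eq, Complex.interior_preimage_im, interior_Icc] at hz
  obtain ⟨y, hy, hy'⟩ := intermediate_value_Ioo hw.lt.le hw.continuous.continuousOn hz
  have hz' : z.im ∈ Set.Ioo (imLift g (a + 2 * π)) (imLift g b) := by
    rw [hw.periodic a]; exact hz
  obtain ⟨x, hx, hx'⟩ := intermediate_value_Ioo' hw.lt_add.le hw.continuous.continuousOn hz'
  refine ⟨x, y + 2 * π, hx', by rw [hw.periodic y, hy'], hw.deriv_neg x hx, ?_, ?_, ?_⟩
  · rw [periodic_deriv hw.periodic y]; exact hw.deriv_pos y hy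
  · linarith [hx.1, hy.2]
  · linarith [hx.2, hy.1]

/-- Strictness matters: the mean serves as the threshold e₀ on both sides, so levels treated at one
extremum stay uniformly away from the other. -/
theorem mean_mem (hg : IsHagerPotential g a b) :
    imLift g a < (mean g).im ∧ (mean g).im < imLift g b := by
  have hw := hg.singlePeak
  have hpi := Real.two_pi_pos
  have e : ∫ x in a..(a + 2 * π), imLift g x = 2 * π * (mean g).im := by
    have h1 := integral_sub_period (z := 0) hg.smooth a
    have h2 := Complex.imCLM.intervalIntegral_comp_comm (μ := volume) (a := a) (b := a + 2 * π)
      ((continuous_const.sub hg.smooth.continuous_lift).intervalIntegrable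
        (u := fun y : ℝ => (0 : ℂ) - g (y : S1)) a (a + 2 * π))
    rw [h1] at h2
    simp only [Complex.imCLM_apply, zero_sub, Complex.neg_im, intervalIntegral.integral_neg] at h2
    have h3 : (2 * (π : ℂ) * -mean g).im = -(2 * π * (mean g).im) := by
      rw [show (2 * (π : ℂ)) = ((2 * π : ℝ) : ℂ) by push_cast; ring, Complex.im_ofReal_mul,
        Complex.neg_im]
      ring
    rw [h3] at h2
    have h4 : ∫ x in a..(a + 2 * π), imLift g x = ∫ x in a..(a + 2 * π), (g (x : S1)).im := rfl
    linarith
  have hlt : a < a + 2 * π := by linarith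
  have hbm : b ∈ Set.Icc a (a + 2 * π) := ⟨hw.lt.le, hw.lt_add.le⟩
  constructor
  · have := intervalIntegral.integral_lt_integral_of_continuousOn_of_le_of_exists_lt hlt
      (f := fun _ => imLift g a) continuousOn_const hw.continuous.continuousOn
      (fun x _ => (hw.mem_Icc x).1) ⟨b, hbm, hg.im_lt⟩
    rw [e, intervalIntegral.integral_const, smul_eq_mul, add_sub_cancel_left] at this
    exact lt_of_mul_lt_mul_left this hpi.le
  · have := intervalIntegral.integral_lt_integral_of_continuousOn_of_le_of_exists_lt hlt
      (g := fun _ => imLift g b) hw.continuous.continuousOn continuousOn_const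
      (fun x _ => (hw.mem_Icc x).2) ⟨a, ⟨le_rfl, hlt.le⟩, hg.im_lt⟩
    rw [e, intervalIntegral.integral_const, smul_eq_mul, add_sub_cancel_left] at this
    exact lt_of_mul_lt_mul_left this hpi.le

end IsHagerPotential

theorem hasDerivAt_phase_im (hg : IsSmooth g) (x : ℝ) :
    HasDerivAt (fun x => (phase g z x).im) (z.im - imLift g x) x := by
  have := Complex.imCLM.hasFDerivAt.comp_hasDerivAt x (hasDerivAt_phase (z := z) hg x)
  simpa [imLift, Function.comp_def] using this

theorem phase_im_add_period (hg : IsSmooth g) (x : ℝ) :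
    (phase g z (x + 2 * π)).im = (phase g z x).im + 2 * π * (z.im - (mean g).im) := by
  rw [phase_add_period hg, Complex.add_im,
    show (2 * (π : ℂ)) = ((2 * π : ℝ) : ℂ) by push_cast; ring, Complex.im_ofReal_mul, Complex.sub_im]

theorem integral_eq_phase_sub (hg : IsSmooth g) (p q : ℝ) :
    ∫ y in p..q, (z - g (y : S1)) = phase g z q - phase g z p :=
  intervalIntegral.integral_eq_sub_of_hasDerivAt (fun x _ => hasDerivAt_phase hg x)
    ((continuous_const.sub hg.continuous_lift).intervalIntegrable p q)

/-- The two integrals in the minimum differ by 2π(Im z − ⟨Im g⟩), so the side of the mean decides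
which one is smaller. -/
theorem action_of_le (hg : IsSmooth g) (h : z.im ≤ (mean g).im) (xp xm : ℝ) :
    action g z xp xm = (phase g z xm).im - (phase g z xp).im := by
  rw [action, integral_eq_phase_sub hg, integral_eq_phase_sub hg, Complex.sub_im, Complex.sub_im]
  apply min_eq_left
  have h1 := phase_im_add_period (z := z) hg (xm - 2 * π)
  rw [sub_add_cancel] at h1
  nlinarith [Real.two_pi_pos]

theorem action_of_ge (hg : IsSmooth g) (h : (mean g).im ≤ z.im) (xp xm : ℝ) :
    action g z xp xm = (phase g z (xm - 2 * π)).im - (phase g z xp).im := by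
  rw [action, integral_eq_phase_sub hg, integral_eq_phase_sub hg, Complex.sub_im, Complex.sub_im]
  apply min_eq_right
  have h1 := phase_im_add_period (z := z) hg (xm - 2 * π)
  rw [sub_add_cancel] at h1
  nlinarith [Real.two_pi_pos]

/-- Here {p, p̄} = −2i Im g', so the two factors are Im g'(x₊) and −Im g'(x₋). At a turning pair
both are negative, and their product is positive. -/
theorem bracketProduct_eq (hg : IsSmooth g) (xp xm : ℝ) :
    bracketProduct g z xp xm = -deriv (imLift g) xp * deriv (imLift g) xm := by
  have hd : ∀ x, HasDerivAt (fun y : ℝ => g (y : S1)) (deriv (fun y : ℝ => g (y : S1)) x) x :=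
    fun x => (ContDiff.differentiable hg (by simp) x).hasDerivAt
  have him : ∀ x, deriv (imLift g) x = (deriv (fun y : ℝ => g (y : S1)) x).im := fun x =>
    (Complex.imCLM.hasFDerivAt.comp_hasDerivAt x (hd x)).deriv
  have s1 : ∀ x ξ, HasDerivAt (fun y => symbol g y ξ) (deriv (fun y : ℝ => g (y : S1)) x) x :=
    fun x ξ => (hd x).const_add _
  have s2 : ∀ x ξ, HasDerivAt (fun η => symbol g x η) 1 ξ := fun x ξ =>
    (Complex.ofRealCLM.hasDerivAt (x := ξ)).add_const _ |>.congr_deriv (by simp)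
  have conj : ∀ {f : ℝ → ℂ} {f' : ℂ} {x : ℝ}, HasDerivAt f f' x →
      HasDerivAt (fun y => (starRingEnd ℂ) (f y)) ((starRingEnd ℂ) f') x := fun {f f' x} hf =>
    (Complex.conjCLE : ℂ →L[ℝ] ℂ).hasFDerivAt.comp_hasDerivAt x hf
  have t1 : ∀ x ξ, deriv (fun y => symbolConj g y ξ) x =
      (starRingEnd ℂ) (deriv (fun y : ℝ => g (y : S1)) x) := fun x ξ => (conj (s1 x ξ)).deriv
  have t2 : ∀ x ξ, deriv (fun η => symbolConj g x η) ξ = 1 := fun x ξ => by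
    have := (conj (s2 x ξ)).deriv
    rwa [map_one] at this
  simp only [bracketProduct, poisson, t1, t2, (s1 _ _).deriv, (s2 _ _).deriv, him]
  simp
  ring

end Potential

/-! ### Norm bounds on the circle and reflection -/

/-- `U` bounds the norm of `windowCircle e` on `L²` from above, `L` bounds it from below. -/
structure HasWindowBounds (e : ℝ → ℂ) (L U : ℝ) : Prop where
  upper : ∀ f : S1 → ℂ, Measurable f →
    ∫⁻ x, ‖windowCircle e f x‖ₑ ^ 2 ≤ ENNReal.ofReal U ^ 2 * ∫⁻ x, ‖f x‖ₑ ^ 2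
  lower : ∃ f : S1 → ℂ, Measurable f ∧ ∫⁻ x, ‖f x‖ₑ ^ 2 ≠ 0 ∧ ∫⁻ x, ‖f x‖ₑ ^ 2 ≠ ⊤ ∧
    ENNReal.ofReal L ^ 2 * ∫⁻ x, ‖f x‖ₑ ^ 2 ≤ ∫⁻ x, ‖windowCircle e f x‖ₑ ^ 2

theorem IsQuasiPeriodic.reflect {e : ℝ → ℂ} {lam : ℂ} (he : IsQuasiPeriodic e lam) :
    IsQuasiPeriodic (fun x => e (-x)) lam⁻¹ where
  continuous := he.continuous.comp continuous_neg
  ne_zero x := he.ne_zero _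
  add_period x := by
    have := he.add_period (-(x + 2 * π))
    rw [show -(x + 2 * π) + 2 * π = -x by ring] at this
    rw [this, inv_mul_cancel_left₀ he.lam_ne_zero]

theorem IsQuasiPeriodic.windowCircle_neg {e : ℝ → ℂ} {lam : ℂ} (he : IsQuasiPeriodic e lam)
    (f : S1 → ℂ) (x : S1) :
    windowCircle e f (-x) = lam * windowCircle (fun x => e (-x)) (fun y => f (-y)) x := by
  refine congrFun (eq_of_lift_eq (F := fun x => windowCircle e f (-x))
    (G := fun x => lam * windowCircle (fun x => e (-x)) (fun y => f (-y)) x) fun x => ?_) x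
  rw [← AddCircle.coe_neg, he.windowCircle_coe, he.reflect.windowCircle_coe, windowOp, windowOp]
  have h1 := intervalIntegral.integral_comp_neg (a := x - 2 * π) (b := x)
    (fun y : ℝ => f (y : S1) / e y)
  have h2 := he.integral_add_period f (-x - 2 * π) (-x)
  rw [sub_add_cancel, show -x + 2 * π = -(x - 2 * π) by ring] at h2
  simp only [AddCircle.coe_neg] at h1
  rw [h1, h2]
  have := he.lam_ne_zero
  field_simp

/-- Reflection turns a backward window into a forward one; moving it back by a period multiplies the
operator by λ, while x ↦ −x preserves all L² norms. -/
theorem HasWindowBounds.of_reflect {e : ℝ → ℂ} {lam : ℂ} {L U : ℝ} (he : IsQuasiPeriodic e lam)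
    (hb : HasWindowBounds (fun x => e (-x)) L U) :
    HasWindowBounds e (‖lam‖ * L) (‖lam‖ * U) := by
  have key : ∀ f : S1 → ℂ, ∫⁻ x, ‖windowCircle e f x‖ₑ ^ 2 =
      ‖lam‖ₑ ^ 2 * ∫⁻ x, ‖windowCircle (fun x => e (-x)) (fun y => f (-y)) x‖ₑ ^ 2 := fun f => by
    rw [← lintegral_neg_eq_self, ← lintegral_const_mul' _ _ (by finiteness)]
    simp only [he.windowCircle_neg, enorm_mul, mul_pow]
  have hneg : ∀ f : S1 → ℂ, ∫⁻ x, ‖f (-x)‖ₑ ^ 2 = ∫⁻ x, ‖f x‖ₑ ^ 2 := fun f =>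
    lintegral_neg_eq_self fun x => ‖f x‖ₑ ^ 2
  have hmul : ∀ t, ENNReal.ofReal (‖lam‖ * t) ^ 2 = ‖lam‖ₑ ^ 2 * ENNReal.ofReal t ^ 2 := fun t => by
    rw [ENNReal.ofReal_mul (norm_nonneg _), ofReal_norm, mul_pow]
  constructor
  · intro f hf
    rw [key, hmul, mul_assoc, ← hneg f]
    gcongr
    exact hb.upper _ (hf.comp measurable_neg)
  · obtain ⟨f, hf, h0, h1, h2⟩ := hb.lower
    refine ⟨fun x => f (-x), hf.comp measurable_neg, by rwa [hneg f], by rwa [hneg f], ?_⟩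
    rw [key, hmul, mul_assoc, hneg f]
    simp only [neg_neg]
    gcongr

theorem HasWindowBounds.norm_bounds {e : ℝ → ℂ} {L U : ℝ} (hb : HasWindowBounds e L U)
    (hU : 0 ≤ U) {R : L2S1 →L[ℂ] L2S1} {c : ℂ}
    (hR : ∀ f : L2S1, R f =ᵐ[volume] fun x => c * windowCircle e f x) :
    ‖c‖ * L ≤ ‖R‖ ∧ ‖R‖ ≤ ‖c‖ * U := by
  have key : ∀ f : L2S1, ‖R f‖ₑ ^ 2 = ‖c‖ₑ ^ 2 * ∫⁻ x, ‖windowCircle e f x‖ₑ ^ 2 := fun f => by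
    rw [enorm_sq_L2, ← lintegral_const_mul' _ _ (by finiteness)]
    apply lintegral_congr_ae
    filter_upwards [hR f] with x hx
    rw [hx, enorm_mul, mul_pow]
  have hmul : ∀ t, ENNReal.ofReal (‖c‖ * t) ^ 2 = ‖c‖ₑ ^ 2 * ENNReal.ofReal t ^ 2 := fun t => by
    rw [ENNReal.ofReal_mul (norm_nonneg _), ofReal_norm, mul_pow]
  constructor
  · rcases le_or_gt L 0 with hL | hL
    · exact (mul_nonpos_of_nonneg_of_nonpos (norm_nonneg _) hL).trans (norm_nonneg _)
    obtain ⟨f, hf, h0, h1, h2⟩ := hb.lower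
    have hm : MemLp f 2 (volume : Measure S1) := by
      refine ⟨hf.aestronglyMeasurable, ?_⟩
      rw [eLpNorm_eq_lintegral_rpow_enorm_toReal two_ne_zero ENNReal.ofNat_ne_top]
      simp only [ENNReal.toReal_ofNat, ENNReal.rpow_two]
      exact ENNReal.rpow_lt_top_of_nonneg (by norm_num) h1
    have hn : ‖hm.toLp f‖ₑ ^ 2 = ∫⁻ x, ‖f x‖ₑ ^ 2 := by
      rw [enorm_sq_L2]
      apply lintegral_congr_ae
      filter_upwards [hm.coeFn_toLp] with x hx
      rw [hx]
    have h3 : (ENNReal.ofReal (‖c‖ * L) * ‖hm.toLp f‖ₑ) ^ 2 ≤ ‖R (hm.toLp f)‖ₑ ^ 2 := by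
      rw [key, windowCircle_congr_ae e hm.coeFn_toLp, mul_pow, hmul, hn, mul_assoc]
      gcongr
    rw [ENNReal.pow_le_pow_left_iff two_ne_zero, ← ofReal_norm, ← ofReal_norm,
      ← ENNReal.ofReal_mul (by positivity), ENNReal.ofReal_le_ofReal_iff (by positivity)] at h3
    have hpos : 0 < ‖hm.toLp f‖ := by
      rw [norm_pos_iff]
      intro h
      rw [h, enorm_zero] at hn
      exact h0 (by rw [← hn]; simp)
    exact le_of_mul_le_mul_right (h3.trans (R.le_opNorm _)) hpos
  · refine R.opNorm_le_bound (by positivity) fun f => norm_le_of_enorm_sq_le (by positivity) ?_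
    rw [key, hmul, mul_assoc, enorm_sq_L2 f]
    gcongr
    exact hb.upper _ (Lp.stronglyMeasurable f).measurable

theorem sqrt_sqrt_mul_sqrt {h A B : ℝ} (hh : 0 < h) (hA : 0 < A) (hB : 0 < B) :
    √(√(π * h / A) * √(π * h / B)) = h * (√π / (√h * (A * B) ^ (1 / 4 : ℝ))) := by
  have e1 : √(π * h / A) * √(π * h / B) = π * h / √(A * B) := by
    rw [← Real.sqrt_mul (by positivity), show π * h / A * (π * h / B) = (π * h) ^ 2 / (A * B) by
      field_simp, Real.sqrt_div (by positivity), Real.sqrt_sq (by positivity)]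
  have e2 : √(√(A * B)) = (A * B) ^ (1 / 4 : ℝ) := by
    rw [Real.sqrt_eq_rpow, Real.sqrt_eq_rpow, ← Real.rpow_mul (by positivity)]; norm_num
  rw [e1, Real.sqrt_div (by positivity), e2, Real.sqrt_mul (by positivity)]
  have h3 : 0 < (A * B) ^ (1 / 4 : ℝ) := by positivity
  have h4 : 0 < √h := Real.sqrt_pos.2 hh
  have h5 : √h * √h = h := Real.mul_self_sqrt hh.le
  field_simp
  rw [pow_two, h5]

/-- The size of `windowCircle e` for `|e| = exp (-F / h)`, `F' = E - w`. -/
theorem SinglePeak.exists_hasWindowBounds {w : ℝ → ℝ} {a b e₀ : ℝ} (hw : SinglePeak w a b)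
    (he₀ : w a < e₀) :
    ∃ c > 0, ∃ C > 0, ∀ h E x y q F e lam, 0 < h → h ≤ √(w b - E) ^ 3 →
      deriv w x < 0 → 0 < deriv w y → x - 2 * π < y → y < x → w x = E → w y = E → e₀ ≤ E →
      (∀ t, HasDerivAt F (E - w t) t) → (∀ t, F (t + 2 * π) = F t + q) → 0 ≤ q →
      IsQuasiPeriodic e lam → (∀ t, ‖e t‖ = Real.exp (-(F t / h))) →
      (c * (w b - E) ≤ -deriv w x * deriv w y ∧ -deriv w x * deriv w y ≤ C * (w b - E)) ∧
      ∀ N, N = √π * Real.exp ((F y - F x) / h) /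
        (√h * (-deriv w x * deriv w y) ^ (1 / 4 : ℝ)) →
      HasWindowBounds e (h * N * (1 - C * (h / √(w b - E) ^ 3)))
        (h * N * (1 + C * (h / √(w b - E) ^ 3))) := by
  obtain ⟨C₁, hC₁, H₁⟩ := hw.exists_windowOp_norm he₀
  obtain ⟨c, hc, C₂, hC₂, H₂⟩ := hw.exists_slope_bounds he₀
  refine ⟨c, hc, max C₁ C₂, lt_max_of_lt_left hC₁, ?_⟩
  intro h E x y q F e lam hh hhs hx hy hxy hyx hwx hwy hE hF hFp hq he hen
  obtain ⟨k, hk₁, hk₂⟩ := hw.exists_shift hx hy hxy hyx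
  have hp := hw.periodic.zsmul k
  have hp' := (periodic_deriv hw.periodic).zsmul k
  have hl : PeakLevel w a b e₀ E (y + k • (2 * π)) (x + k • (2 * π)) F :=
    ⟨hw, hk₂, hk₁, by rw [hp, hwy], by rw [hp, hwx], hE, hF, fun t => by rw [hFp]; linarith⟩
  -- F is not periodic, but its increment between two points moved together is.
  have hFk : F (y + k • (2 * π)) - F (x + k • (2 * π)) = F y - F x := by
    have hper : Function.Periodic (fun t => F (y + t) - F (x + t)) (2 * π) := fun t => by
      dsimp only
      rw [← add_assoc, ← add_assoc, hFp, hFp]; ring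
    simpa using hper.zsmul k 0
  obtain ⟨hs₁, hs₂⟩ := H₂ _ _ _ _ hl
  rw [hp', hp'] at hs₁ hs₂
  have hEb : E < w b := by
    rw [← hl.left_eq]
    exact hw.strictMonoOn ⟨hk₂.1.le, hk₂.2.le⟩ ⟨hw.lt.le, le_rfl⟩ hk₂.2
  refine ⟨⟨hs₁, hs₂.trans ?_⟩, ?_⟩
  · exact mul_le_mul_of_nonneg_right (le_max_right _ _) (by linarith)
  intro N hN
  have hN0 : 0 ≤ N := by
    have : 0 < -deriv w x * deriv w y := mul_pos (by linarith) hy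
    rw [hN]; positivity
  have hs0 : 0 < √(w b - E) := Real.sqrt_pos.2 (by linarith)
  have hNeq : h * N = Real.exp ((F (y + k • (2 * π)) - F (x + k • (2 * π))) / h) *
      √(√(π * h / (-deriv w (x + k • (2 * π)))) * √(π * h / deriv w (y + k • (2 * π)))) := by
    rw [hp', hp', hFk, sqrt_sqrt_mul_sqrt hh (by linarith) hy, hN]; ring
  obtain ⟨hu, f, hf, h0, h1, hlow⟩ := H₁ _ _ _ _ hl _ h (h * N) rfl hh hhs hNeq e he.continuous hen
  constructor
  · intro f hf
    rw [he.lintegral_windowCircle f b]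
    refine (hu f hf).trans ?_
    gcongr
    exact le_max_left _ _
  · refine ⟨f, hf, h0, h1, ?_⟩
    rw [he.lintegral_windowCircle f b]
    refine le_trans ?_ hlow
    gcongr
    exact le_max_left _ _

/-! ### Resolvent bounds on both sides of the mean -/

theorem rpow_three_halves {d : ℝ} (hd : 0 ≤ d) : d ^ (3 / 2 : ℝ) = √d ^ 3 := by
  rw [Real.sqrt_eq_rpow, ← Real.rpow_natCast, ← Real.rpow_mul hd]; norm_num

theorem exp_phi_of_le {g : S1 → ℂ} {h : ℝ} {z : ℂ} (hz : z.im ≤ (mean g).im) :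
    Complex.exp (phi g h z) = (multiplier g h z)⁻¹ := by
  rw [phi, if_pos hz, multiplier, ← Complex.exp_neg, neg_mul]

theorem exp_phi_of_lt {g : S1 → ℂ} {h : ℝ} {z : ℂ} (hz : (mean g).im < z.im) :
    Complex.exp (phi g h z) = multiplier g h z := by
  rw [phi, if_neg (not_le.2 hz), multiplier]

theorem exp_phi_eq_one_iff {g : S1 → ℂ} {h : ℝ} {z : ℂ} :
    Complex.exp (phi g h z) = 1 ↔ multiplier g h z = 1 := by
  rcases le_or_gt z.im (mean g).im with hz | hz
  · rw [exp_phi_of_le hz, inv_eq_one]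
  · rw [exp_phi_of_lt hz]

theorem phi_re {g : S1 → ℂ} {h : ℝ} {z : ℂ} :
    (phi g h z).re = -(2 * π / h) * |z.im - (mean g).im| := by
  have e : (2 * π * Complex.I / h * (z - mean g)).re = -(2 * π / h) * (z.im - (mean g).im) := by
    rw [show 2 * π * Complex.I / h * (z - mean g) =
      ((2 * π / h : ℝ) : ℂ) * (Complex.I * (z - mean g)) by push_cast; ring, Complex.re_ofReal_mul,
      Complex.I_mul_re, Complex.sub_im]
    ring
  rw [phi]
  split_ifs with hz
  · rw [neg_mul, Complex.neg_re, e, abs_of_nonpos (by linarith)]; ring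
  · rw [e, abs_of_pos (by linarith)]

theorem norm_exp_phi {g : S1 → ℂ} {h : ℝ} {z : ℂ} :
    ‖Complex.exp (phi g h z)‖ = Real.exp (-(2 * π / h) * |z.im - (mean g).im|) := by
  rw [Complex.norm_exp, phi_re]

theorem abs_norm_one_sub_exp_phi_sub_one_le {g : S1 → ℂ} {h : ℝ} {z : ℂ} :
    |‖1 - Complex.exp (phi g h z)‖ - 1| ≤
      Real.exp (-(2 * π / h) * |z.im - (mean g).im|) := by
  rw [← norm_exp_phi]
  have := abs_norm_sub_norm_le (1 - Complex.exp (phi g h z)) 1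
  simpa using this

/-- Comparison of the squared scale `r` of a level with the distance `d` to the boundary. -/
theorem scale_bounds {h d r A B C C' : ℝ} (hh : 0 < h) (hd : 0 < d) (hdr : d ≤ r)
    (hA : 0 ≤ A) (hC : 0 ≤ C) (hCC : C ≤ C') (hB : A * (1 - C * (h / √r ^ 3)) ≤ B)
    (hB' : B ≤ A * (1 + C * (h / √r ^ 3))) :
    A * (1 - C' * (h / d ^ (3 / 2 : ℝ))) ≤ B ∧ B ≤ A * (1 + C' * (h / d ^ (3 / 2 : ℝ))) := by
  have hs : 0 < √d := Real.sqrt_pos.2 hd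
  have h1 : h / √r ^ 3 ≤ h / √d ^ 3 := by gcongr
  have h2 : C * (h / √r ^ 3) ≤ C' * (h / √d ^ 3) :=
    mul_le_mul hCC h1 (by positivity) (hC.trans hCC)
  rw [rpow_three_halves hd.le]
  exact ⟨le_trans (by gcongr) hB, hB'.trans (by gcongr)⟩

namespace IsHagerPotential

variable {g : S1 → ℂ} {a b : ℝ}

/-- Above the mean, the distance to the lower edge of Σ is at least ⟨Im g⟩ − min Im g = κ(max − min)
≥ κ(max − Im z). With d ≤ max − Im z this makes d and s² comparable. -/
theorem exists_scale_upper (hg : IsHagerPotential g a b) : ∃ κ > 0, ∀ z : ℂ,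
    imLift g a ≤ z.im → z.im ≤ imLift g b →
    (mean g).im ≤ z.im → κ * (imLift g b - z.im) ≤ dBdry g z := by
  obtain ⟨m1, m2⟩ := hg.mean_mem
  have hlt := hg.im_lt
  set κ := ((mean g).im - imLift g a) / (imLift g b - imLift g a) with hκ
  have hκ0 : 0 < κ := div_pos (by linarith) (by linarith)
  have hκ1 : κ ≤ 1 := (div_le_one (by linarith)).2 (by linarith)
  have hκ2 : κ * (imLift g b - imLift g a) = (mean g).im - imLift g a :=
    div_mul_cancel₀ _ (by linarith)
  refine ⟨κ, hκ0, fun z h1 h2 h3 => hg.le_dBdry ?_ ?_⟩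
  · rw [abs_of_nonneg (by linarith)]
    nlinarith
  · rw [abs_of_nonpos (by linarith)]
    nlinarith

theorem exists_scale_lower (hg : IsHagerPotential g a b) : ∃ κ > 0, ∀ z : ℂ,
    imLift g a ≤ z.im → z.im ≤ imLift g b →
    z.im ≤ (mean g).im → κ * (z.im - imLift g a) ≤ dBdry g z := by
  obtain ⟨m1, m2⟩ := hg.mean_mem
  have hlt := hg.im_lt
  set κ := (imLift g b - (mean g).im) / (imLift g b - imLift g a) with hκ
  have hκ0 : 0 < κ := div_pos (by linarith) (by linarith)
  have hκ1 : κ ≤ 1 := (div_le_one (by linarith)).2 (by linarith)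
  have hκ2 : κ * (imLift g b - imLift g a) = imLift g b - (mean g).im :=
    div_mul_cancel₀ _ (by linarith)
  refine ⟨κ, hκ0, fun z h1 h2 h3 => hg.le_dBdry ?_ ?_⟩
  · rw [abs_of_nonneg (by linarith)]
    nlinarith
  · rw [abs_of_nonpos (by linarith)]
    nlinarith

/-- The resolvent estimate for levels above the mean. -/
theorem exists_resolvent_bounds_of_lt (hg : IsHagerPotential g a b) :
    ∃ c > 0, ∃ C > 0, ∀ (h : ℝ) (z : ℂ) (xp xm : ℝ), 0 < h → 0 < dBdry g z →
      h ≤ dBdry g z ^ (3 / 2 : ℝ) → IsTurningPair g z xp xm → (mean g).im < z.im →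
      (c * dBdry g z ≤ bracketProduct g z xp xm ∧ bracketProduct g z xp xm ≤ C * dBdry g z) ∧
      (multiplier g h z ≠ 1 → ∃ R, IsResolventAt (hagerOperator g h) z R ∧
        ∀ A, A = √π * Real.exp (action g z xp xm / h) /
          (√h * bracketProduct g z xp xm ^ (1 / 4 : ℝ)) * ‖1 - Complex.exp (phi g h z)‖⁻¹ →
        A * (1 - C * (h / dBdry g z ^ (3 / 2 : ℝ))) ≤ ‖R‖ ∧
          ‖R‖ ≤ A * (1 + C * (h / dBdry g z ^ (3 / 2 : ℝ)))) := by
  have hw := hg.singlePeak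
  obtain ⟨κ, hκ, Hκ⟩ := hg.exists_scale_upper
  obtain ⟨c, hc, C, hC, H⟩ := hw.exists_hasWindowBounds hg.mean_mem.1
  refine ⟨c, hc, max C (C / κ), lt_max_of_lt_left hC, ?_⟩
  intro h z xp xm hh hd hhd ht hz
  set d := dBdry g z with hdd
  have hzm : z.im ∈ Set.Icc (imLift g a) (imLift g b) := ht.im_plus ▸ hw.mem_Icc xp
  have hdr : d ≤ imLift g b - z.im := by
    have := hg.dBdry_le (z := z) (Or.inr rfl : imLift g b ∈ ({imLift g a, imLift g b} : Set ℝ))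
    rwa [abs_of_nonpos (by linarith [hzm.2]), neg_sub] at this
  have hrd := Hκ z hzm.1 hzm.2 hz.le
  rw [← hdd] at hrd
  have hqp := isQuasiPeriodic_wave (h := h) (z := z) hg.smooth
  have hp' := periodic_deriv hw.periodic
  have hhs : h ≤ √(imLift g b - z.im) ^ 3 := by
    rw [rpow_three_halves hd.le] at hhd
    exact hhd.trans (by gcongr)
  -- Above the mean the action uses the representative x₋ − 2π, which precedes x₊ by less than a
  -- period, as the maximum of F must.
  obtain ⟨⟨s1, s2⟩, hN⟩ := H h z.im xp (xm - 2 * π) (2 * π * (z.im - (mean g).im))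
    (fun t => (phase g z t).im) (wave g h z) _ hh hhs ht.deriv_plus
    (by rw [hp'.sub_eq]; exact ht.deriv_minus) (by linarith [ht.plus_lt]) ht.lt_plus ht.im_plus
    (by rw [hw.periodic.sub_eq, ht.im_minus]) hz.le (fun t => hasDerivAt_phase_im hg.smooth t)
    (fun t => phase_im_add_period hg.smooth t)
    (mul_nonneg Real.two_pi_pos.le (by linarith)) hqp norm_wave
  rw [hp'.sub_eq, ← bracketProduct_eq hg.smooth (z := z)] at s1 s2 hN
  rw [← action_of_ge hg.smooth hz.le] at hN
  set bp := bracketProduct g z xp xm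
  have hbp : c * d ≤ bp := le_trans (by gcongr) s1
  refine ⟨⟨hbp, s2.trans ?_⟩, fun hlam => ?_⟩
  · calc C * (imLift g b - z.im) = C / κ * (κ * (imLift g b - z.im)) := by field_simp
      _ ≤ C / κ * d := by gcongr
      _ ≤ _ := by gcongr; exact le_max_right _ _
  obtain ⟨R, hR, hRf⟩ := exists_resolvent hg.smooth hh hlam
  refine ⟨R, hR, fun A hA => ?_⟩
  have hbp0 : 0 ≤ bp := le_trans (by positivity) hbp
  set N := √π * Real.exp (action g z xp xm / h) / (√h * bp ^ (1 / 4 : ℝ)) with hNd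
  have hN0 : 0 ≤ N := by positivity
  have hr0 : 0 < √(imLift g b - z.im) := Real.sqrt_pos.2 (hd.trans_le hdr)
  obtain ⟨n1, n2⟩ := (hN N rfl).norm_bounds (by positivity) hRf
  have hcn : ‖Complex.I / h * (1 - multiplier g h z)⁻¹‖ * (h * N) = A := by
    rw [hA, exp_phi_of_lt hz, norm_mul, norm_div, Complex.norm_I, Complex.norm_real,
      Real.norm_of_nonneg hh.le, norm_inv]
    field_simp
  rw [← mul_assoc, hcn] at n1 n2
  exact scale_bounds hh hd hdr (by rw [hA]; positivity) hC.le (le_max_left _ _) n1 n2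

/-- The resolvent estimate for levels below the mean. -/
theorem exists_resolvent_bounds_of_le (hg : IsHagerPotential g a b) :
    ∃ c > 0, ∃ C > 0, ∀ (h : ℝ) (z : ℂ) (xp xm : ℝ), 0 < h → 0 < dBdry g z →
      h ≤ dBdry g z ^ (3 / 2 : ℝ) → IsTurningPair g z xp xm → z.im ≤ (mean g).im →
      (c * dBdry g z ≤ bracketProduct g z xp xm ∧ bracketProduct g z xp xm ≤ C * dBdry g z) ∧
      (multiplier g h z ≠ 1 → ∃ R, IsResolventAt (hagerOperator g h) z R ∧
        ∀ A, A = √π * Real.exp (action g z xp xm / h) /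
          (√h * bracketProduct g z xp xm ^ (1 / 4 : ℝ)) * ‖1 - Complex.exp (phi g h z)‖⁻¹ →
        A * (1 - C * (h / dBdry g z ^ (3 / 2 : ℝ))) ≤ ‖R‖ ∧
          ‖R‖ ≤ A * (1 + C * (h / dBdry g z ^ (3 / 2 : ℝ)))) := by
  have hw := hg.singlePeak
  obtain ⟨κ, hκ, Hκ⟩ := hg.exists_scale_lower
  obtain ⟨c, hc, C, hC, H⟩ := hg.singlePeak_neg.exists_hasWindowBounds (e₀ := -(mean g).im)
    (by simpa using hg.mean_mem.2)
  refine ⟨c, hc, max C (C / κ), lt_max_of_lt_left hC, ?_⟩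
  intro h z xp xm hh hd hhd ht hz
  set d := dBdry g z with hdd
  have hzm : z.im ∈ Set.Icc (imLift g a) (imLift g b) := ht.im_plus ▸ hw.mem_Icc xp
  have hdr : d ≤ z.im - imLift g a := by
    have := hg.dBdry_le (z := z) (Or.inl rfl : imLift g a ∈ ({imLift g a, imLift g b} : Set ℝ))
    rwa [abs_of_nonneg (by linarith [hzm.1])] at this
  have hrd := Hκ z hzm.1 hzm.2 hz
  rw [← hdd] at hrd
  have hqp := isQuasiPeriodic_wave (h := h) (z := z) hg.smooth
  have hd' : ∀ x, deriv (fun x => -imLift g (-x)) (-x) = deriv (imLift g) x := fun x => by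
    rw [deriv.fun_neg, deriv_comp_neg, neg_neg, neg_neg]
  have hr : -imLift g (- -a) - -z.im = z.im - imLift g a := by rw [neg_neg]; ring
  have hhs : h ≤ √(z.im - imLift g a) ^ 3 := by
    rw [rpow_three_halves hd.le] at hhd
    exact hhd.trans (by gcongr)
  have hFd : ∀ t, HasDerivAt (fun t => (phase g z (-t)).im) (-z.im - -imLift g (-t)) t := fun t =>
    ((hasDerivAt_phase_im hg.smooth (-t)).comp t (hasDerivAt_neg t)).congr_deriv (by ring)
  have hFp : ∀ t, (phase g z (-(t + 2 * π))).im =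
      (phase g z (-t)).im + 2 * π * ((mean g).im - z.im) := fun t => by
    have := phase_im_add_period (z := z) hg.smooth (-(t + 2 * π))
    rw [show -(t + 2 * π) + 2 * π = -t by ring] at this
    rw [this]; ring
  -- After reflection −x₋ precedes −x₊ by less than a period, so no translation is needed; this
  -- matches the first integral in the action.
  obtain ⟨⟨s1, s2⟩, hN⟩ := H h (-z.im) (-xp) (-xm) (2 * π * ((mean g).im - z.im))
    (fun t => (phase g z (-t)).im) (fun t => wave g h z (-t)) _ hh (by rw [hr]; exact hhs)
    (by rw [hd']; exact ht.deriv_plus) (by rw [hd']; exact ht.deriv_minus)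
    (by linarith [ht.lt_plus]) (by linarith [ht.plus_lt])
    (by rw [neg_neg, ht.im_plus]) (by rw [neg_neg, ht.im_minus]) (by linarith) hFd hFp
    (mul_nonneg Real.two_pi_pos.le (by linarith)) hqp.reflect (fun t => norm_wave _)
  rw [hr, hd', hd', ← bracketProduct_eq hg.smooth (z := z)] at s1 s2 hN
  simp only [neg_neg] at hN
  rw [← action_of_le hg.smooth hz] at hN
  set bp := bracketProduct g z xp xm
  have hbp : c * d ≤ bp := le_trans (by gcongr) s1
  refine ⟨⟨hbp, s2.trans ?_⟩, fun hlam => ?_⟩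
  · calc C * (z.im - imLift g a) = C / κ * (κ * (z.im - imLift g a)) := by field_simp
      _ ≤ C / κ * d := by gcongr
      _ ≤ _ := by gcongr; exact le_max_right _ _
  obtain ⟨R, hR, hRf⟩ := exists_resolvent hg.smooth hh hlam
  refine ⟨R, hR, fun A hA => ?_⟩
  have hbp0 : 0 ≤ bp := le_trans (by positivity) hbp
  set N := √π * Real.exp (action g z xp xm / h) / (√h * bp ^ (1 / 4 : ℝ)) with hNd
  have hN0 : 0 ≤ N := by positivity
  have hr0 : 0 < √(z.im - imLift g a) := Real.sqrt_pos.2 (hd.trans_le hdr)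
  obtain ⟨n1, n2⟩ := ((hN N rfl).of_reflect hqp).norm_bounds (by positivity) hRf
  -- The factor ‖λ‖ produced by the reflection combines with |1 − λ|⁻¹ to |1 − λ⁻¹|⁻¹, and λ⁻¹ = e^Φ
  -- below the mean.
  have hcn : ‖Complex.I / h * (1 - multiplier g h z)⁻¹‖ * (‖multiplier g h z‖ * (h * N)) = A := by
    have h1 : ‖1 - (multiplier g h z)⁻¹‖ = ‖1 - multiplier g h z‖ / ‖multiplier g h z‖ := by
      rw [← norm_neg, ← norm_div, sub_div, div_self hqp.lam_ne_zero, neg_sub, one_div]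
    have h2 : ‖multiplier g h z‖ ≠ 0 := norm_ne_zero_iff.2 hqp.lam_ne_zero
    rw [hA, exp_phi_of_le hz, h1, norm_mul, norm_div, Complex.norm_I, Complex.norm_real,
      Real.norm_of_nonneg hh.le, norm_inv]
    field_simp
  rw [← mul_assoc ‖multiplier g h z‖, ← mul_assoc, hcn] at n1 n2
  exact scale_bounds hh hd hdr (by rw [hA]; positivity) hC.le (le_max_left _ _) n1 n2

theorem exists_resolvent_bounds (hg : IsHagerPotential g a b) :
    ∃ c > 0, ∃ C > 0, ∀ (h : ℝ) (z : ℂ) (xp xm : ℝ), 0 < h → 0 < dBdry g z →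
      h ≤ dBdry g z ^ (3 / 2 : ℝ) → IsTurningPair g z xp xm →
      (c * dBdry g z ≤ bracketProduct g z xp xm ∧ bracketProduct g z xp xm ≤ C * dBdry g z) ∧
      (multiplier g h z ≠ 1 → ∃ R, IsResolventAt (hagerOperator g h) z R ∧
        ∀ A, A = √π * Real.exp (action g z xp xm / h) /
          (√h * bracketProduct g z xp xm ^ (1 / 4 : ℝ)) * ‖1 - Complex.exp (phi g h z)‖⁻¹ →
        A * (1 - C * (h / dBdry g z ^ (3 / 2 : ℝ))) ≤ ‖R‖ ∧
          ‖R‖ ≤ A * (1 + C * (h / dBdry g z ^ (3 / 2 : ℝ)))) := by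
  obtain ⟨c₁, hc₁, C₁, hC₁, H₁⟩ := hg.exists_resolvent_bounds_of_lt
  obtain ⟨c₂, hc₂, C₂, hC₂, H₂⟩ := hg.exists_resolvent_bounds_of_le
  have weaken : ∀ {h d bp c C : ℝ} {P : Prop} {Q : (L2S1 →L[ℂ] L2S1) → Prop} {T : ℝ → Prop},
      0 < h → 0 < d → min c₁ c₂ ≤ c → C ≤ max C₁ C₂ → (∀ A, T A → 0 ≤ A) →
      ((c * d ≤ bp ∧ bp ≤ C * d) ∧ (P → ∃ R, Q R ∧ ∀ A, T A →
        A * (1 - C * (h / d ^ (3 / 2 : ℝ))) ≤ ‖R‖ ∧ ‖R‖ ≤ A * (1 + C * (h / d ^ (3 / 2 : ℝ))))) →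
      ((min c₁ c₂ * d ≤ bp ∧ bp ≤ max C₁ C₂ * d) ∧ (P → ∃ R, Q R ∧ ∀ A, T A →
        A * (1 - max C₁ C₂ * (h / d ^ (3 / 2 : ℝ))) ≤ ‖R‖ ∧
          ‖R‖ ≤ A * (1 + max C₁ C₂ * (h / d ^ (3 / 2 : ℝ))))) := by
    intro h d bp c C P Q T hh hd hc hC hA ⟨⟨b1, b2⟩, b3⟩
    refine ⟨⟨le_trans (by gcongr) b1, b2.trans (by gcongr)⟩, fun hP => ?_⟩
    obtain ⟨R, hQ, hR⟩ := b3 hP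
    refine ⟨R, hQ, fun A hTA => ?_⟩
    obtain ⟨r1, r2⟩ := hR A hTA
    have := hA A hTA
    exact ⟨le_trans (by gcongr) r1, r2.trans (by gcongr)⟩
  refine ⟨min c₁ c₂, lt_min hc₁ hc₂, max C₁ C₂, lt_max_of_lt_left hC₁, ?_⟩
  intro h z xp xm hh hd hhd ht
  rcases lt_or_ge (mean g).im z.im with hz | hz
  · have key := H₁ h z xp xm hh hd hhd ht hz
    have hbp : 0 ≤ bracketProduct g z xp xm := le_trans (by positivity) key.1.1
    exact weaken hh hd (min_le_left _ _) (le_max_left _ _)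
      (fun A hA => by rw [hA]; positivity) key
  · have key := H₂ h z xp xm hh hd hhd ht hz
    have hbp : 0 ≤ bracketProduct g z xp xm := le_trans (by positivity) key.1.1
    exact weaken hh hd (min_le_right _ _) (le_max_right _ _)
      (fun A hA => by rw [hA]; positivity) key

end IsHagerPotential

/-! ### The spectrum and the leading term -/

variable {g : S1 → ℂ} {a b h : ℝ} {z : ℂ}

theorem norm_one_sub_exp_phi_eq_zero_iff (hg : IsSmooth g) (hh : 0 < h) :
    ‖1 - Complex.exp (phi g h z)‖ = 0 ↔ z ∈ spec (hagerOperator g h) := by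
  rw [norm_eq_zero, sub_eq_zero, eq_comm, exp_phi_eq_one_iff]
  refine ⟨mem_spec_of_multiplier_eq_one hg hh, fun hz => ?_⟩
  by_contra hne
  obtain ⟨R, hR, -⟩ := exists_resolvent hg hh hne
  exact hz ⟨R, hR⟩

theorem leadingTerm_of_ne (hphi : Complex.exp (phi g h z) ≠ 1) {xp xm : ℝ}
    (hbp : 0 ≤ bracketProduct g z xp xm) :
    leadingTerm g h z xp xm = ENNReal.ofReal (√π * Real.exp (action g z xp xm / h) /
      (√h * bracketProduct g z xp xm ^ (1 / 4 : ℝ)) * ‖1 - Complex.exp (phi g h z)‖⁻¹) := by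
  have hq : 0 < ‖1 - Complex.exp (phi g h z)‖ := norm_pos_iff.2 (sub_ne_zero.2 hphi.symm)
  rw [leadingTerm, ENNReal.ofReal_mul (by positivity), ENNReal.ofReal_inv_of_pos hq, ofReal_norm]

theorem leadingTerm_of_eq (hphi : Complex.exp (phi g h z) = 1) (hh : 0 < h) {xp xm : ℝ}
    (hbp : 0 < bracketProduct g z xp xm) : leadingTerm g h z xp xm = ⊤ := by
  rw [leadingTerm, hphi, sub_self, enorm_zero, ENNReal.inv_zero]
  exact ENNReal.mul_top (ne_of_gt (ENNReal.ofReal_pos.2 (by positivity)))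

/-- The norm of the resolvent is given by `leadingTerm` up to a small relative error. -/
theorem IsHagerPotential.exists_resolventNorm_eq (hg : IsHagerPotential g a b) :
    ∃ c > 0, ∃ C > 0, ∀ (h : ℝ) (z : ℂ) (xp xm : ℝ), 0 < h → 0 < dBdry g z →
      h ≤ dBdry g z ^ (3 / 2 : ℝ) → IsTurningPair g z xp xm →
      (c * dBdry g z ≤ bracketProduct g z xp xm ∧ bracketProduct g z xp xm ≤ C * dBdry g z) ∧
      ∃ ε : ℝ, |ε| ≤ C * h / dBdry g z ^ (3 / 2 : ℝ) ∧
        resolventNorm (hagerOperator g h) z =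
          leadingTerm g h z xp xm * ENNReal.ofReal (1 + ε) := by
  obtain ⟨c, hc, C, hC, H⟩ := hg.exists_resolvent_bounds
  refine ⟨c, hc, C, hC, fun h z xp xm hh hd hhd ht => ?_⟩
  obtain ⟨hb, hR⟩ := H h z xp xm hh hd hhd ht
  have hbp : 0 < bracketProduct g z xp xm := lt_of_lt_of_le (by positivity) hb.1
  refine ⟨hb, ?_⟩
  by_cases hlam : multiplier g h z = 1
  -- At spectral points both sides are infinite, so any small ε serves.
  · refine ⟨0, by rw [abs_zero]; positivity, ?_⟩
    rw [resolventNorm_of_mem_spec (mem_spec_of_multiplier_eq_one hg.smooth hh hlam),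
      leadingTerm_of_eq (exp_phi_eq_one_iff.2 hlam) hh hbp]
    simp
  · have hphi : Complex.exp (phi g h z) ≠ 1 := fun h => hlam (exp_phi_eq_one_iff.1 h)
    have hq : 0 < ‖1 - Complex.exp (phi g h z)‖ := norm_pos_iff.2 (sub_ne_zero.2 hphi.symm)
    obtain ⟨R, hR, hA⟩ := hR hlam
    obtain ⟨r1, r2⟩ := hA _ rfl
    rw [leadingTerm_of_ne hphi hbp.le, resolventNorm_eq hR]
    set A := √π * Real.exp (action g z xp xm / h) /
      (√h * bracketProduct g z xp xm ^ (1 / 4 : ℝ)) * ‖1 - Complex.exp (phi g h z)‖⁻¹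
    have hA0 : 0 < A := by positivity
    refine ⟨‖R‖ / A - 1, ?_, ?_⟩
    · rw [mul_div_assoc, abs_le]
      constructor
      · have := (le_div_iff₀' hA0).2 r1
        linarith
      · have := (div_le_iff₀' hA0).2 r2
        linarith
    · rw [add_sub_cancel, ← ENNReal.ofReal_mul hA0.le, mul_div_cancel₀ _ hA0.ne', ofReal_norm]

theorem mul_le_rpow_three_halves {M d : ℝ} (hM : 0 ≤ M) (hh : 0 ≤ h)
    (hd : M ^ (2 / 3 : ℝ) * h ^ (2 / 3 : ℝ) ≤ d) : M * h ≤ d ^ (3 / 2 : ℝ) := by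
  rw [← Real.mul_rpow hM hh] at hd
  have := Real.rpow_le_rpow (by positivity) hd (by norm_num : (0 : ℝ) ≤ 3 / 2)
  rw [← Real.rpow_mul (by positivity)] at this
  norm_num at this
  exact this

/-- Away from the mean level, the leading term is comparable to `e^{S/h} h^{-1/2} d^{-1/4}`. -/
theorem leadingTerm_comparable {c C δ : ℝ} (hc : 0 < c) (hC : 0 < C) (hδ : 0 < δ) :
    ∃ K ≥ 1, ∀ (g : S1 → ℂ) (h : ℝ) (z : ℂ) (xp xm d ε : ℝ), 0 < h → h ≤ 1 → 0 < d →
      c * d ≤ bracketProduct g z xp xm → bracketProduct g z xp xm ≤ C * d →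
      δ < |z.im - (mean g).im| → |ε| ≤ 1 / 2 →
      ENNReal.ofReal (K⁻¹ * (Real.exp (action g z xp xm / h) / (√h * d ^ (1 / 4 : ℝ)))) ≤
          leadingTerm g h z xp xm * ENNReal.ofReal (1 + ε) ∧
        leadingTerm g h z xp xm * ENNReal.ofReal (1 + ε) ≤
          ENNReal.ofReal (K * (Real.exp (action g z xp xm / h) / (√h * d ^ (1 / 4 : ℝ)))) := by
  -- Since h ≤ 1, |e^Φ| ≤ η < 1, whence 1 − η ≤ |1 − e^Φ| ≤ 2. These bounds, with 1/2 ≤ 1 + ε ≤ 3/2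
  -- and the bracket product comparable to d, give `k₁` and `k₂`.
  set η := Real.exp (-(2 * π * δ)) with hη
  have hη1 : η < 1 := by
    rw [hη, Real.exp_lt_one_iff, neg_lt_zero]
    have := Real.two_pi_pos
    positivity
  have hη0 : 0 < 1 - η := by linarith
  set k₁ := √π / C ^ (1 / 4 : ℝ) * 2⁻¹ * (1 / 2) with hk₁
  set k₂ := √π / c ^ (1 / 4 : ℝ) * (1 - η)⁻¹ * (3 / 2) with hk₂
  have hk₁0 : 0 < k₁ := by positivity
  have hk₂0 : 0 < k₂ := by positivity
  refine ⟨max 1 (max k₁⁻¹ k₂), le_max_left _ _, ?_⟩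
  intro g h z xp xm d ε hh hh1 hd hb1 hb2 hz hε
  have hbp : 0 < bracketProduct g z xp xm := lt_of_lt_of_le (by positivity) hb1
  have hexp : Real.exp (-(2 * π / h) * |z.im - (mean g).im|) ≤ η := by
    rw [hη]
    apply Real.exp_le_exp.2
    rw [neg_mul, neg_le_neg_iff, div_mul_eq_mul_div, le_div_iff₀ hh]
    have := Real.two_pi_pos
    calc 2 * π * δ * h ≤ 2 * π * δ * 1 := by gcongr
      _ ≤ 2 * π * |z.im - (mean g).im| := by rw [mul_one]; gcongr
  have hq := abs_le.1 (abs_norm_one_sub_exp_phi_sub_one_le.trans hexp : |‖1 -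
    Complex.exp (phi g h z)‖ - 1| ≤ η)
  set q := ‖1 - Complex.exp (phi g h z)‖ with hqd
  have hq1 : 1 - η ≤ q := by linarith [hq.1]
  have hq2 : q ≤ 2 := by linarith [hq.2]
  have hq0 : 0 < q := hη0.trans_le hq1
  have hphi : Complex.exp (phi g h z) ≠ 1 := fun h1 => by
    rw [hqd, h1, sub_self, norm_zero] at hq0
    exact lt_irrefl _ hq0
  obtain ⟨e1, e2⟩ := abs_le.1 hε
  rw [leadingTerm_of_ne hphi hbp.le, ← ENNReal.ofReal_mul (by positivity), ← hqd]
  set bp := bracketProduct g z xp xm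
  set X := Real.exp (action g z xp xm / h) with hX
  have hX0 : 0 < X := Real.exp_pos _
  have hsh : 0 < √h := Real.sqrt_pos.2 hh
  have b1 : c ^ (1 / 4 : ℝ) * d ^ (1 / 4 : ℝ) ≤ bp ^ (1 / 4 : ℝ) := by
    rw [← Real.mul_rpow hc.le hd.le]; gcongr
  have b2 : bp ^ (1 / 4 : ℝ) ≤ C ^ (1 / 4 : ℝ) * d ^ (1 / 4 : ℝ) := by
    rw [← Real.mul_rpow hC.le hd.le]; gcongr
  have hK1 : (max 1 (max k₁⁻¹ k₂))⁻¹ ≤ k₁ := by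
    rw [inv_le_comm₀ (by positivity) hk₁0]
    exact (le_max_left _ _).trans (le_max_right _ _)
  have hK2 : k₂ ≤ max 1 (max k₁⁻¹ k₂) := (le_max_right _ _).trans (le_max_right _ _)
  constructor <;> apply ENNReal.ofReal_le_ofReal
  · calc _ ≤ k₁ * (X / (√h * d ^ (1 / 4 : ℝ))) := by gcongr
      _ = √π * X / (√h * (C ^ (1 / 4 : ℝ) * d ^ (1 / 4 : ℝ))) * 2⁻¹ * (1 / 2) := by
          rw [hk₁]; field_simp
      _ ≤ √π * X / (√h * bp ^ (1 / 4 : ℝ)) * q⁻¹ * (1 + ε) := by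
          gcongr
          linarith
  · calc _ ≤ √π * X / (√h * (c ^ (1 / 4 : ℝ) * d ^ (1 / 4 : ℝ))) * (1 - η)⁻¹ * (3 / 2) := by
          gcongr <;> linarith
      _ = k₂ * (X / (√h * d ^ (1 / 4 : ℝ))) := by rw [hk₂]; field_simp
      _ ≤ _ := by gcongr

end Hager

/-! ### Assembly -/

theorem mainTheorem6 (g : Hager.S1 → ℂ) (a b : ℝ) (hg : Hager.IsHagerPotential g a b) :
    -- the points `x_±(z)` exist
    (∀ z ∈ interior (Hager.sigma g), ∃ xp xm : ℝ, Hager.IsTurningPair g z xp xm) ∧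
    -- uniformly for `d(z) ≫ h^{2/3}`
    (∃ C₀ > 0, ∃ h₀ > 0,
      (∃ C > 0, ∀ (h : ℝ) (z : ℂ) (xp xm : ℝ), 0 < h → h ≤ h₀ → z ∈ Hager.sigma g →
        C₀ * h ^ (2 / 3 : ℝ) ≤ Hager.dBdry g z → Hager.IsTurningPair g z xp xm →
        ∃ ε : ℝ, |ε| ≤ C * h / Hager.dBdry g z ^ (3 / 2 : ℝ) ∧
          Hager.resolventNorm (Hager.hagerOperator g h) z =
            Hager.leadingTerm g h z xp xm * ENNReal.ofReal (1 + ε)) ∧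
      (∀ c > 0, ∃ K ≥ 1, ∀ (h : ℝ) (z : ℂ) (xp xm : ℝ), 0 < h → h ≤ h₀ → z ∈ Hager.sigma g →
        C₀ * h ^ (2 / 3 : ℝ) ≤ Hager.dBdry g z → Hager.IsTurningPair g z xp xm →
        c < |z.im - (Hager.mean g).im| →
        ENNReal.ofReal (K⁻¹ * (Real.exp (Hager.action g z xp xm / h) /
            (√h * Hager.dBdry g z ^ (1 / 4 : ℝ)))) ≤
          Hager.resolventNorm (Hager.hagerOperator g h) z ∧
        Hager.resolventNorm (Hager.hagerOperator g h) z ≤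
          ENNReal.ofReal (K * (Real.exp (Hager.action g z xp xm / h) /
            (√h * Hager.dBdry g z ^ (1 / 4 : ℝ)))))) ∧
    -- at a fixed distance from the boundary the relative error is `O(h)`
    (∀ c > 0, ∃ h₁ > 0, ∃ C > 0, ∀ (h : ℝ) (z : ℂ) (xp xm : ℝ), 0 < h → h ≤ h₁ →
      z ∈ Hager.sigma g → c ≤ Hager.dBdry g z → Hager.IsTurningPair g z xp xm →
      ∃ ε : ℝ, |ε| ≤ C * h ∧
        Hager.resolventNorm (Hager.hagerOperator g h) z =
          Hager.leadingTerm g h z xp xm * ENNReal.ofReal (1 + ε)) ∧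
    -- properties of `Φ`
    (∀ (h : ℝ) (z : ℂ), 0 < h → (Hager.phi g h z).re ≤ 0 ∧
      (‖1 - Complex.exp (Hager.phi g h z)‖ = 0 ↔ z ∈ Hager.spec (Hager.hagerOperator g h))) ∧
    (∃ C > 0, ∀ (h : ℝ) (z : ℂ), 0 < h →
      |‖1 - Complex.exp (Hager.phi g h z)‖ - 1| ≤
        C * Real.exp (-(2 * π / h) * |z.im - (Hager.mean g).im|)) := by

  obtain ⟨c₁, hc₁, C, hC, H⟩ := hg.exists_resolventNorm_eq
  -- With C₀ = M^{2/3} the hypothesis reads Mh ≤ d^{3/2}. The entry 1 gives h ≤ d^{3/2}, needed for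
  -- the estimates to apply; the entry 2C makes the relative error at most 1/2.
  set M := max 1 (2 * C) with hM
  have hM0 : 0 < M := by positivity
  have dist_pos : ∀ {h : ℝ} {z : ℂ}, 0 < h → M ^ (2 / 3 : ℝ) * h ^ (2 / 3 : ℝ) ≤ Hager.dBdry g z →
      0 < Hager.dBdry g z := fun hh hd => lt_of_lt_of_le (by positivity) hd
  have le_dist : ∀ {h : ℝ} {z : ℂ}, 0 < h → M ^ (2 / 3 : ℝ) * h ^ (2 / 3 : ℝ) ≤ Hager.dBdry g z →
      h ≤ Hager.dBdry g z ^ (3 / 2 : ℝ) ∧ C * h / Hager.dBdry g z ^ (3 / 2 : ℝ) ≤ 1 / 2 := by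
    intro h z hh hd
    have h1 := Hager.mul_le_rpow_three_halves hM0.le hh.le hd
    have hd0 := dist_pos hh hd
    have h2 : 1 * h ≤ M * h := by gcongr; exact le_max_left _ _
    have h3 : 2 * C * h ≤ M * h := by gcongr; exact le_max_right _ _
    exact ⟨by linarith, (div_le_iff₀ (by positivity)).2 (by linarith)⟩
  refine ⟨fun z hz => hg.exists_turningPair hz, ⟨M ^ (2 / 3 : ℝ), by positivity, 1, one_pos,
    ⟨C, hC, ?_⟩, ?_⟩, ?_, fun h z hh => ⟨?_, Hager.norm_one_sub_exp_phi_eq_zero_iff hg.smooth hh⟩,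
    1, one_pos, fun h z _ => ?_⟩
  · intro h z xp xm hh _ _ hd ht
    exact (H h z xp xm hh (dist_pos hh hd) (le_dist hh hd).1 ht).2
  · intro c hc
    obtain ⟨K, hK, HK⟩ := Hager.leadingTerm_comparable hc₁ hC hc
    refine ⟨K, hK, fun h z xp xm hh hh1 _ hd ht hz => ?_⟩
    obtain ⟨⟨b1, b2⟩, ε, hε, e⟩ := H h z xp xm hh (dist_pos hh hd) (le_dist hh hd).1 ht
    rw [e]
    exact HK g h z xp xm _ ε hh hh1 (dist_pos hh hd) b1 b2 hz (hε.trans (le_dist hh hd).2)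
  · intro c hc
    -- For d ≥ c, the choice h₁ = c^{3/2} already ensures h ≤ d^{3/2}.
    refine ⟨c ^ (3 / 2 : ℝ), by positivity, C / c ^ (3 / 2 : ℝ), by positivity, ?_⟩
    intro h z xp xm hh hh1 _ hd ht
    have h1 : c ^ (3 / 2 : ℝ) ≤ Hager.dBdry g z ^ (3 / 2 : ℝ) := by gcongr
    obtain ⟨-, ε, hε, e⟩ := H h z xp xm hh (hc.trans_le hd) (hh1.trans h1) ht
    refine ⟨ε, hε.trans ?_, e⟩
    rw [div_mul_eq_mul_div]
    gcongr
  · rw [Hager.phi_re, neg_mul, neg_nonpos]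
    have := Real.two_pi_pos
    positivity
  · rw [one_mul]
    exact Hager.abs_norm_one_sub_exp_phi_sub_one_le
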